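/- Let $K$ be an algebraically closed field of characteristic $0$ (for instance $K=\mathbb{C}$). Let $S=\mathrm{Spec}\,\mathcal{O}_S$ be a formal smooth surface, i.e. $\mathcal{O}_S\cong K[[x,y]]$ as a $K$-algebra, with closed point $P$, and let $D\subset S$ be a formal smooth curve, i.e. a closed subscheme with ideal $\mathbf{I}_D$ such that $\mathcal{O}_S/\mathbf{I}_D\cong K[[t]]$ as a $K$-algebra. Let $C=\mathbf{V}(F)\subset S$ be a reduced algebroid curve not containing $D$, that is, $F\in\mathcal{O}_S$, $\mathcal{O}_S/\langle F\rangle$ is reduced and $F\notin\mathbf{I}_D$. Then $$I^{\mathrm{ea}}(C)\subseteq I^{\mathrm{ea}}_{\log,D}(C)\subseteq I^{\mathrm{es}}_{\log,D}(C)\subseteq I^{\mathrm{ec}}(C),$$ where these ideals of $\mathcal{O}_S$ are defined as follows, in any coordinate system $x,y$ on $S$. * $I^{\mathrm{ea}}(C)=\langle\partial_xF,\partial_yF,F\rangle$ is the equianalytic (Tjurina) ideal. * $I^{\mathrm{ea}}_{\log,D}(C)=(\mathcal{T}F+\langle F\rangle):\mathbf{I}_D$ is the logarithmic equianalytic ideal,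 where $\mathcal{T}$ is the $\mathcal{O}_S$-module of $K$-derivations $\delta$ of $\mathcal{O}_S$ with $\delta(\mathbf{I}_D)\subseteq\mathbf{I}_D$ and $\delta(\mathfrak{m}_P)\subseteq\mathfrak{m}_P$, and $\mathcal{T}F=\{\delta F\mid\delta\in\mathcal{T}\}$. * $I^{\mathrm{es}}_{\log,D}(C)=\{g\in\mathcal{O}_S\mid \mathbf{V}(F+\epsilon g)\cup D_{K[\epsilon]}\text{ is equisingular over }K[\epsilon]\}:\mathbf{I}_D$ is the logarithmic equisingular ideal, where $\epsilon^2=0$ and the union is defined by the product of the equations. * $I^{\mathrm{ec}}(C)=(\nu^{\#})^{-1}(\langle\partial_xF,\partial_yF\rangle\mathcal{O}_{\bar C})$ is the equiclassical ideal, where $\nu:\bar C\to C$ is the normalization and $\nu^{\#}:\mathcal{O}_S\to\mathcal{O}_{\bar C}$ the induced homomorphism. Here a deformation $\mathcal{Z}\subset S_{K[\epsilon]}$ over $K[\epsilon]$ of a nonempty reduced curve $Z\subset S$ is called equisingular if it is equisingular along some section $\mathcal{P}\subset\mathcal{Z}$ over $K[\epsilon]$, which is defined inductively: if $Z$ is smooth,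 $\mathcal{Z}$ is equisingular along every section $\mathcal{P}\subset\mathcal{Z}$; if $Z$ is a node, $\mathcal{Z}$ is equisingular along $\mathcal{P}$ if and only if it is equimultiple along $\mathcal{P}$; otherwise, $\mathcal{Z}$ is equisingular along $\mathcal{P}$ if and only if it is equimultiple along $\mathcal{P}$ and the reduced total transform of $\mathcal{Z}$ on the blow-up of $S_{K[\epsilon]}$ along $\mathcal{P}$ is, after completion at each of its closed points, equisingular along some section lying over $\mathcal{P}$. Equimultiple along $\mathcal{P}$ means that the equation of $\mathcal{Z}$ lies in $\mathbf{I}_{\mathcal{P}}^{m}$, where $m$ is the multiplicity of $Z$. -/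

import Mathlib

open scoped DualNumber

noncomputable section

namespace LogCurve

/-! ### Curves over the dual numbers in the formal plane -/

/-- The coordinate ring `K[[x, y]]` of the standard formal smooth surface;
`x` is `X 0` and `y` is `X 1`. -/
abbrev Plane (K : Type*) [Field K] := MvPowerSeries (Fin 2) K

/-- The coordinate ring `K[ε][[x, y]]` of the trivial deformation over `K[ε]` of the formal smooth
surface. -/
abbrev PlaneEps (K : Type*) [Field K] := MvPowerSeries (Fin 2) K[ε]

/-- The family `F + ε g`. -/
def family {K : Type*} [Field K] (F g : Plane K) : PlaneEps K :=
  MvPowerSeries.map (TrivSqZeroExt.inlHom K K) F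
    + MvPowerSeries.C (ε : K[ε]) * MvPowerSeries.map (TrivSqZeroExt.inlHom K K) g

/-- Restriction of a function to the closed fibre `ε = 0`. -/
def closedFibre {K : Type*} [Field K] (𝓕 : PlaneEps K) : Plane K :=
  MvPowerSeries.map (TrivSqZeroExt.fstHom K K K).toRingHom 𝓕

/-- The ideal `⟨x - a ε, y - b ε⟩`. These are the ideals of the sections over `K[ε]`. -/
def sectionIdeal {K : Type*} [Field K] (a b : K) : Ideal (PlaneEps K) :=
  Ideal.span {MvPowerSeries.X 0 - MvPowerSeries.C (a • (ε : K[ε])),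
    MvPowerSeries.X 1 - MvPowerSeries.C (b • (ε : K[ε]))}

/-- The curve `F = 0` is smooth (and nonempty). -/
def IsSmoothCurve {K : Type*} [Field K] (F : Plane K) : Prop :=
  F.order = 1

/-- The curve `F = 0` is a node: an ordinary double point, i.e. `F` has multiplicity two and its
quadratic part has two distinct linear factors. -/
def IsNode {K : Type*} [Field K] (F : Plane K) : Prop :=
  F.order = 2 ∧
    MvPowerSeries.coeff (Finsupp.single 0 1 + Finsupp.single 1 1) F ^ 2
      - 4 * MvPowerSeries.coeff (Finsupp.single 0 2) F
        * MvPowerSeries.coeff (Finsupp.single 1 2) F ≠ 0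

/-- Pull-back of functions to the completion, at the point with direction `(1 : c)` of the
exceptional curve, of the blow-up along the section `⟨x - a ε, y - b ε⟩`:
`x = x₁ + a ε`, `y = x₁ (y₁ + c) + b ε`. The exceptional curve is `x₁ = 0`. -/
def chart {K : Type*} [Field K] (a b c : K) (𝓕 : PlaneEps K) : PlaneEps K :=
  MvPowerSeries.subst (R := K[ε]) (S := K[ε])
    ![MvPowerSeries.X 0 + MvPowerSeries.C (a • (ε : K[ε])),
      MvPowerSeries.X 0 * (MvPowerSeries.X 1 + MvPowerSeries.C (algebraMap K K[ε] c))
        + MvPowerSeries.C (b • (ε : K[ε]))] 𝓕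

/-- Pull-back of functions to the completion, at the remaining point `(0 : 1)` of the exceptional
curve, of the blow-up along the section `⟨x - a ε, y - b ε⟩`:
`x = x₁ y₁ + a ε`, `y = y₁ + b ε`. The exceptional curve is `y₁ = 0`. -/
def chartInfty {K : Type*} [Field K] (a b : K) (𝓕 : PlaneEps K) : PlaneEps K :=
  MvPowerSeries.subst (R := K[ε]) (S := K[ε])
    ![MvPowerSeries.X 0 * MvPowerSeries.X 1 + MvPowerSeries.C (a • (ε : K[ε])),
      MvPowerSeries.X 1 + MvPowerSeries.C (b • (ε : K[ε]))] 𝓕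

/-- `IsEquisingularAlong 𝓕 a b`: the curve `𝓕 = 0` in the trivial deformation over `K[ε]` of the
formal plane is an equisingular deformation of its closed fibre along the section
`⟨x - a ε, y - b ε⟩`.
* A deformation of a smooth curve is equisingular along every section contained in it.
* A deformation of a node is equisingular along a section iff it is equimultiple along it.
* Otherwise, it is equisingular along a section iff it is equimultiple along it and, on the blow-up
  along the section, the reduced total transform is at every closed point of the exceptional curve
  equisingular along some section lying over the given one. At the direction `(1 : c)` the total
  transform is `x₁ ^ m * 𝓖 c`, with `m` the multiplicity; the reduced total transform is
  `x₁ * 𝓖 c`; and the sections lying over the given one are the `⟨x₁, y₁ - s c ε⟩`. Similarly for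
  `(0 : 1)`. -/
inductive IsEquisingularAlong {K : Type*} [Field K] : PlaneEps K → K → K → Prop
  | smooth (𝓕 : PlaneEps K) (a b : K)
      (smooth : IsSmoothCurve (closedFibre 𝓕))
      (mem : 𝓕 ∈ sectionIdeal a b) :
      IsEquisingularAlong 𝓕 a b
  | node (𝓕 : PlaneEps K) (a b : K)
      (node : IsNode (closedFibre 𝓕))
      (equimultiple : 𝓕 ∈ sectionIdeal a b ^ 2) :
      IsEquisingularAlong 𝓕 a b
  | blowup (𝓕 : PlaneEps K) (a b : K) (m : ℕ)
      (mult : (closedFibre 𝓕).order = m)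
      (singular : 2 ≤ m)
      (not_node : ¬ IsNode (closedFibre 𝓕))
      (equimultiple : 𝓕 ∈ sectionIdeal a b ^ m)
      (𝓖 : K → PlaneEps K) (s : K → K)
      (transform : ∀ c, chart a b c 𝓕 = MvPowerSeries.X 0 ^ m * 𝓖 c)
      (equisingular : ∀ c, IsEquisingularAlong (MvPowerSeries.X 0 * 𝓖 c) 0 (s c))
      (𝓖' : PlaneEps K) (s' : K)
      (transform_infty : chartInfty a b 𝓕 = MvPowerSeries.X 1 ^ m * 𝓖')
      (equisingular_infty : IsEquisingularAlong (MvPowerSeries.X 1 * 𝓖') s' 0) :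
      IsEquisingularAlong 𝓕 a b

/-- The deformation `𝓕 = 0` (of a curve through the closed point) is equisingular: it is so along
some section. -/
def IsEquisingular {K : Type*} [Field K] (𝓕 : PlaneEps K) : Prop :=
  ∃ a b : K, IsEquisingularAlong 𝓕 a b

/-! ### Ideals attached to a curve in a formal smooth surface

A formal smooth surface is `Spec R` for a `K`-algebra `R` isomorphic to `K[[x, y]]`; an isomorphism
`φ` is a coordinate system on it. -/

section Surface

/-- The partial derivative `∂F/∂x` (for `i = 0`) or `∂F/∂y` (for `i = 1`) in the coordinate
system `φ`. -/
def partialDeriv {K R : Type*} [Field K] [CommRing R] [Algebra K R] (φ : R ≃ₐ[K] Plane K)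
    (i : Fin 2) (F : R) : R :=
  φ.symm (MvPowerSeries.pderiv K i (φ F))

/-- The ideal of the closed point of the surface. -/
def pointIdeal {K R : Type*} [Field K] [CommRing R] [Algebra K R] (φ : R ≃ₐ[K] Plane K) :
    Ideal R :=
  RingHom.ker ((MvPowerSeries.constantCoeff (σ := Fin 2) (R := K)).comp (φ : R →+* Plane K))

/-- `D = V(I)` is a formal smooth curve. -/
def IsFormalSmoothCurve (K : Type*) {R : Type*} [Field K] [CommRing R] [Algebra K R]
    (I : Ideal R) : Prop :=
  Nonempty ((R ⧸ I) ≃ₐ[K] PowerSeries K)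

/-- The equianalytic (Tjurina) ideal `⟨∂F/∂x, ∂F/∂y, F⟩` of `C = V(F)`. -/
def equianalyticIdeal {K R : Type*} [Field K] [CommRing R] [Algebra K R] (φ : R ≃ₐ[K] Plane K)
    (F : R) : Ideal R :=
  Ideal.span {partialDeriv φ 0 F, partialDeriv φ 1 F, F}

/-- The ideal `T F + ⟨F⟩` of `C = V(F)` relative to `D = V(I)` and the closed point `P`, where `T`
is the module of derivations preserving `D` and `P`. -/
def relEquianalyticIdeal {K R : Type*} [Field K] [CommRing R] [Algebra K R]
    (φ : R ≃ₐ[K] Plane K) (I : Ideal R) (F : R) : Ideal R :=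
  Ideal.span {g | ∃ δ : Derivation K R R,
    (∀ f ∈ I, δ f ∈ I) ∧ (∀ f ∈ pointIdeal φ, δ f ∈ pointIdeal φ) ∧ g = δ F} ⊔ Ideal.span {F}

/-- The logarithmic equianalytic ideal of `C = V(F)` relative to `D = V(I)`. -/
def logEquianalyticIdeal {K R : Type*} [Field K] [CommRing R] [Algebra K R]
    (φ : R ≃ₐ[K] Plane K) (I : Ideal R) (F : R) : Ideal R :=
  (relEquianalyticIdeal φ I F).colon (I : Set R)

/-- The `g` such that the union of `V(F + ε g)` and of the trivial deformation of `D = V(I)` is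
equisingular; `y` is an equation of `D`. -/
def relEquisingular {K R : Type*} [Field K] [CommRing R] [Algebra K R]
    (φ : R ≃ₐ[K] Plane K) (I : Ideal R) (F : R) : Set R :=
  {g | ∃ y : R, I = Ideal.span {y} ∧
    IsEquisingular (family (φ y) 0 * family (φ F) (φ g))}

/-- The logarithmic equisingular ideal of `C = V(F)` relative to `D = V(I)`: the quotient of
`relEquisingular φ I F` by `I`. -/
def logEquisingular {K R : Type*} [Field K] [CommRing R] [Algebra K R]
    (φ : R ≃ₐ[K] Plane K) (I : Ideal R) (F : R) : Set R :=
  {h | ∀ d ∈ I, h * d ∈ relEquisingular φ I F}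

/-- The coordinate ring of the normalization of `C = V(F)`: the integral closure of `R ⧸ ⟨F⟩` in its
total ring of fractions. -/
abbrev Normalization {R : Type*} [CommRing R] (F : R) : Type _ :=
  integralClosure (R ⧸ Ideal.span {F}) (FractionRing (R ⧸ Ideal.span {F}))

/-- The homomorphism from `R` to the coordinate ring of the normalization of `C = V(F)`. -/
def toNormalization {R : Type*} [CommRing R] (F : R) : R →+* Normalization F :=
  (algebraMap (R ⧸ Ideal.span {F}) (Normalization F)).comp (Ideal.Quotient.mk (Ideal.span {F}))

/-- The equiclassical ideal of `C = V(F)`: the functions whose pull-back to the normalization lies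
in the ideal generated there by `∂F/∂x` and `∂F/∂y`. -/
def equiclassicalIdeal {K R : Type*} [Field K] [CommRing R] [Algebra K R] (φ : R ≃ₐ[K] Plane K)
    (F : R) : Ideal R :=
  ((Ideal.span {partialDeriv φ 0 F, partialDeriv φ 1 F}).map (toNormalization F)).comap
    (toNormalization F)

end Surface

end LogCurve

end

/-!
# The logarithmic equianalytic and equisingular ideals of a plane curve singularity

The inclusion of the equianalytic ideal in the logarithmic one is formal: if `y` is an equation of
`D`, the derivations `y ∂ᵢ` preserve `D` and the closed point.

**Equianalytic implies equisingular.** A derivation `δ` preserving `D` integrates over `K[ε]` to an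
automorphism of the plane that trivializes the deformation `V(F + ε (δ F + a F)) ∪ D`, up to a unit.
So it has to be shown that a deformation of a reduced curve which is the trivial one up to such an
automorphism is equisingular along the section to which the automorphism moves the closed point
(`isEquisingular_of_derivation`). The automorphism lifts to the blow-up, so that this is an
induction on the embedded resolution of the curve by finitely many blow-ups (`Resolvable`). The
existence of the latter (`ArcReduced.resolvable`) is proved by induction on the multiplicity of the
part of the total transform that is not exceptional: an infinite chain of points at which it does
not drop would produce an arc along which the curve is not reduced.

**Equisingular implies equiclassical.** Every branch `θ` of a reduced curve `G = 0` lifts to an arc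
`θ + ε ξ` over `K[ε]` on each equisingular deformation `𝓖` of it, and if `𝓖` is the union of two
components, one of them smooth over the closed fibre, the intersection of the components is
constant to first order along the lifted branch (`exists_branchLift`). The proof is by induction
along the blow-ups, lifting the branch to the strict transform; the exceptional curve serves as the
smooth component there. For `𝓖 = V(F + ε g) ∪ D`, the branch `D` itself shows that the section is
trivial (`section_eq_zero`). Along each branch `θ` of `F = 0` the two statements then say that
`g = -∑ ξₖ ∂ₖF` and that `∑ ξₖ ∂ₖ y` is a multiple of `y`. Comparing `ξ` with the velocity of `θ`,
which is tangent to `F = 0`, one finds that `g / y` lies in the ideal of the partial derivatives of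
`F` on the branch (`mem_span_of_branchLift`).

It remains to pass from the branches to the normalization (`mem_equiclassicalIdeal`). By the theorem
of Newton and Puiseux (`exists_puiseux_root`) every minimal prime over `F` is the kernel of a
parametrization over which `K[[t]]` is integral (`exists_arc_ker_eq`). A generic combination `f` of
the two partial derivatives generates their ideal on all branches, and if `f` divides `h` on every
branch, then `h / f` is integral over the coordinate ring of the curve
(`exists_integral_fraction`). That the partial derivatives do not both vanish on a branch of a
reduced curve is `arcReduced_of_isRadical`.
-/

noncomputable section

namespace LogCurve

section Plane

open MvPowerSeries (X C coeff constantCoeff pderiv order)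

variable {K : Type*} [Field K]

/-! ### The formal plane -/

theorem rev_ne (i : Fin 2) : i.rev ≠ i := by fin_cases i <;> decide

theorem eq_or_eq_rev (i k : Fin 2) : k = i ∨ k = i.rev := by
  fin_cases i <;> fin_cases k <;> decide

theorem sum_eq_add_rev {M : Type*} [AddCommMonoid M] (i : Fin 2) (f : Fin 2 → M) :
    ∑ k, f k = f i + f i.rev := by
  fin_cases i
  · simp [Fin.sum_univ_two]
  · simp [Fin.sum_univ_two, add_comm]

/-- Every `f` is `f' + X i.rev * g` with `f'` free of the monomials that involve `X i.rev`. -/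
theorem exists_eq_add_X_rev_mul (i : Fin 2) (f : Plane K) :
    ∃ f' g : Plane K, f = f' + X i.rev * g ∧ (∀ n, n i.rev = 0 → coeff n f' = coeff n f) ∧
      (∀ n, n i.rev ≠ 0 → coeff n f' = 0) := by
  classical
  let f' : Plane K := fun n => if n i.rev = 0 then coeff n f else 0
  have hf' : ∀ n, coeff n f' = if n i.rev = 0 then coeff n f else 0 := fun n => rfl
  have : X i.rev ∣ f - f' := by
    rw [MvPowerSeries.X_dvd_iff]
    intro n hn
    simp [hf', hn]
  obtain ⟨g, hg⟩ := this
  refine ⟨f', g, by rw [← hg]; ring, ?_, ?_⟩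
  · intro n hn; simp [hf', hn]
  · intro n hn; simp [hf', hn]

theorem exists_eq_C_add (f : Plane K) :
    ∃ g : Fin 2 → Plane K, f = C (constantCoeff f) + ∑ k, X k * g k := by
  obtain ⟨f', g, h, h1, h2⟩ := exists_eq_add_X_rev_mul 0 f
  have : X 0 ∣ f' - C (constantCoeff f) := by
    rw [MvPowerSeries.X_dvd_iff]
    intro n hn
    classical
    by_cases h1' : n (Fin.rev 0) = 0
    · have : n = 0 := by
        ext k; rcases eq_or_eq_rev 0 k with rfl | rfl
        · exact hn
        · exact h1'
      subst this
      rw [map_sub, h1 0 h1']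
      simp
    · have : n ≠ 0 := by rintro rfl; simp at h1'
      rw [map_sub, h2 n h1', MvPowerSeries.coeff_C, if_neg this, sub_zero]
  obtain ⟨g', hg'⟩ := this
  refine ⟨![g', g], ?_⟩
  rw [Fin.sum_univ_two]
  have e : f' = C (constantCoeff f) + X 0 * g' := by rw [← hg']; ring
  conv_lhs => rw [h, e]
  simp [add_assoc]

theorem exists_eq_sum_of_constantCoeff_eq_zero {f : Plane K} (hf : constantCoeff f = 0) :
    ∃ g : Fin 2 → Plane K, f = ∑ k, X k * g k := by
  obtain ⟨g, hg⟩ := exists_eq_C_add f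
  exact ⟨g, by simpa [hf] using hg⟩

/-- An additive map on `K[[x, y]]` that vanishes on constants and is semilinear for multiplication
by the coordinates, the multipliers lying in an ideal with zero infinite power, vanishes. This is
how continuous maps are recognised by their values on the coordinates. -/
theorem eq_zero_of_X_mul {B : Type*} [CommRing B] {J : Ideal B} (hJ : ⨅ n : ℕ, J ^ n = ⊥)
    (e : Plane K →+ B) (j : Fin 2 → B) (hj : ∀ k, j k ∈ J) (h0 : ∀ c, e (C c) = 0)
    (hX : ∀ k f, e (X k * f) = j k * e f) (f : Plane K) : e f = 0 := by
  have key : ∀ n : ℕ, ∀ f, e f ∈ J ^ n := by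
    intro n
    induction n with
    | zero => intro f; simp
    | succ n ih =>
      intro f
      obtain ⟨g, hg⟩ := exists_eq_C_add f
      rw [hg, map_add, h0, zero_add, map_sum]
      refine Ideal.sum_mem _ fun k _ => ?_
      rw [hX, pow_succ']
      exact Ideal.mul_mem_mul (hj k) (ih _)
  have : e f ∈ ⨅ n : ℕ, J ^ n := by simpa [Ideal.mem_iInf] using fun n => key n f
  simpa [hJ] using this

theorem algebraMap_eq_C (c : K) : algebraMap K (Plane K) c = C c := rfl

theorem algHom_ext_of_X {B : Type*} [CommRing B] [Algebra K B] {J : Ideal B}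
    (hJ : ⨅ n : ℕ, J ^ n = ⊥) (f g : Plane K →ₐ[K] B) (hf : ∀ k, f (X k) ∈ J)
    (h : ∀ k, f (X k) = g (X k)) : f = g := by
  ext a
  have := eq_zero_of_X_mul hJ (f.toLinearMap.toAddMonoidHom - g.toLinearMap.toAddMonoidHom)
    (fun k => f (X k)) hf
    (fun c => by
      change f (C c) - g (C c) = 0
      rw [← algebraMap_eq_C, f.commutes, g.commutes, sub_self])
    (fun k a => by
      change f (X k * a) - g (X k * a) = f (X k) * (f a - g a)
      rw [map_mul, map_mul, h]; ring) a
  exact sub_eq_zero.mp this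

/-- The ideal of the closed point of the plane. -/
def maxIdeal (K : Type*) [Field K] : Ideal (Plane K) := RingHom.ker (constantCoeff (σ := Fin 2))

theorem mem_maxIdeal {f : Plane K} : f ∈ maxIdeal K ↔ constantCoeff f = 0 := RingHom.mem_ker

theorem maxIdeal_eq_span : maxIdeal K = Ideal.span (Set.range (X : Fin 2 → Plane K)) := by
  apply le_antisymm
  · intro f hf
    obtain ⟨g, hg⟩ := exists_eq_sum_of_constantCoeff_eq_zero (mem_maxIdeal.mp hf)
    rw [hg]
    exact Ideal.sum_mem _ fun k _ => Ideal.mul_mem_right _ _ (Ideal.subset_span ⟨k, rfl⟩)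
  · rw [Ideal.span_le]
    rintro _ ⟨k, rfl⟩
    simp [mem_maxIdeal]

theorem maxIdeal_ne_top : maxIdeal K ≠ ⊤ := RingHom.ker_ne_top _

theorem isUnit_iff {f : Plane K} : IsUnit f ↔ constantCoeff f ≠ 0 := by
  rw [MvPowerSeries.isUnit_iff_constantCoeff, isUnit_iff_ne_zero]

theorem iInf_maxIdeal_pow : ⨅ n : ℕ, maxIdeal K ^ n = ⊥ :=
  Ideal.iInf_pow_eq_bot_of_isLocalRing _ maxIdeal_ne_top

theorem iInf_span_X_pow :
    ⨅ n : ℕ, Ideal.span {(PowerSeries.X : PowerSeries K)} ^ n = ⊥ :=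
  Ideal.iInf_pow_eq_bot_of_isLocalRing _ (by
    rw [Ne, Ideal.span_singleton_eq_top]
    exact PowerSeries.X_prime.not_isUnit)

theorem X_prime (i : Fin 2) : Prime (X i : Plane K) := by
  have h0 : Prime (X 0 : Plane K) := by
    rw [← MulEquiv.prime_iff (MvPowerSeries.finSuccEquiv K 1).toMulEquiv]
    have : IsDomain (MvPowerSeries (Fin 1) K) := NoZeroDivisors.to_isDomain _
    simpa using PowerSeries.X_prime
  obtain rfl | rfl := eq_or_eq_rev 0 i
  · exact h0
  · rw [← MulEquiv.prime_iff (MvPowerSeries.renameEquiv K (Fin.revPerm (n := 2))).toMulEquiv]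
    simpa using h0

/-- A derivation of `K[[x, y]]` is determined by its values on the coordinates. -/
theorem derivation_eq_sum (δ : Derivation K (Plane K) (Plane K)) (f : Plane K) :
    δ f = ∑ k, δ (X k) * pderiv K k f := by
  have := eq_zero_of_X_mul iInf_maxIdeal_pow
    ((δ - ∑ k, δ (X k) • pderiv K k : Derivation K (Plane K) (Plane K)) :
      Plane K →ₗ[K] Plane K).toAddMonoidHom (fun k => X k) (fun k => by simp [mem_maxIdeal])
    (fun c => by
      change (δ - ∑ k, δ (X k) • pderiv K k : Derivation K (Plane K) (Plane K)) (C c) = 0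
      rw [← algebraMap_eq_C, Derivation.map_algebraMap])
    (fun k a => by
      change (δ - ∑ k, δ (X k) • pderiv K k : Derivation K (Plane K) (Plane K)) (X k * a) =
        X k * (δ - ∑ k, δ (X k) • pderiv K k : Derivation K (Plane K) (Plane K)) a
      have h0 : (δ - ∑ k, δ (X k) • pderiv K k : Derivation K (Plane K) (Plane K)) (X k) = 0 := by
        fin_cases k <;> simp [Fin.sum_univ_two]
      rw [Derivation.leibniz, h0]; simp) f
  have h2 : (δ - ∑ k, δ (X k) • pderiv K k : Derivation K (Plane K) (Plane K)) f = 0 := this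
  simpa [Fin.sum_univ_two, sub_eq_zero] using h2

/-! ### Orders -/

theorem order_eq_zero_iff {f : Plane K} : f.order = 0 ↔ constantCoeff f ≠ 0 := by
  rw [← not_iff_not, not_not, ← MvPowerSeries.order_ne_zero_iff_constCoeff_eq_zero]

theorem one_le_order_iff {f : Plane K} : 1 ≤ f.order ↔ constantCoeff f = 0 :=
  MvPowerSeries.one_le_order_iff_constCoeff_eq_zero

theorem order_ge_of_mem_pow {f : Plane K} {m : ℕ} (h : f ∈ maxIdeal K ^ m) : (m : ℕ∞) ≤ f.order := by
  induction m generalizing f with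
  | zero => simp
  | succ m ih =>
    rw [pow_succ'] at h
    induction h using Submodule.mul_induction_on' with
    | mem_mul_mem a ha b hb =>
      refine le_trans ?_ MvPowerSeries.le_order_mul
      have := one_le_order_iff.mpr (mem_maxIdeal.mp ha)
      rw [Nat.cast_succ, add_comm]
      exact add_le_add this (ih hb)
    | add a _ b _ ha hb => exact le_trans (le_min ha hb) MvPowerSeries.min_order_le_add

/-- A series of order at least `m` is a form of degree `m` in the coordinates, with coefficients
power series. -/
theorem exists_eq_sum_of_le_order (i : Fin 2) {m : ℕ} {f : Plane K} (h : (m : ℕ∞) ≤ f.order) :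
    ∃ a : ℕ → Plane K, f = ∑ j ∈ Finset.range (m + 1), a j * X i ^ (m - j) * X i.rev ^ j ∧
      constantCoeff (a 0) = coeff (Finsupp.single i m) f := by
  induction m generalizing f with
  | zero => exact ⟨fun _ => f, by simp⟩
  | succ m ih =>
    obtain ⟨f', g, hf, h1, h2⟩ := exists_eq_add_X_rev_mul i f
    have hg : (m : ℕ∞) ≤ g.order := by
      refine MvPowerSeries.nat_le_order fun d hd => ?_
      have e1 : coeff (d + Finsupp.single i.rev 1) f = coeff d g := by
        rw [hf, map_add, h2 _ (by simp), zero_add, add_comm]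
        simpa [MvPowerSeries.X] using
          MvPowerSeries.coeff_add_monomial_mul (Finsupp.single i.rev 1) d g (1 : K)
      rw [← e1]
      refine MvPowerSeries.coeff_of_lt_order (lt_of_lt_of_le ?_ h)
      rw [map_add, Finsupp.degree_single]
      exact_mod_cast Nat.add_lt_add_right hd 1
    have hf' : X i ^ (m + 1) ∣ f' := by
      rw [MvPowerSeries.X_pow_dvd_iff]
      intro n hn
      by_cases hn' : n i.rev = 0
      · rw [h1 n hn']
        refine MvPowerSeries.coeff_of_lt_order (lt_of_lt_of_le ?_ h)
        rw [Finsupp.degree_eq_sum, sum_eq_add_rev i, hn', add_zero]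
        exact_mod_cast hn
      · exact h2 n hn'
    obtain ⟨a, ha, -⟩ := ih hg
    obtain ⟨b, hb⟩ := hf'
    refine ⟨fun j => Nat.casesOn j b a, ?_, ?_⟩
    · rw [Finset.sum_range_succ']
      conv_lhs => rw [hf, hb, ha]
      simp only [Finset.mul_sum, Nat.add_sub_add_right, Nat.sub_zero, pow_zero, mul_one]
      rw [add_comm]
      congr 1
      · exact Finset.sum_congr rfl fun j _ => by ring
      · exact mul_comm _ _
    · change constantCoeff b = _
      rw [← h1 _ (by simp [rev_ne]), hb, MvPowerSeries.X_pow_eq]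
      simpa using (MvPowerSeries.coeff_add_monomial_mul (Finsupp.single i (m+1)) 0 b (1:K)).symm

theorem mem_maxIdeal_pow {f : Plane K} {m : ℕ} :
    f ∈ maxIdeal K ^ m ↔ (m : ℕ∞) ≤ f.order := by
  refine ⟨order_ge_of_mem_pow, fun h => ?_⟩
  obtain ⟨a, ha, -⟩ := exists_eq_sum_of_le_order 0 h
  rw [ha]
  refine Ideal.sum_mem _ fun j hj => ?_
  have hX : ∀ k, (X k : Plane K) ∈ maxIdeal K := fun k => by simp [mem_maxIdeal]
  have hj' : j ≤ m := Nat.lt_succ_iff.mp (Finset.mem_range.mp hj)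
  have : X 0 ^ (m - j) * X (Fin.rev 0) ^ j ∈ maxIdeal K ^ (m - j) * maxIdeal K ^ j :=
    Ideal.mul_mem_mul (Ideal.pow_mem_pow (hX _) _) (Ideal.pow_mem_pow (hX _) _)
  rw [← pow_add, Nat.sub_add_cancel hj'] at this
  rw [mul_assoc]
  exact Ideal.mul_mem_left _ _ this

instance : IsDomain (Plane K) := NoZeroDivisors.to_isDomain _

theorem ringHom_ext_of_X {B : Type*} [CommRing B] {J : Ideal B}
    (hJ : ⨅ n : ℕ, J ^ n = ⊥) (f g : Plane K →+* B) (hC : ∀ c, f (C c) = g (C c))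
    (hf : ∀ k, f (X k) ∈ J) (h : ∀ k, f (X k) = g (X k)) (a : Plane K) : f a = g a := by
  have := eq_zero_of_X_mul hJ (f.toAddMonoidHom - g.toAddMonoidHom) (fun k => f (X k)) hf
    (fun c => by
      change f (C c) - g (C c) = 0
      rw [hC, sub_self])
    (fun k a => by
      change f (X k * a) - g (X k * a) = f (X k) * (f a - g a)
      rw [map_mul, map_mul, h]; ring) a
  exact sub_eq_zero.mp this

/-! ### Arcs in the formal plane -/

/-- An arc in the formal plane: a `K`-algebra homomorphism to `K[[t]]`. It is automatically local,
and it is determined by the images of the two coordinates. -/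
abbrev Arc (K : Type*) [Field K] := Plane K →ₐ[K] PowerSeries K

theorem constantCoeff_arc (θ : Arc K) (f : Plane K) :
    PowerSeries.constantCoeff (θ f) = constantCoeff f := by
  set d := PowerSeries.constantCoeff (θ f)
  by_contra hne
  have hu : IsUnit (f - C d) := by
    rw [isUnit_iff]
    simpa [sub_eq_zero] using fun h => hne h.symm
  have h1 := hu.map θ
  rw [map_sub, ← algebraMap_eq_C, θ.commutes, PowerSeries.isUnit_iff_constantCoeff] at h1
  apply h1.ne_zero
  rw [map_sub]
  change d - PowerSeries.constantCoeff (PowerSeries.C d) = 0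
  simp

theorem X_dvd_iff_constantCoeff {f : PowerSeries K} :
    PowerSeries.X ∣ f ↔ PowerSeries.constantCoeff f = 0 := PowerSeries.X_dvd_iff

theorem X_dvd_arc_X (θ : Arc K) (k : Fin 2) : PowerSeries.X ∣ θ (X k) := by
  rw [X_dvd_iff_constantCoeff, constantCoeff_arc]; simp

theorem arc_C (θ : Arc K) (c : K) : θ (C c) = PowerSeries.C c := by
  rw [← algebraMap_eq_C, θ.commutes]; rfl

theorem arc_ext {θ θ' : Arc K} (h : ∀ k, θ (X k) = θ' (X k)) : θ = θ' :=
  algHom_ext_of_X iInf_span_X_pow θ θ'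
    (fun k => Ideal.mem_span_singleton.mpr (X_dvd_arc_X θ k)) h

/-- The arc with given coordinates. -/
def arcOf (v : Fin 2 → PowerSeries K) (hv : ∀ k, PowerSeries.constantCoeff (v k) = 0) : Arc K :=
  MvPowerSeries.substAlgHom (R := K) (S := K) (a := v)
    (MvPowerSeries.hasSubst_of_constantCoeff_zero hv)

theorem arcOf_X (v : Fin 2 → PowerSeries K) (hv : ∀ k, PowerSeries.constantCoeff (v k) = 0)
    (k : Fin 2) : arcOf v hv (X k) = v k :=
  MvPowerSeries.substAlgHom_X _ k

/-- The arc is not the constant arc at the closed point. -/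
def Arc.Nonconst (θ : Arc K) : Prop := ∃ k, θ (X k) ≠ 0

/-- Chain rule along an arc. -/
theorem derivative_arc (θ : Arc K) (f : Plane K) :
    PowerSeries.derivative K (θ f) =
      ∑ k, θ (pderiv K k f) * PowerSeries.derivative K (θ (X k)) := by
  let e : Plane K →+ PowerSeries K :=
    { toFun := fun f => PowerSeries.derivative K (θ f) -
        ∑ k, θ (pderiv K k f) * PowerSeries.derivative K (θ (X k))
      map_zero' := by simp
      map_add' := fun a b => by simp [Fin.sum_univ_two]; ring }
  have := eq_zero_of_X_mul iInf_span_X_pow e (fun k => θ (X k))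
    (fun k => Ideal.mem_span_singleton.mpr (X_dvd_arc_X θ k))
    (fun c => by simp [e, arc_C])
    (fun k a => by
      fin_cases k <;>
      simp [e, Fin.sum_univ_two, Derivation.leibniz] <;> ring) f
  exact sub_eq_zero.mp this

/-! ### Blowing up -/

/-- Pull-back of functions to the completion of the blow-up at the point of the exceptional curve
`X i = 0` with slope `c`. With `i = 0` this covers the directions `(1 : c)`; the remaining
direction `(0 : 1)` is `i = 1` and `c = 0`. -/
def blow (i : Fin 2) (c : K) : Plane K →ₐ[K] Plane K :=
  MvPowerSeries.substAlgHom (R := K) (S := K)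
    (a := fun k => if k = i then X i else X i * (X i.rev + C c))
    (MvPowerSeries.hasSubst_of_constantCoeff_zero fun k => by split_ifs <;> simp)

theorem blow_X (i : Fin 2) (c : K) : blow i c (X i) = X i := by
  rw [blow, MvPowerSeries.substAlgHom_X, if_pos rfl]

theorem blow_X_rev (i : Fin 2) (c : K) : blow i c (X i.rev) = X i * (X i.rev + C c) := by
  rw [blow, MvPowerSeries.substAlgHom_X, if_neg (rev_ne i)]

theorem blow_C (i : Fin 2) (c d : K) : blow i c (C d) = C d := by
  rw [← algebraMap_eq_C, AlgHom.commutes]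

theorem X_dvd_blow_X (i k : Fin 2) (c : K) : X i ∣ blow i c (X k) := by
  obtain rfl | rfl := eq_or_eq_rev i k
  · rw [blow_X]
  · rw [blow_X_rev]; exact dvd_mul_right _ _

theorem X_dvd_blow {i : Fin 2} {c : K} {f : Plane K} (hf : constantCoeff f = 0) :
    X i ∣ blow i c f := by
  obtain ⟨g, rfl⟩ := exists_eq_sum_of_constantCoeff_eq_zero hf
  rw [map_sum]
  refine Finset.dvd_sum fun k _ => ?_
  rw [map_mul]
  exact dvd_mul_of_dvd_left (X_dvd_blow_X _ _ _) _

theorem constantCoeff_blow (i : Fin 2) (c : K) (f : Plane K) :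
    constantCoeff (blow i c f) = constantCoeff f := by
  have h : X i ∣ blow i c (f - C (constantCoeff f)) := X_dvd_blow (by simp)
  obtain ⟨g, hg⟩ := h
  rw [map_sub, blow_C] at hg
  have := congrArg constantCoeff hg
  simpa [sub_eq_zero] using this

theorem blow_X_mem_maxIdeal (i k : Fin 2) (c : K) : blow i c (X k) ∈ maxIdeal K := by
  rw [mem_maxIdeal, constantCoeff_blow]; simp

/-- Chain rule for the blow-up, along the exceptional coordinate. -/
theorem pderiv_blow (i : Fin 2) (c : K) (f : Plane K) :
    pderiv K i (blow i c f) =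
      blow i c (pderiv K i f) + (X i.rev + C c) * blow i c (pderiv K i.rev f) := by
  let e : Plane K →+ Plane K :=
    { toFun := fun f => pderiv K i (blow i c f) -
        (blow i c (pderiv K i f) + (X i.rev + C c) * blow i c (pderiv K i.rev f))
      map_zero' := by simp
      map_add' := fun a b => by simp only [map_add]; ring }
  have := eq_zero_of_X_mul iInf_maxIdeal_pow e (fun k => blow i c (X k))
    (fun k => blow_X_mem_maxIdeal i k c)
    (fun d => by simp [e, blow_C])
    (fun k a => by
      obtain rfl | rfl := eq_or_eq_rev i k
      · simp only [e, AddMonoidHom.coe_mk, ZeroHom.coe_mk, map_mul, Derivation.leibniz, blow_X,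
          smul_eq_mul, map_add, MvPowerSeries.pderiv_X_self,
          MvPowerSeries.pderiv_X_of_ne (rev_ne k).symm, map_one, map_zero]
        ring
      · simp only [e, AddMonoidHom.coe_mk, ZeroHom.coe_mk, map_mul, Derivation.leibniz, blow_X_rev,
          smul_eq_mul, map_add, MvPowerSeries.pderiv_X_self, MvPowerSeries.pderiv_C,
          MvPowerSeries.pderiv_X_of_ne (rev_ne i), map_one, map_zero]
        ring) f
  exact sub_eq_zero.mp this

/-- Chain rule for the blow-up, along the other coordinate. -/
theorem pderiv_rev_blow (i : Fin 2) (c : K) (f : Plane K) :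
    pderiv K i.rev (blow i c f) = X i * blow i c (pderiv K i.rev f) := by
  let e : Plane K →+ Plane K :=
    { toFun := fun f => pderiv K i.rev (blow i c f) - X i * blow i c (pderiv K i.rev f)
      map_zero' := by simp
      map_add' := fun a b => by simp only [map_add]; ring }
  have := eq_zero_of_X_mul iInf_maxIdeal_pow e (fun k => blow i c (X k))
    (fun k => blow_X_mem_maxIdeal i k c)
    (fun d => by simp [e, blow_C])
    (fun k a => by
      obtain rfl | rfl := eq_or_eq_rev i k
      · simp only [e, AddMonoidHom.coe_mk, ZeroHom.coe_mk, map_mul, Derivation.leibniz, blow_X,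
          smul_eq_mul, map_add, MvPowerSeries.pderiv_X_of_ne (rev_ne k).symm, map_zero]
        ring
      · simp only [e, AddMonoidHom.coe_mk, ZeroHom.coe_mk, map_mul, Derivation.leibniz, blow_X_rev,
          smul_eq_mul, map_add, MvPowerSeries.pderiv_X_self, MvPowerSeries.pderiv_C,
          MvPowerSeries.pderiv_X_of_ne (rev_ne i).symm, map_one]
        ring) f
  exact sub_eq_zero.mp this

/-- The strict transform on the blow-up. Along the exceptional curve it is a nonzero polynomial of
degree at most the multiplicity. -/
theorem exists_strictTransform (i : Fin 2) (c : K) {f : Plane K} {m : ℕ} (hf : f.order = m) :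
    ∃ g : Plane K, blow i c f = X i ^ m * g ∧
      (∃ j ≤ m, coeff (Finsupp.single i.rev j) g ≠ 0) ∧
      (c = 0 → constantCoeff g = coeff (Finsupp.single i m) f) := by
  classical
  obtain ⟨a, ha, ha0⟩ := exists_eq_sum_of_le_order i hf.ge
  have key : ∀ j, ∃ b, blow i c (a j) = C (constantCoeff (a j)) + X i * b := fun j => by
    obtain ⟨b, hb⟩ := X_dvd_blow (i := i) (c := c) (f := a j - C (constantCoeff (a j))) (by simp)
    exact ⟨b, by rw [← hb, map_sub, blow_C]; ring⟩
  choose b hb using key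
  let p : Polynomial K := ∑ j ∈ Finset.range (m + 1), Polynomial.C (constantCoeff (a j)) *
    (Polynomial.X + Polynomial.C c) ^ j
  let G : Plane K := Polynomial.aeval (X i.rev : Plane K) p
  let B : Plane K := ∑ j ∈ Finset.range (m + 1), b j * (X i.rev + C c) ^ j
  have hG : G = ∑ j ∈ Finset.range (m + 1), C (constantCoeff (a j)) * (X i.rev + C c) ^ j := by
    simp [G, p, map_sum, algebraMap_eq_C]
  have hp : p ≠ 0 := by
    intro h0
    have hq : (∑ j ∈ Finset.range (m + 1), Polynomial.C (constantCoeff (a j)) *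
      Polynomial.X ^ j : Polynomial K) = 0 := by
      have := congrArg (Polynomial.compRingHom (Polynomial.X - Polynomial.C c)) h0
      simpa [p, map_sum] using this
    have hz : ∀ j ≤ m, constantCoeff (a j) = 0 := fun j hj => by
      have := congrArg (fun q => Polynomial.coeff q j) hq
      simpa [Polynomial.finsetSum_coeff, Polynomial.coeff_C_mul, Polynomial.coeff_X_pow,
        Nat.lt_succ_iff, hj, not_lt.mpr] using this
    have : f ∈ maxIdeal K ^ (m + 1) := by
      rw [ha]
      refine Ideal.sum_mem _ fun j hj => ?_
      have hX : ∀ k, (X k : Plane K) ∈ maxIdeal K := fun k => by simp [mem_maxIdeal]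
      have hj' : j ≤ m := Nat.lt_succ_iff.mp (Finset.mem_range.mp hj)
      have := Ideal.mul_mem_mul (Ideal.mul_mem_mul (mem_maxIdeal.mpr (hz j hj'))
        (Ideal.pow_mem_pow (hX i) (m - j))) (Ideal.pow_mem_pow (hX i.rev) j)
      rwa [← pow_succ', ← pow_add, show m - j + 1 + j = m + 1 by omega] at this
    have := mem_maxIdeal_pow.mp this
    rw [hf] at this
    exact absurd (by exact_mod_cast this : m + 1 ≤ m) (by omega)
  have hdeg : p.natDegree ≤ m := by
    refine Polynomial.natDegree_sum_le_of_forall_le _ _ fun j hj => ?_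
    refine (Polynomial.natDegree_C_mul_le _ _).trans ?_
    rw [Polynomial.natDegree_pow, Polynomial.natDegree_X_add_C, mul_one]
    exact Nat.lt_succ_iff.mp (Finset.mem_range.mp hj)
  have hcoeff : ∀ k, coeff (Finsupp.single i.rev k) G = p.coeff k := fun k => by
    simp only [G, Polynomial.aeval_eq_sum_range, map_sum]
    conv_rhs => rw [Polynomial.as_sum_range_C_mul_X_pow p, Polynomial.finsetSum_coeff]
    refine Finset.sum_congr rfl fun j _ => ?_
    rw [MvPowerSeries.coeff_smul, MvPowerSeries.coeff_X_pow, Polynomial.coeff_C_mul,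
      Polynomial.coeff_X_pow]
    by_cases hkj : k = j
    · simp [hkj]
    · have : Finsupp.single i.rev k ≠ Finsupp.single i.rev j := fun h =>
        hkj (Finsupp.single_injective _ h)
      simp [hkj, this]
  refine ⟨G + X i * B, ?_, ⟨p.natDegree, hdeg, ?_⟩, ?_⟩
  · conv_lhs => rw [ha]
    rw [map_sum, hG, Finset.mul_sum, ← Finset.sum_add_distrib, Finset.mul_sum]
    refine Finset.sum_congr rfl fun j hj => ?_
    have hj' : j ≤ m := Nat.lt_succ_iff.mp (Finset.mem_range.mp hj)
    rw [map_mul, map_mul, map_pow, map_pow, blow_X, blow_X_rev, hb, mul_pow,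
      ← Nat.sub_add_cancel hj']
    simp only [Nat.add_sub_cancel]
    ring
  · have : coeff (Finsupp.single i.rev p.natDegree) (X i * B) = 0 :=
      MvPowerSeries.X_dvd_iff.mp (dvd_mul_right _ _) _ (by simp [rev_ne])
    rw [map_add, this, add_zero, hcoeff]
    exact Polynomial.leadingCoeff_ne_zero.mpr hp
  · rintro rfl
    rw [← ha0, hG]
    simp [Finset.sum_range_succ']

/-! ### Series over the dual numbers -/

/-- The coefficient of `ε`. -/
def epsPart (𝓕 : PlaneEps K) : Plane K := fun n => (coeff n 𝓕).snd

theorem coeff_epsPart (𝓕 : PlaneEps K) (n) : coeff n (epsPart 𝓕) = (coeff n 𝓕).snd := rfl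

theorem coeff_closedFibre (𝓕 : PlaneEps K) (n) : coeff n (closedFibre 𝓕) = (coeff n 𝓕).fst := rfl

theorem planeEps_ext {𝓐 𝓑 : PlaneEps K} (h : closedFibre 𝓐 = closedFibre 𝓑)
    (h' : epsPart 𝓐 = epsPart 𝓑) : 𝓐 = 𝓑 := by
  ext n
  · rw [← coeff_closedFibre, h, coeff_closedFibre]
  · rw [← coeff_epsPart, h', coeff_epsPart]

theorem closedFibre_add (𝓐 𝓑 : PlaneEps K) :
    closedFibre (𝓐 + 𝓑) = closedFibre 𝓐 + closedFibre 𝓑 := map_add _ _ _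

theorem closedFibre_mul (𝓐 𝓑 : PlaneEps K) :
    closedFibre (𝓐 * 𝓑) = closedFibre 𝓐 * closedFibre 𝓑 := map_mul _ _ _

theorem closedFibre_pow (𝓐 : PlaneEps K) (n : ℕ) :
    closedFibre (𝓐 ^ n) = closedFibre 𝓐 ^ n := map_pow _ _ _

theorem closedFibre_X (i : Fin 2) : closedFibre (X i : PlaneEps K) = X i :=
  MvPowerSeries.map_X _ _

theorem closedFibre_C (a : K[ε]) : closedFibre (C a : PlaneEps K) = C a.fst :=
  MvPowerSeries.map_C _ _

theorem epsPart_add (𝓐 𝓑 : PlaneEps K) : epsPart (𝓐 + 𝓑) = epsPart 𝓐 + epsPart 𝓑 := by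
  ext n; simp [coeff_epsPart]

theorem epsPart_mul (𝓐 𝓑 : PlaneEps K) :
    epsPart (𝓐 * 𝓑) = closedFibre 𝓐 * epsPart 𝓑 + closedFibre 𝓑 * epsPart 𝓐 := by
  classical
  ext n
  rw [mul_comm (closedFibre 𝓑)]
  simp only [coeff_epsPart, map_add, MvPowerSeries.coeff_mul, coeff_closedFibre,
    TrivSqZeroExt.snd_sum, TrivSqZeroExt.snd_mul, ← Finset.sum_add_distrib, smul_eq_mul,
    MulOpposite.smul_eq_mul_unop, MulOpposite.unop_op]

theorem epsPart_X (i : Fin 2) : epsPart (X i : PlaneEps K) = 0 := by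
  classical
  ext n; rw [coeff_epsPart, MvPowerSeries.coeff_X]; split_ifs <;> simp

theorem epsPart_C (a : K[ε]) : epsPart (C a : PlaneEps K) = C a.snd := by
  classical
  ext n; rw [coeff_epsPart, MvPowerSeries.coeff_C, MvPowerSeries.coeff_C]; split_ifs <;> simp

theorem closedFibre_map (F : Plane K) :
    closedFibre (MvPowerSeries.map (TrivSqZeroExt.inlHom K K) F) = F := by
  ext n; rw [coeff_closedFibre, MvPowerSeries.coeff_map]; simp

theorem epsPart_map (F : Plane K) :
    epsPart (MvPowerSeries.map (TrivSqZeroExt.inlHom K K) F) = 0 := by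
  ext n; rw [coeff_epsPart, MvPowerSeries.coeff_map]; simp

theorem closedFibre_family (F g : Plane K) : closedFibre (family F g) = F := by
  rw [family, closedFibre_add, closedFibre_mul, closedFibre_map, closedFibre_C]; simp

theorem epsPart_family (F g : Plane K) : epsPart (family F g) = g := by
  rw [family, epsPart_add, epsPart_mul, epsPart_map, epsPart_map, closedFibre_map, closedFibre_C,
    epsPart_C]; simp

theorem family_eq (𝓕 : PlaneEps K) : family (closedFibre 𝓕) (epsPart 𝓕) = 𝓕 :=
  planeEps_ext (closedFibre_family _ _) (epsPart_family _ _)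

theorem X_dvd_planeEps {i : Fin 2} {𝓐 : PlaneEps K} (h : X i ∣ closedFibre 𝓐)
    (h' : X i ∣ epsPart 𝓐) : X i ∣ 𝓐 := by
  obtain ⟨a, ha⟩ := h
  obtain ⟨b, hb⟩ := h'
  refine ⟨family a b, planeEps_ext ?_ ?_⟩
  · rw [closedFibre_mul, closedFibre_X, closedFibre_family, ha]
  · rw [epsPart_mul, closedFibre_X, epsPart_X, epsPart_family, hb]; simp

theorem X_mul_cancel {i : Fin 2} {𝓐 𝓑 : PlaneEps K} (h : X i * 𝓐 = X i * 𝓑) : 𝓐 = 𝓑 := by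
  have h1 := congrArg closedFibre h
  have h2 := congrArg epsPart h
  rw [closedFibre_mul, closedFibre_mul, closedFibre_X] at h1
  rw [epsPart_mul, epsPart_mul, closedFibre_X, epsPart_X, mul_zero, mul_zero, add_zero,
    add_zero] at h2
  exact planeEps_ext (mul_left_cancel₀ (X_prime i).ne_zero h1)
    (mul_left_cancel₀ (X_prime i).ne_zero h2)

theorem X_pow_mul_cancel {i : Fin 2} {n : ℕ} {𝓐 𝓑 : PlaneEps K} (h : X i ^ n * 𝓐 = X i ^ n * 𝓑) :
    𝓐 = 𝓑 := by
  induction n with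
  | zero => simpa using h
  | succ n ih =>
    rw [pow_succ', mul_assoc, mul_assoc] at h
    exact ih (X_mul_cancel h)

/-- If `X i` does not divide the closed fibre of `𝓑`, it can be cancelled from `𝓐` in `𝓐 * 𝓑`. -/
theorem X_pow_dvd_of_dvd_mul {i : Fin 2} {n : ℕ} {𝓐 𝓑 : PlaneEps K} (h : X i ^ n ∣ 𝓐 * 𝓑)
    (hb : ¬ X i ∣ closedFibre 𝓑) : X i ^ n ∣ 𝓐 := by
  induction n generalizing 𝓐 with
  | zero => simp
  | succ n ih =>
    have h1 : X i ∣ 𝓐 := by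
      obtain ⟨𝓒, h𝓒⟩ := (dvd_pow_self (X i) (Nat.succ_ne_zero n)).trans h
      have e1 := congrArg closedFibre h𝓒
      have e2 := congrArg epsPart h𝓒
      rw [closedFibre_mul, closedFibre_mul, closedFibre_X] at e1
      rw [epsPart_mul, epsPart_mul, closedFibre_X, epsPart_X, mul_zero, add_zero] at e2
      have d1 : X i ∣ closedFibre 𝓐 :=
        ((X_prime i).dvd_or_dvd (Dvd.intro _ e1.symm)).resolve_right hb
      refine X_dvd_planeEps d1 ?_
      have : X i ∣ closedFibre 𝓑 * epsPart 𝓐 := by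
        rw [← (eq_sub_of_add_eq' e2).symm]
        exact dvd_sub (dvd_mul_right _ _) (dvd_mul_of_dvd_left d1 _)
      exact ((X_prime i).dvd_or_dvd this).resolve_left hb
    obtain ⟨𝓐', rfl⟩ := h1
    rw [pow_succ']
    refine mul_dvd_mul_left _ (ih ?_)
    obtain ⟨𝓒, h𝓒⟩ := h
    refine ⟨𝓒, X_mul_cancel (i := i) ?_⟩
    rw [← mul_assoc, h𝓒]; ring

/-- Pull-back of functions to the blow-up along the section `⟨X k - v k ε⟩`, at the point of the
exceptional curve `X i = 0` with slope `c`. -/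
def chartHom (i : Fin 2) (v : Fin 2 → K) (c : K) : PlaneEps K →ₐ[K[ε]] PlaneEps K :=
  MvPowerSeries.substAlgHom (R := K[ε]) (S := K[ε])
    (a := fun k => (if k = i then X i else X i * (X i.rev + C (algebraMap K K[ε] c))) +
      C (v k • (ε : K[ε])))
    (MvPowerSeries.hasSubst_of_constantCoeff_nilpotent fun k => by
      refine ⟨2, ?_⟩
      split_ifs <;> simp [pow_two, DualNumber.eps_mul_eps])

theorem chart_eq (a b c : K) (𝓕 : PlaneEps K) : chart a b c 𝓕 = chartHom 0 ![a, b] c 𝓕 := by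
  rw [chart, chartHom, MvPowerSeries.substAlgHom_apply]
  congr 1
  funext k
  fin_cases k <;> rfl

theorem chartInfty_eq (a b : K) (𝓕 : PlaneEps K) :
    chartInfty a b 𝓕 = chartHom 1 ![a, b] 0 𝓕 := by
  rw [chartInfty, chartHom, MvPowerSeries.substAlgHom_apply]
  congr 1
  funext k
  fin_cases k
  · change _ = X 1 * (X (Fin.rev 1) + C (algebraMap K K[ε] 0)) + C (a • (ε : K[ε]))
    simp [mul_comm]
  · rfl

theorem chartHom_X (i k : Fin 2) (v : Fin 2 → K) (c : K) :
    closedFibre (chartHom i v c (X k)) = blow i c (X k) ∧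
      epsPart (chartHom i v c (X k)) = C (v k) := by
  rw [chartHom, MvPowerSeries.substAlgHom_X]
  obtain rfl | rfl := eq_or_eq_rev i k
  · rw [if_pos rfl, closedFibre_add, epsPart_add, closedFibre_X, epsPart_X, closedFibre_C,
      epsPart_C, blow_X]
    simp
  · rw [if_neg (rev_ne i), closedFibre_add, epsPart_add, closedFibre_mul, epsPart_mul,
      closedFibre_add, epsPart_add, closedFibre_X, epsPart_X, closedFibre_X, epsPart_X,
      closedFibre_C, epsPart_C, closedFibre_C, epsPart_C, blow_X_rev]
    simp [TrivSqZeroExt.algebraMap_eq_inl]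

theorem chartHom_C (i : Fin 2) (v : Fin 2 → K) (c : K) (a : K[ε]) :
    chartHom i v c (C a) = C a := by
  have := (chartHom i v c).commutes a
  exact this

theorem closedFibre_chartHom_map (i : Fin 2) (v : Fin 2 → K) (c : K) (F : Plane K) :
    closedFibre (chartHom i v c (MvPowerSeries.map (TrivSqZeroExt.inlHom K K) F)) = blow i c F :=
  ringHom_ext_of_X iInf_maxIdeal_pow
    (((MvPowerSeries.map (TrivSqZeroExt.fstHom K K K).toRingHom).comp
      (chartHom i v c : PlaneEps K →+* PlaneEps K)).comp
        (MvPowerSeries.map (TrivSqZeroExt.inlHom K K)))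
    (blow i c : Plane K →+* Plane K)
    (fun d => by
      change closedFibre (chartHom i v c (MvPowerSeries.map _ (C d))) = blow i c (C d)
      rw [MvPowerSeries.map_C, chartHom_C, closedFibre_C, blow_C]; simp)
    (fun k => by
      change closedFibre (chartHom i v c (MvPowerSeries.map _ (X k))) ∈ _
      rw [MvPowerSeries.map_X, (chartHom_X i k v c).1]
      exact blow_X_mem_maxIdeal i k c)
    (fun k => by
      change closedFibre (chartHom i v c (MvPowerSeries.map _ (X k))) = blow i c (X k)
      rw [MvPowerSeries.map_X, (chartHom_X i k v c).1]) F

/-- To first order, blowing up the moved section adds the derivative along `v`, because the chart is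
the constant one composed with the translation by `ε v`. -/
theorem epsPart_chartHom_map (i : Fin 2) (v : Fin 2 → K) (c : K) (F : Plane K) :
    epsPart (chartHom i v c (MvPowerSeries.map (TrivSqZeroExt.inlHom K K) F)) =
      ∑ k, C (v k) * blow i c (pderiv K k F) := by
  let e : Plane K →+ Plane K :=
    { toFun := fun F => epsPart (chartHom i v c (MvPowerSeries.map (TrivSqZeroExt.inlHom K K) F))
        - ∑ k, C (v k) * blow i c (pderiv K k F)
      map_zero' := by
        have : epsPart (0 : PlaneEps K) = 0 := rfl
        simp [this]
      map_add' := fun a b => by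
        simp only [map_add, epsPart_add, mul_add, Finset.sum_add_distrib]; ring }
  have := eq_zero_of_X_mul iInf_maxIdeal_pow e (fun k => blow i c (X k))
    (fun k => blow_X_mem_maxIdeal i k c)
    (fun d => by
      simp only [e, AddMonoidHom.coe_mk, ZeroHom.coe_mk, MvPowerSeries.map_C, chartHom_C,
        epsPart_C]
      simp)
    (fun k a => by
      have h0 : ∀ l, pderiv K l (X k * a) = X k * pderiv K l a + (if l = k then a else 0) := by
        intro l
        rw [Derivation.leibniz, MvPowerSeries.pderiv_X]
        by_cases h : k = l <;> simp [h, eq_comm]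
      simp only [e, AddMonoidHom.coe_mk, ZeroHom.coe_mk, map_mul, epsPart_mul,
        MvPowerSeries.map_X, (chartHom_X i k v c).1, (chartHom_X i k v c).2,
        closedFibre_chartHom_map, h0, map_add, mul_add, Finset.sum_add_distrib]
      have : ∑ l, C (v l) * blow i c (if l = k then a else 0) = C (v k) * blow i c a := by
        rw [Finset.sum_eq_single k] <;> simp +contextual
      rw [this, mul_sub, Finset.mul_sum]
      have : ∀ l, C (v l) * (blow i c (X k) * blow i c (pderiv K l a)) =
        blow i c (X k) * (C (v l) * blow i c (pderiv K l a)) := fun l => by ring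
      simp only [this]
      ring) F
  exact sub_eq_zero.mp this

/-- Taylor expansion of the pull-back of functions to the blow-up along a moving section:
the closed fibre. -/
theorem closedFibre_chartHom (i : Fin 2) (v : Fin 2 → K) (c : K) (𝓕 : PlaneEps K) :
    closedFibre (chartHom i v c 𝓕) = blow i c (closedFibre 𝓕) := by
  conv_lhs => rw [← family_eq 𝓕, family]
  rw [map_add, map_mul, chartHom_C, closedFibre_add, closedFibre_mul, closedFibre_C,
    closedFibre_chartHom_map]
  simp

/-- Taylor expansion of the pull-back of functions to the blow-up along a moving section:
the coefficient of `ε`. -/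
theorem epsPart_chartHom (i : Fin 2) (v : Fin 2 → K) (c : K) (𝓕 : PlaneEps K) :
    epsPart (chartHom i v c 𝓕) =
      blow i c (epsPart 𝓕) + ∑ k, C (v k) * blow i c (pderiv K k (closedFibre 𝓕)) := by
  conv_lhs => rw [← family_eq 𝓕, family]
  rw [map_add, map_mul, chartHom_C, epsPart_add, epsPart_mul, closedFibre_C, epsPart_C,
    closedFibre_chartHom_map, epsPart_chartHom_map]
  simp [add_comm]

/-! ### Prime ideals and arcs -/

instance maxIdeal_isPrime : (maxIdeal K).IsPrime := RingHom.ker_isPrime _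

theorem le_maxIdeal_of_ne_top {I : Ideal (Plane K)} (h : I ≠ ⊤) : I ≤ maxIdeal K := by
  intro f hf
  rw [mem_maxIdeal]
  by_contra hc
  exact h (Ideal.eq_top_of_isUnit_mem _ hf (isUnit_iff.mpr hc))

theorem height_maxIdeal_le : (maxIdeal K).height ≤ 2 := by
  have h : maxIdeal K ∈ (Ideal.span (Set.range (X : Fin 2 → Plane K))).minimalPrimes := by
    rw [← maxIdeal_eq_span, Ideal.minimalPrimes_eq_subsingleton_self]
    rfl
  refine (Ideal.height_le_card_of_mem_minimalPrimes_span (Set.finite_range _) h).trans ?_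
  have := Set.ncard_image_le (f := (X : Fin 2 → Plane K)) (s := Set.univ)
  rw [Set.image_univ, Set.ncard_univ, Nat.card_eq_fintype_card, Fintype.card_fin] at this
  exact_mod_cast this

/-- The plane has dimension two: there is no inclusion between distinct primes other than zero and
the maximal ideal. -/
theorem eq_of_isPrime_of_le {p q : Ideal (Plane K)} [p.IsPrime] [q.IsPrime] (hp : p ≠ ⊥)
    (hpq : p ≤ q) (hq : q ≠ maxIdeal K) : p = q := by
  by_contra hne
  have h1 := Ideal.height_add_one_le_of_lt_of_isPrime (lt_of_le_of_ne hpq hne)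
  have h2 := Ideal.height_add_one_le_of_lt_of_isPrime
    (lt_of_le_of_ne (le_maxIdeal_of_ne_top (Ideal.IsPrime.ne_top ‹q.IsPrime›)) hq)
  have h0 : (1 : ℕ∞) ≤ p.height := by
    rw [Order.one_le_iff_ne_zero]
    exact fun h => hp (Ideal.height_eq_zero_iff_eq_bot.mp h)
  have h3 := height_maxIdeal_le (K := K)
  have : (1 : ℕ∞) + 1 + 1 ≤ 2 :=
    (add_le_add_left ((add_le_add_left h0 1).trans h1) 1).trans (h2.trans h3)
  norm_num at this

theorem Arc.ker_ne_maxIdeal {θ : Arc K} (h : θ.Nonconst) : RingHom.ker θ ≠ maxIdeal K := by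
  obtain ⟨k, hk⟩ := h
  intro e
  have : X k ∈ RingHom.ker θ := by rw [e, mem_maxIdeal]; simp
  exact hk this

instance (θ : Arc K) : (RingHom.ker θ).IsPrime := RingHom.ker_isPrime _

theorem Arc.eq_ker {θ : Arc K} (h : θ.Nonconst) {p : Ideal (Plane K)} [p.IsPrime] (hp : p ≠ ⊥)
    (hle : p ≤ RingHom.ker θ) : p = RingHom.ker θ :=
  eq_of_isPrime_of_le hp hle (Arc.ker_ne_maxIdeal h)

theorem Arc.dvd_of_prime {θ : Arc K} (h : θ.Nonconst) {z f : Plane K} (hz : Prime z)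
    (h0 : θ z = 0) (hf : θ f = 0) : z ∣ f := by
  have : (Ideal.span {z}).IsPrime := (Ideal.span_singleton_prime hz.ne_zero).mpr hz
  have e := Arc.eq_ker h (p := Ideal.span {z})
    (by simpa [Ideal.span_singleton_eq_bot] using hz.ne_zero)
    (by rw [Ideal.span_singleton_le_iff_mem]; exact h0)
  rw [← Ideal.mem_span_singleton, e]
  exact hf

/-- A nonconstant arc lifts to the blow-up. -/
theorem Arc.exists_lift {θ : Arc K} (h : θ.Nonconst) :
    ∃ (i : Fin 2) (c : K) (θ' : Arc K), (i = 0 ∨ c = 0) ∧ θ = θ'.comp (blow i c) ∧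
      θ' (X i) ≠ 0 := by
  have key : ∀ (i : Fin 2) (q : PowerSeries K), θ (X i.rev) = θ (X i) * q → θ (X i) ≠ 0 →
      ∃ θ' : Arc K, θ = θ'.comp (blow i (PowerSeries.constantCoeff q)) ∧ θ' (X i) ≠ 0 := by
    intro i q hq hi
    let v : Fin 2 → PowerSeries K := fun k =>
      if k = i then θ (X i) else q - PowerSeries.C (PowerSeries.constantCoeff q)
    have hv : ∀ k, PowerSeries.constantCoeff (v k) = 0 := by
      intro k
      simp only [v]
      split_ifs
      · rw [constantCoeff_arc]; simp
      · simp
    have hi' : arcOf v hv (X i) = θ (X i) := by rw [arcOf_X]; simp [v]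
    refine ⟨arcOf v hv, arc_ext fun k => ?_, by rw [hi']; exact hi⟩
    obtain rfl | rfl := eq_or_eq_rev i k
    · rw [AlgHom.comp_apply, blow_X, hi']
    · rw [AlgHom.comp_apply, blow_X_rev, map_mul, map_add, hi', arc_C, arcOf_X, hq]
      simp [v, rev_ne]
  by_cases h01 : θ (X 0) ∣ θ (X 1)
  · obtain ⟨q, hq⟩ := h01
    have h0 : θ (X 0) ≠ 0 := fun h0 => by
      obtain ⟨k, hk⟩ := h
      fin_cases k
      · exact hk h0
      · exact hk (by simpa [h0] using hq)
    obtain ⟨θ', h1, h2⟩ := key 0 q hq h0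
    exact ⟨0, _, θ', Or.inl rfl, h1, h2⟩
  · obtain ⟨q, hq⟩ := (ValuationRing.dvd_total _ _).resolve_left h01
    have hq0 : PowerSeries.constantCoeff q = 0 := by
      by_contra hne
      apply h01
      rw [hq]
      exact ((PowerSeries.isUnit_iff_constantCoeff.mpr (isUnit_iff_ne_zero.mpr hne)).mul_right_dvd).mpr
        dvd_rfl
    have h1 : θ (X 1) ≠ 0 := fun h1 => h01 (by rw [h1]; exact dvd_zero _)
    obtain ⟨θ', h2, h3⟩ := key 1 q hq h1
    exact ⟨1, _, θ', Or.inr hq0, h2, h3⟩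

/-! ### Curves without multiple arcs -/

/-- The gradient of `f` does not vanish along any nonconstant arc in the curve `f = 0`. For a
reduced curve this is the Jacobian criterion at the generic points of its branches. -/
def ArcReduced (f : Plane K) : Prop :=
  ∀ θ : Arc K, θ.Nonconst → θ f = 0 → ∃ k, θ (pderiv K k f) ≠ 0

theorem ArcReduced.of_mul_right {f g : Plane K} (h : ArcReduced (f * g)) {θ : Arc K}
    (hθ : θ.Nonconst) (hf : θ f = 0) : θ g ≠ 0 := by
  intro hg
  obtain ⟨k, hk⟩ := h θ hθ (by rw [map_mul, hf, zero_mul])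
  apply hk
  rw [Derivation.leibniz]
  simp [hf, hg]

theorem not_X_dvd_of_coeff {i : Fin 2} {j : ℕ} {g : Plane K}
    (h : coeff (Finsupp.single i.rev j) g ≠ 0) : ¬ X i ∣ g := fun hd =>
  h (MvPowerSeries.X_dvd_iff.mp hd _ (by simp [rev_ne]))

theorem pderiv_X_pow_mul_rev (i : Fin 2) (m : ℕ) (g : Plane K) :
    pderiv K i.rev (X i ^ m * g) = X i ^ m * pderiv K i.rev g := by
  rw [Derivation.leibniz, Derivation.leibniz_pow, MvPowerSeries.pderiv_X_of_ne (rev_ne i).symm]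
  simp

theorem pderiv_X_pow_mul (i : Fin 2) (m : ℕ) (g : Plane K) :
    X i * pderiv K i (X i ^ m * g) = X i ^ m * (X i * pderiv K i g + (m : Plane K) * g) := by
  rw [Derivation.leibniz, Derivation.leibniz_pow, MvPowerSeries.pderiv_X_self]
  rcases m with _ | m
  · simp
  · simp only [smul_eq_mul, nsmul_eq_mul, Nat.add_sub_cancel]; ring

/-- The reduced total transform of a curve without multiple arcs has no multiple arcs. -/
theorem ArcReduced.blow {f g : Plane K} (h : ArcReduced f) {i : Fin 2} {c : K} {m : ℕ}
    (hg : LogCurve.blow i c f = X i ^ m * g) (hX : ¬ X i ∣ g) : ArcReduced (X i * g) := by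
  intro θ hθ h0
  by_cases hi : θ (X i) = 0
  · refine ⟨i, ?_⟩
    rw [Derivation.leibniz, MvPowerSeries.pderiv_X_self]
    have : θ g ≠ 0 := fun h1 => hX (Arc.dvd_of_prime hθ (X_prime i) hi h1)
    simpa [hi] using this
  · rw [map_mul, mul_eq_zero, or_iff_right hi] at h0
    by_contra hcon
    push Not at hcon
    have hr : θ (pderiv K i.rev g) = 0 := by
      have := hcon i.rev
      rw [← pow_one (X i), pderiv_X_pow_mul_rev, pow_one, map_mul] at this
      exact (mul_eq_zero.mp this).resolve_left hi
    have hi' : θ (pderiv K i g) = 0 := by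
      have := hcon i
      rw [Derivation.leibniz, MvPowerSeries.pderiv_X_self] at this
      simp only [smul_eq_mul, mul_one, map_add, map_mul, h0, add_zero] at this
      exact (mul_eq_zero.mp this).resolve_left hi
    have e2 : θ (LogCurve.blow i c (pderiv K i.rev f)) = 0 := by
      have := congrArg θ (pderiv_rev_blow i c f)
      rw [hg, pderiv_X_pow_mul_rev, map_mul, map_mul, hr, mul_zero] at this
      exact (mul_eq_zero.mp this.symm).resolve_left hi
    have e1 : θ (LogCurve.blow i c (pderiv K i f)) = 0 := by
      have h3 := congrArg (fun a => θ (X i * a)) (pderiv_blow i c f)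
      simp only [hg, pderiv_X_pow_mul] at h3
      simp only [map_mul, map_add, hi', h0, e2, mul_zero, add_zero] at h3
      exact (mul_eq_zero.mp h3.symm).resolve_left hi
    have hn : Arc.Nonconst (θ.comp (LogCurve.blow i c)) :=
      ⟨i, by rw [AlgHom.comp_apply, blow_X]; exact hi⟩
    obtain ⟨k, hk⟩ := h _ hn (by rw [AlgHom.comp_apply, hg, map_mul, h0, mul_zero])
    obtain rfl | rfl := eq_or_eq_rev i k
    · exact hk e1
    · exact hk e2

/-! ### Embedded resolution -/

/-- The curve `f = 0` becomes a union of smooth points and nodes after finitely many blow-ups, when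
the exceptional curves are added to it. -/
inductive Resolvable : Plane K → Prop
  | smooth (f : Plane K) (smooth : IsSmoothCurve f) : Resolvable f
  | node (f : Plane K) (node : IsNode f) : Resolvable f
  | blowup (f : Plane K) (m : ℕ) (mult : f.order = m) (singular : 2 ≤ m) (not_node : ¬ IsNode f)
      (g : Fin 2 → K → Plane K)
      (transform : ∀ i c, (i = 0 ∨ c = 0) → blow i c f = X i ^ m * g i c)
      (resolvable : ∀ i c, (i = 0 ∨ c = 0) → Resolvable (X i * g i c)) : Resolvable f

theorem order_X (i : Fin 2) : (X i : Plane K).order = 1 := by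
  rw [MvPowerSeries.X]
  simp [MvPowerSeries.order_monomial_of_ne_zero]

theorem order_X_pow_mul (i : Fin 2) (a : ℕ) (f : Plane K) :
    (X i ^ a * f).order = a + f.order := by
  induction a with
  | zero => simp
  | succ a ih =>
    rw [pow_succ', mul_assoc, MvPowerSeries.order_mul, ih, order_X, ← add_assoc]
    push_cast
    rw [add_comm (1 : ℕ∞)]

theorem order_unit_mul {u : Plane K} (hu : constantCoeff u ≠ 0) (f : Plane K) :
    (u * f).order = f.order := by
  rw [MvPowerSeries.order_mul, order_eq_zero_iff.mpr hu, zero_add]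

theorem coeff_add_single_X_mul (i : Fin 2) (n) (f : Plane K) :
    coeff (Finsupp.single i 1 + n) (X i * f) = coeff n f := by
  simpa [MvPowerSeries.X] using
    MvPowerSeries.coeff_add_monomial_mul (Finsupp.single i 1) n f (1 : K)

/-- The coefficient in lowest degree is multiplicative for a unit factor. -/
theorem coeff_unit_mul {u f : Plane K} {m : ℕ} (hf : f.order = m) {n} (hn : n.degree = m) :
    coeff n (u * f) = constantCoeff u * coeff n f := by
  have h : ((m + 1 : ℕ) : ℕ∞) ≤ ((u - C (constantCoeff u)) * f).order := by
    rw [MvPowerSeries.order_mul, hf, Nat.cast_succ, add_comm]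
    exact add_le_add_left (one_le_order_iff.mpr (by simp)) _
  have h0 := MvPowerSeries.coeff_of_lt_order (d := n)
    (lt_of_lt_of_le (by rw [hn]; exact_mod_cast Nat.lt_succ_self m) h)
  rw [sub_mul, map_sub, sub_eq_zero] at h0
  rw [h0]
  simp

/-- A coordinate line and a transversal smooth curve form a node. -/
theorem isNode_X_mul {i : Fin 2} {h : Plane K} (h1 : h.order = 1)
    (hc : coeff (Finsupp.single i.rev 1) h ≠ 0) : IsNode (X i * h) := by
  refine ⟨by rw [MvPowerSeries.order_mul, order_X, h1]; norm_num, ?_⟩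
  have e1 : coeff (Finsupp.single i 1 + Finsupp.single i.rev 1) (X i * h) =
      coeff (Finsupp.single i.rev 1) h := coeff_add_single_X_mul _ _ _
  have e2 : coeff (Finsupp.single i.rev 2) (X i * h) = 0 :=
    MvPowerSeries.X_dvd_iff.mp (dvd_mul_right _ _) _ (by simp [rev_ne])
  fin_cases i
  · change coeff (Finsupp.single 1 2) (X 0 * h) = _ at e2
    change coeff (Finsupp.single 0 1 + Finsupp.single 1 1) (X 0 * h) = _ at e1
    change coeff (Finsupp.single 0 1 + Finsupp.single 1 1) (X 0 * h) ^ 2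
      - 4 * coeff (Finsupp.single 0 2) (X 0 * h) * coeff (Finsupp.single 1 2) (X 0 * h) ≠ 0
    rw [e1, e2]
    simpa using hc
  · change coeff (Finsupp.single 0 2) (X 1 * h) = _ at e2
    change coeff (Finsupp.single 1 1 + Finsupp.single 0 1) (X 1 * h) = _ at e1
    rw [add_comm] at e1
    change coeff (Finsupp.single 0 1 + Finsupp.single 1 1) (X 1 * h) ^ 2
      - 4 * coeff (Finsupp.single 0 2) (X 1 * h) * coeff (Finsupp.single 1 2) (X 1 * h) ≠ 0
    rw [e1, e2]
    simpa using hc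

/-- The blow-up of a curve `h = 0` together with some of the coordinate lines. The line
`X i.rev = 0` only meets the point with slope `0`. -/
theorem exists_blow_boundary (i : Fin 2) (c : K) (a b : ℕ) {u h : Plane K} {m : ℕ}
    (hu : constantCoeff u ≠ 0) (hm : h.order = m) :
    ∃ (h' u' : Plane K) (b' : ℕ), blow i c h = X i ^ m * h' ∧
      (∃ j ≤ m, coeff (Finsupp.single i.rev j) h' ≠ 0) ∧
      (c = 0 → constantCoeff h' = coeff (Finsupp.single i m) h) ∧
      constantCoeff u' ≠ 0 ∧ b' ≤ b ∧ (c ≠ 0 → b' = 0) ∧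
      blow i c (X i ^ a * (X i.rev ^ b * (u * h))) =
        X i ^ (a + b + m) * (X i.rev ^ b' * (u' * h')) := by
  obtain ⟨h', h1, h2, h3⟩ := exists_strictTransform i c hm
  by_cases hc : c = 0
  · refine ⟨h', blow i c u, b, h1, h2, h3, by rwa [constantCoeff_blow], le_rfl,
      fun h => absurd hc h, ?_⟩
    rw [map_mul, map_mul, map_mul, map_pow, map_pow, blow_X, blow_X_rev, h1, hc, map_zero, add_zero]
    ring
  · refine ⟨h', blow i c u * (X i.rev + C c) ^ b, 0, h1, h2, h3, ?_, Nat.zero_le _,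
      fun _ => rfl, ?_⟩
    · rw [map_mul, constantCoeff_blow]
      exact mul_ne_zero hu (by simpa using pow_ne_zero b hc)
    · rw [map_mul, map_mul, map_mul, map_pow, map_pow, blow_X, blow_X_rev, h1, mul_pow]
      ring

theorem not_X_dvd_boundary (i : Fin 2) (b : ℕ) {u h : Plane K} {m : ℕ} (hu : constantCoeff u ≠ 0)
    (hh : ∃ j ≤ m, coeff (Finsupp.single i.rev j) h ≠ 0) : ¬ X i ∣ X i.rev ^ b * (u * h) := by
  intro hd
  obtain ⟨j, -, hj⟩ := hh
  rcases (X_prime i).dvd_or_dvd hd with h1 | h1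
  · exact not_X_dvd_of_coeff (i := i) (j := 1) (by rw [MvPowerSeries.coeff_X]; simp)
      ((X_prime i).dvd_of_dvd_pow h1)
  · rcases (X_prime i).dvd_or_dvd h1 with h1 | h1
    · exact (X_prime i).not_isUnit (isUnit_of_dvd_unit h1 (isUnit_iff.mpr hu))
    · exact not_X_dvd_of_coeff hj h1

theorem order_boundary (i : Fin 2) (a b : ℕ) {u h : Plane K} {m : ℕ}
    (hu : constantCoeff u ≠ 0) (hm : h.order = m) :
    (X i ^ a * (X i.rev ^ b * (u * h))).order = ((a + b + m : ℕ) : ℕ∞) := by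
  rw [order_X_pow_mul, order_X_pow_mul, order_unit_mul hu, hm]
  push_cast
  rw [add_assoc]

theorem order_le_of_coeff {i : Fin 2} {h : Plane K} {m : ℕ}
    (hh : ∃ j ≤ m, coeff (Finsupp.single i j) h ≠ 0) :
    ∃ j ≤ m, h.order = (j : ℕ) := by
  obtain ⟨j, hj, hc⟩ := hh
  have h1 := MvPowerSeries.order_le hc
  rw [Finsupp.degree_single] at h1
  obtain ⟨k, hk⟩ := ENat.ne_top_iff_exists.mp (ne_top_of_le_ne_top (ENat.natCast_ne_top j) h1)
  rw [← hk] at h1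
  exact ⟨k, (by exact_mod_cast h1 : k ≤ j).trans hj, hk.symm⟩

/-- If moreover the order is `m`, then the coefficient of `X i ^ m` is nonzero. -/
theorem coeff_ne_zero_of_order {i : Fin 2} {h : Plane K} {m : ℕ} (hm : h.order = m)
    (hh : ∃ j ≤ m, coeff (Finsupp.single i j) h ≠ 0) : coeff (Finsupp.single i m) h ≠ 0 := by
  obtain ⟨j, hj, hc⟩ := hh
  have h1 := MvPowerSeries.order_le hc
  rw [Finsupp.degree_single, hm] at h1
  rwa [le_antisymm hj (by exact_mod_cast h1)] at hc

/-- An infinite descent: every `a n` is divisible by all powers of `X`. -/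
theorem eq_zero_of_X_mul_dvd {a : ℕ → PowerSeries K}
    (h : ∀ n, PowerSeries.X * a (n + 1) ∣ a n) (n : ℕ) : a n = 0 := by
  have key : ∀ N n, PowerSeries.X ^ N ∣ a n := by
    intro N
    induction N with
    | zero => simp
    | succ N ih => intro n; rw [pow_succ']; exact (mul_dvd_mul_left _ (ih _)).trans (h n)
  have : a n ∈ ⨅ N : ℕ, Ideal.span {(PowerSeries.X : PowerSeries K)} ^ N := by
    simp only [Ideal.mem_iInf, Ideal.span_singleton_pow, Ideal.mem_span_singleton]
    exact fun N => key N n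
  simpa [iInf_span_X_pow] using this

/-- An infinite sequence of infinitely near points of constant multiplicity `m ≥ 1` on a curve, all
in the charts `i`, lies on an arc in the curve; and if `m ≥ 2` then the gradient vanishes on this
arc. -/
theorem exists_arc_of_chain (i : Fin 2) {m : ℕ} (hm : 1 ≤ m) (c : ℕ → K) (h : ℕ → Plane K)
    (hh : ∀ n, blow i (c n) (h n) = X i ^ m * h (n + 1)) :
    ∃ θ : Arc K, θ.Nonconst ∧ θ (h 0) = 0 ∧ ((∀ n, c n = 0) → θ (X i.rev) = 0) ∧
      (2 ≤ m → ∀ k, θ (pderiv K k (h 0)) = 0) := by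
  let ψ : ℕ → PowerSeries K := fun n =>
    PowerSeries.X * PowerSeries.mk (fun k => c (n + k))
  have hψ : ∀ n, ψ n = PowerSeries.X * (ψ (n + 1) + PowerSeries.C (c n)) := by
    intro n
    simp only [ψ]
    congr 1
    ext k
    rcases k with _ | k
    · simp
    · rw [map_add, PowerSeries.coeff_succ_X_mul, PowerSeries.coeff_mk, PowerSeries.coeff_mk,
        PowerSeries.coeff_C, if_neg (Nat.succ_ne_zero k), add_zero]
      congr 1; omega
  let v : ℕ → Fin 2 → PowerSeries K := fun n k => if k = i then PowerSeries.X else ψ n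
  have hv : ∀ n k, PowerSeries.constantCoeff (v n k) = 0 := by
    intro n k
    simp only [v, ψ]
    split_ifs <;> simp
  let θ : ℕ → Arc K := fun n => arcOf (v n) (hv n)
  have hi : ∀ n, θ n (X i) = PowerSeries.X := fun n => by simp [θ, arcOf_X, v]
  have hr : ∀ n, θ n (X i.rev) = ψ n := fun n => by simp [θ, arcOf_X, v, rev_ne]
  have hθ : ∀ n f, θ n f = θ (n + 1) (blow i (c n) f) := by
    intro n f
    have : θ n = (θ (n + 1)).comp (blow i (c n)) := arc_ext fun k => by
      obtain rfl | rfl := eq_or_eq_rev i k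
      · rw [AlgHom.comp_apply, blow_X, hi, hi]
      · rw [AlgHom.comp_apply, blow_X_rev, map_mul, map_add, hi, hr, hr, arc_C, hψ]
    rw [this]; rfl
  obtain ⟨m, rfl⟩ := Nat.exists_eq_add_of_le' hm
  have h0 : ∀ n, θ n (h n) = 0 := eq_zero_of_X_mul_dvd fun n => by
    rw [hθ n (h n), hh, map_mul, map_pow, hi, pow_succ']
    exact mul_dvd_mul (dvd_mul_right _ _) dvd_rfl
  refine ⟨θ 0, ⟨i, by rw [hi]; exact PowerSeries.X_ne_zero⟩, h0 0, fun hc => ?_, fun hm => ?_⟩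
  · have : PowerSeries.mk (fun k => c (0 + k)) = 0 := by ext k; simp [hc]
    rw [hr]
    simp only [ψ]
    rw [this, mul_zero]
  · obtain ⟨m, rfl⟩ := Nat.exists_eq_add_of_le' (show 1 ≤ m by omega)
    have h1 : ∀ n, θ n (pderiv K i.rev (h n)) = 0 := eq_zero_of_X_mul_dvd fun n => by
      have e := congrArg (θ (n + 1)) (pderiv_rev_blow i (c n) (h n))
      rw [hh, pderiv_X_pow_mul_rev, map_mul, map_mul, ← hθ, map_pow, hi, pow_succ', pow_succ',
        mul_assoc, mul_assoc] at e
      rw [← mul_left_cancel₀ PowerSeries.X_ne_zero e]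
      exact mul_dvd_mul_left _ (dvd_mul_left _ _)
    have h2 : ∀ n, θ n (pderiv K i (h n)) = 0 := eq_zero_of_X_mul_dvd fun n => by
      have e := congrArg (fun f => θ (n + 1) (X i * f)) (pderiv_blow i (c n) (h n))
      simp only [hh, pderiv_X_pow_mul] at e
      simp only [map_mul, map_add, ← hθ, h0, h1, mul_zero, add_zero, map_pow, hi] at e
      have e' : θ n (pderiv K i (h n)) =
          PowerSeries.X ^ (m + 1 + 1) * θ (n + 1) (pderiv K i (h (n + 1))) :=
        mul_left_cancel₀ PowerSeries.X_ne_zero (by rw [← e]; ring)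
      rw [e']
      exact mul_dvd_mul (dvd_pow_self _ (by omega)) dvd_rfl
    intro k
    obtain rfl | rfl := eq_or_eq_rev i k
    · exact h2 0
    · exact h1 0

/-- All curves made of the line `X i = 0`, possibly of the other coordinate line, and of a curve of
multiplicity `m` not tangent to `X i = 0`, are resolvable. -/
def TransversalResolvable (K : Type*) [Field K] (i : Fin 2) (m : ℕ) : Prop :=
  ∀ (b : ℕ) (h : Plane K), b ≤ 1 → h.order = m → coeff (Finsupp.single i.rev m) h ≠ 0 →
    ArcReduced (X i ^ 1 * (X i.rev ^ b * h)) → Resolvable (X i ^ 1 * (X i.rev ^ b * h))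

/-- All curves made of some of the coordinate lines and of a curve of multiplicity `m` are
resolvable. -/
def BoundaryResolvable (K : Type*) [Field K] (m : ℕ) : Prop :=
  ∀ (i : Fin 2) (a b : ℕ) (h : Plane K), a ≤ 1 → b ≤ 1 → h.order = m → 1 ≤ a + b + m →
    ArcReduced (X i ^ a * (X i.rev ^ b * h)) → Resolvable (X i ^ a * (X i.rev ^ b * h))

theorem boundaryResolvable_zero : BoundaryResolvable K 0 := by
  intro i a b h ha hb hm h1 _
  have hu : constantCoeff h ≠ 0 := order_eq_zero_iff.mp (by simpa using hm)
  by_cases hab : a + b = 1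
  · refine Resolvable.smooth _ ?_
    have := order_boundary i a b (u := h) (h := 1) (m := 0) hu (by simp [order_eq_zero_iff])
    rw [mul_one, hab] at this
    simpa [IsSmoothCurve] using this
  · obtain rfl : a = 1 := by omega
    obtain rfl : b = 1 := by omega
    refine Resolvable.node _ ?_
    rw [pow_one, pow_one]
    refine isNode_X_mul ?_ ?_
    · rw [MvPowerSeries.order_mul, order_X, hm]; simp
    · have := coeff_add_single_X_mul i.rev 0 h
      rw [add_zero] at this
      rw [this]
      exact hu

/-- If a curve with its boundary is not resolvable, neither is its total transform at some point of
the blow-up. -/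
theorem exists_child_not_resolvable {f : Plane K} {M : ℕ} (hM : f.order = M) (hM1 : 1 ≤ M)
    (hf : ¬ Resolvable f) :
    ∃ (i : Fin 2) (c : K), (i = 0 ∨ c = 0) ∧
      ∀ g, blow i c f = X i ^ M * g → ¬ Resolvable (X i * g) := by
  by_contra hcon
  push Not at hcon
  have h1 : M ≠ 1 := by
    rintro rfl
    exact hf (Resolvable.smooth _ (by simpa [IsSmoothCurve] using hM))
  choose! g hg using hcon
  exact hf (Resolvable.blowup f M hM (by omega) (fun h => hf (Resolvable.node f h)) g
    (fun i c h => (hg i c h).1) (fun i c h => (hg i c h).2))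

/-- A transversal curve that is not resolvable gives an infinite chain of total transforms that are not
resolvable. By the induction hypothesis, and by `hr` for the charts that interchange the axes, the
multiplicity stays `m` and all points of the chain lie in chart `i`. The points of the chain are then
those of an arc, and along that arc the curve is not reduced. -/
theorem TransversalResolvable.of_lt (i : Fin 2) {m : ℕ} (hm : 1 ≤ m)
    (ih : ∀ m' < m, BoundaryResolvable K m')
    (hr : i = 0 ∨ TransversalResolvable K i.rev m) : TransversalResolvable K i m := by
  classical
  intro b₀ h₀ hb₀ hm₀ hc₀ har₀
  by_contra hbad₀
  let Bad : ℕ × Plane K × Plane K → Prop := fun s =>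
    s.1 ≤ 1 ∧ constantCoeff s.2.1 ≠ 0 ∧ s.2.2.order = m ∧
      coeff (Finsupp.single i.rev m) s.2.2 ≠ 0 ∧
      ArcReduced (X i ^ 1 * (X i.rev ^ s.1 * (s.2.1 * s.2.2))) ∧
      ¬ Resolvable (X i ^ 1 * (X i.rev ^ s.1 * (s.2.1 * s.2.2)))
  have step : ∀ s : {s // Bad s}, ∃ (c : K) (s' : {s // Bad s}),
      blow i c s.1.2.2 = X i ^ m * s'.1.2.2 ∧ (c ≠ 0 → s'.1.1 = 0) := by
    rintro ⟨⟨b, u, h⟩, hb, hu, hm, hc, har, hres⟩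
    simp only at hb hu hm hc har hres ⊢
    obtain ⟨j, c, hjc, hch⟩ := exists_child_not_resolvable (order_boundary i 1 b hu hm)
      (by omega) hres
    obtain rfl | rfl := eq_or_eq_rev i j
    · obtain ⟨h', u', b', e1, e2, e3, e4, e5, e6, e7⟩ :=
        exists_blow_boundary j c 1 b hu hm
      have hres' := hch _ e7
      have har' := har.blow e7 (not_X_dvd_boundary _ _ e4 e2)
      rw [← pow_one (X j)] at hres' har'
      obtain ⟨k, hk, hk'⟩ := order_le_of_coeff e2
      have hkm : k = m := by
        by_contra hne
        exact hres' (ih k (by omega) j 1 b' _ le_rfl (by omega)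
          (by rw [order_unit_mul e4, hk']) (by omega) har')
      subst hkm
      exact ⟨c, ⟨(b', u', h'), by simp only [Bad]; exact ⟨by omega, e4, hk',
        coeff_ne_zero_of_order hk' e2, har', hres'⟩⟩, e1, e6⟩
    · exfalso
      have hG : X i ^ 1 * (X i.rev ^ b * (u * h)) =
          X i.rev ^ b * (X i.rev.rev ^ 1 * (u * h)) := by
        rw [Fin.rev_rev]; ring
      obtain ⟨h', u', b', e1, e2, e3, e4, e5, e6, e7⟩ :=
        exists_blow_boundary i.rev c b 1 hu hm
      rw [hG] at hch har
      have hM : 1 + b + m = b + 1 + m := by omega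
      rw [hM] at hch
      have hres' := hch _ e7
      have har' := har.blow e7 (not_X_dvd_boundary _ _ e4 e2)
      rw [← pow_one (X i.rev)] at hres' har'
      by_cases hc0 : c = 0
      · have h0 : h'.order = (0 : ℕ) := by
          rw [Nat.cast_zero, order_eq_zero_iff, e3 hc0]
          exact hc
        exact hres' (ih 0 (by omega) i.rev 1 b' _ le_rfl (by omega)
          (by rw [order_unit_mul e4, h0]) (by omega) har')
      · obtain ⟨k, hk, hk'⟩ := order_le_of_coeff e2
        rcases Nat.lt_or_ge k m with hlt | hge
        · exact hres' (ih k hlt i.rev 1 b' _ le_rfl (by omega)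
            (by rw [order_unit_mul e4, hk']) (by omega) har')
        · obtain rfl : k = m := by omega
          have hr' : TransversalResolvable K i.rev k := by
            refine hr.resolve_left ?_
            rintro rfl
            exact absurd (hjc.resolve_right hc0) (by decide)
          refine hres' (hr' b' _ (by omega) (by rw [order_unit_mul e4, hk']) ?_ har')
          rw [coeff_unit_mul hk' (by simp)]
          exact mul_ne_zero e4 (coeff_ne_zero_of_order hk' e2)
  choose c s' hs' hc' using step
  let s₀ : {s // Bad s} := ⟨(b₀, 1, h₀), by
    simp only [Bad]
    exact ⟨hb₀, by simp, hm₀, hc₀, by simpa using har₀, by simpa using hbad₀⟩⟩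
  let s : ℕ → {s // Bad s} := fun n => Nat.rec s₀ (fun _ t => s' t) n
  obtain ⟨θ, hθ, h0, hrev, hgrad⟩ := exists_arc_of_chain i hm (fun n => c (s n))
    (fun n => (s n).1.2.2) (fun n => hs' (s n))
  have h0' : θ h₀ = 0 := h0
  rcases Nat.lt_or_ge m 2 with hlt | hge
  · obtain rfl : m = 1 := by omega
    have hb1 : ∀ n, (s n).1.1 = 1 := by
      intro n
      obtain ⟨⟨b, u, h⟩, hb, hu, hm, hc, har, hres⟩ := s n
      simp only at hb hu hm hc har hres ⊢
      by_contra hne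
      obtain rfl : b = 0 := by omega
      apply hres
      refine Resolvable.node _ ?_
      rw [pow_one, pow_zero, one_mul]
      refine isNode_X_mul (by rw [order_unit_mul hu, hm]; rfl) ?_
      rw [coeff_unit_mul hm (by simp)]
      exact mul_ne_zero hu hc
    have hc0 : ∀ n, c (s n) = 0 := by
      intro n
      by_contra hne
      exact one_ne_zero ((hb1 (n + 1)).symm.trans (hc' (s n) hne))
    have hb₀1 : b₀ = 1 := hb1 0
    subst hb₀1
    have hX := hrev hc0
    have : ArcReduced (X i.rev * (X i * h₀)) := by
      convert har₀ using 1
      ring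
    exact this.of_mul_right hθ hX (by rw [map_mul, h0', mul_zero])
  · obtain ⟨k, hk⟩ := har₀ θ hθ (by simp [h0'])
    apply hk
    have hk0 : θ (pderiv K k h₀) = 0 := hgrad hge k
    rw [← mul_assoc, Derivation.leibniz]
    simp [h0', hk0]

/-- By induction on `m`. After a blow-up the exceptional curve is transversal to every curve whose
multiplicity has not dropped, so that the transversal case suffices. -/
theorem boundaryResolvable (m : ℕ) : BoundaryResolvable K m := by
  induction m using Nat.strong_induction_on with
  | _ m ih =>
    rcases Nat.eq_zero_or_pos m with rfl | hm
    · exact boundaryResolvable_zero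
    have t0 : TransversalResolvable K 0 m := TransversalResolvable.of_lt 0 hm ih (Or.inl rfl)
    have t1 : TransversalResolvable K 1 m := TransversalResolvable.of_lt 1 hm ih (Or.inr t0)
    have t : ∀ i, TransversalResolvable K i m := fun i => by
      fin_cases i
      · exact t0
      · exact t1
    have key : ∀ (i : Fin 2) (c : K) (a b : ℕ) (h : Plane K), a ≤ 1 → b ≤ 1 → h.order = m →
        ArcReduced (X i ^ a * (X i.rev ^ b * h)) →
        ∃ g, blow i c (X i ^ a * (X i.rev ^ b * h)) = X i ^ (a + b + m) * g ∧
          Resolvable (X i * g) := by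
      intro i c a b h ha hb hm har
      obtain ⟨h', u', b', e1, e2, e3, e4, e5, e6, e7⟩ :=
        exists_blow_boundary i c a b (u := 1) (by simp) hm
      rw [one_mul] at e7
      refine ⟨_, e7, ?_⟩
      have har' := har.blow e7 (not_X_dvd_boundary _ _ e4 e2)
      rw [← pow_one (X i)] at har' ⊢
      obtain ⟨k, hk, hk'⟩ := order_le_of_coeff e2
      rcases Nat.lt_or_ge k m with hlt | hge
      · exact ih k hlt i 1 b' _ le_rfl (by omega) (by rw [order_unit_mul e4, hk']) (by omega) har'
      · obtain rfl : k = m := by omega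
        refine t i b' _ (by omega) (by rw [order_unit_mul e4, hk']) ?_ har'
        rw [coeff_unit_mul hk' (by simp)]
        exact mul_ne_zero e4 (coeff_ne_zero_of_order hk' e2)
    intro i a b h ha hb hord h1 har
    by_contra hres
    have hM := order_boundary i a b (u := 1) (by simp) hord
    rw [one_mul] at hM
    obtain ⟨j, c, hjc, hch⟩ := exists_child_not_resolvable hM h1 hres
    obtain rfl | rfl := eq_or_eq_rev i j
    · obtain ⟨g, hg, hg'⟩ := key j c a b h ha hb hord har
      exact hch g hg hg'
    · have hG : X i ^ a * (X i.rev ^ b * h) = X i.rev ^ b * (X i.rev.rev ^ a * h) := by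
        rw [Fin.rev_rev]; ring
      rw [hG] at har hch
      obtain ⟨g, hg, hg'⟩ := key i.rev c b a h hb ha hord har
      rw [add_comm b a] at hg
      exact hch g hg hg'

/-- Embedded resolution of plane curve singularities. -/
theorem ArcReduced.resolvable {f : Plane K} (h : ArcReduced f) (h0 : f ≠ 0)
    (hc : constantCoeff f = 0) : Resolvable f := by
  obtain ⟨m, hm⟩ := ENat.ne_top_iff_exists.mp (mt MvPowerSeries.order_eq_top_iff.mp h0)
  have h1 : 1 ≤ m := by
    have := one_le_order_iff.mpr hc
    rw [← hm] at this
    exact_mod_cast this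
  have := boundaryResolvable m 0 0 0 f (by omega) (by omega) hm.symm (by omega)
    (by simpa using h)
  simpa using this

/-! ### Trivial deformations are equisingular -/

/-- The first order deformation of the curve `f = 0` by the vector field with components `A` and
the multiplier `α` of the equation. -/
def moved (A : Fin 2 → Plane K) (α f : Plane K) : PlaneEps K :=
  family f (∑ k, A k * pderiv K k f + α * f)

/-- The infinitesimal automorphism given by the vector field with components `A`. -/
def infinitesimalAut (A : Fin 2 → Plane K) : Plane K →+* PlaneEps K where
  toFun f := moved A 0 f
  map_one' := planeEps_ext (by rw [moved, closedFibre_family]; exact (map_one _).symm)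
    (by
      have : epsPart (1 : PlaneEps K) = 0 := by
        rw [← map_one (C : K[ε] →+* PlaneEps K), epsPart_C]; simp
      rw [moved, epsPart_family, this]; simp)
  map_mul' f g := planeEps_ext
    (by rw [closedFibre_mul]; simp only [moved, closedFibre_family])
    (by
      rw [epsPart_mul]
      simp only [moved, closedFibre_family, epsPart_family, Derivation.leibniz, Fin.sum_univ_two,
        smul_eq_mul]
      ring)
  map_zero' := planeEps_ext (by rw [moved, closedFibre_family]; exact (map_zero _).symm)
    (by rw [moved, epsPart_family]; simp; rfl)
  map_add' f g := planeEps_ext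
    (by rw [closedFibre_add]; simp only [moved, closedFibre_family])
    (by
      rw [epsPart_add]
      simp only [moved, epsPart_family, map_add, Fin.sum_univ_two]
      ring)

theorem infinitesimalAut_apply (A : Fin 2 → Plane K) (f : Plane K) :
    infinitesimalAut A f = moved A 0 f := rfl

theorem moved_eq (A : Fin 2 → Plane K) (α f : Plane K) :
    moved A α f = family 1 α * infinitesimalAut A f := by
  rw [infinitesimalAut_apply]
  refine planeEps_ext ?_ ?_
  · rw [closedFibre_mul]; simp [moved, closedFibre_family]
  · rw [epsPart_mul]; simp [moved, closedFibre_family, epsPart_family, mul_comm]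

/-- The equations of the section with components `v`. -/
def sectionEq (v : Fin 2 → K) (k : Fin 2) : PlaneEps K := X k - C (v k • (ε : K[ε]))

theorem closedFibre_sectionEq (v : Fin 2 → K) (k : Fin 2) : closedFibre (sectionEq v k) = X k := by
  rw [sectionEq, sub_eq_add_neg, ← map_neg, closedFibre_add, closedFibre_X, closedFibre_C]
  simp

theorem epsPart_sectionEq (v : Fin 2 → K) (k : Fin 2) : epsPart (sectionEq v k) = - C (v k) := by
  rw [sectionEq, sub_eq_add_neg, ← map_neg, epsPart_add, epsPart_X, epsPart_C]
  simp

theorem sectionIdeal_eq (v : Fin 2 → K) :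
    sectionIdeal (v 0) (v 1) = Ideal.span (Set.range (sectionEq v)) := by
  rw [sectionIdeal]
  congr 1
  ext f
  simp [sectionEq, eq_comm]

theorem sectionEq_mem (v : Fin 2 → K) (k : Fin 2) : sectionEq v k ∈ sectionIdeal (v 0) (v 1) := by
  rw [sectionIdeal_eq]; exact Ideal.subset_span ⟨k, rfl⟩

/-- An infinitesimal automorphism takes the maximal ideal to the ideal of the section to which it moves
the closed point, so that the moved curve is equimultiple along that section. -/
theorem moved_mem_sectionIdeal_pow (A : Fin 2 → Plane K) (α : Plane K) {f : Plane K} {m : ℕ}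
    (hf : (m : ℕ∞) ≤ f.order) :
    moved A α f ∈
      sectionIdeal (-constantCoeff (A 0)) (-constantCoeff (A 1)) ^ m := by
  set v : Fin 2 → K := fun k => -constantCoeff (A k)
  rw [moved_eq]
  refine Ideal.mul_mem_left _ _ ?_
  have hle : (maxIdeal K).map (infinitesimalAut A) ≤ sectionIdeal (v 0) (v 1) := by
    rw [maxIdeal_eq_span, Ideal.map_span, Ideal.span_le]
    rintro _ ⟨_, ⟨k, rfl⟩, rfl⟩
    obtain ⟨g, hg⟩ := exists_eq_sum_of_constantCoeff_eq_zero
      (f := A k - C (constantCoeff (A k))) (by simp)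
    have e : infinitesimalAut A (X k) = sectionEq v k + ∑ l, sectionEq v l * family 0 (g l) := by
      rw [infinitesimalAut_apply]
      refine planeEps_ext ?_ ?_
      · simp only [Fin.sum_univ_two, closedFibre_add, closedFibre_mul, closedFibre_family,
          closedFibre_sectionEq, moved]
        simp
      · simp only [Fin.sum_univ_two, epsPart_add, epsPart_mul, closedFibre_family, epsPart_family,
          closedFibre_sectionEq, moved, epsPart_sectionEq]
        have h1 : ∑ l, A l * pderiv K l (X k) = A k := by
          rw [Finset.sum_eq_single k]
          · simp
          · intro l _ hl; rw [MvPowerSeries.pderiv_X_of_ne hl.symm, mul_zero]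
          · simp
        rw [Fin.sum_univ_two] at h1 hg
        rw [h1]
        simp only [v, map_neg, neg_neg]
        linear_combination hg
    rw [SetLike.mem_coe, e]
    exact Ideal.add_mem _ (sectionEq_mem v k)
      (Ideal.sum_mem _ fun l _ => Ideal.mul_mem_right _ _ (sectionEq_mem v l))
  have h1 := Ideal.mem_map_of_mem (infinitesimalAut A) (mem_maxIdeal_pow.mpr hf)
  rw [Ideal.map_pow] at h1
  exact Ideal.pow_right_mono hle m h1

/-- A vector field lifts to the blow-up along the section through which it moves the closed point,
and the lift is tangent to the exceptional curve. -/
theorem exists_moved_blow (A : Fin 2 → Plane K) (α : Plane K) {f g : Plane K} {m : ℕ} {i : Fin 2}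
    {c : K} (hg : blow i c f = X i ^ m * g) :
    ∃ (𝓖 : PlaneEps K) (A' : Fin 2 → Plane K) (α' : Plane K),
      chartHom i (fun k => -constantCoeff (A k)) c (moved A α f) = X i ^ m * 𝓖 ∧
      X i * 𝓖 = moved A' α' (X i * g) ∧ constantCoeff (A' i) = 0 := by
  have key : ∀ k, ∃ B, blow i c (A k) = C (constantCoeff (A k)) + X i * B := fun k => by
    obtain ⟨b, hb⟩ := X_dvd_blow (i := i) (c := c) (f := A k - C (constantCoeff (A k))) (by simp)
    exact ⟨b, by rw [← hb, map_sub, blow_C]; ring⟩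
  choose B hB using key
  -- In the chart, `X i.rev = x / y - c` for the coordinates `x` and `y = X i` below, whence the
  -- quotient rule for the second component.
  let A' : Fin 2 → Plane K := fun k => if k = i then X i * B i else B i.rev - (X i.rev + C c) * B i
  have hA'i : A' i = X i * B i := by simp [A']
  have hA'r : A' i.rev = B i.rev - (X i.rev + C c) * B i := by simp [A', rev_ne]
  let β : Plane K := blow i c α + (m : Plane K) * B i
  refine ⟨moved A' β g, A', β - B i, ?_, ?_, by rw [hA'i]; simp⟩
  · refine planeEps_ext ?_ ?_
    · rw [closedFibre_chartHom, closedFibre_mul, closedFibre_pow, closedFibre_X]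
      simp only [moved, closedFibre_family, hg]
    · have hpow : ∀ n : ℕ, epsPart ((X i : PlaneEps K) ^ n) = 0 := by
        intro n
        induction n with
        | zero =>
          rw [pow_zero, ← map_one (C : K[ε] →+* PlaneEps K), epsPart_C]; simp
        | succ n ih => rw [pow_succ, epsPart_mul, ih, epsPart_X]; simp
      rw [epsPart_chartHom, epsPart_mul, closedFibre_pow, closedFibre_X, hpow]
      have e1 := pderiv_blow i c f
      have e2 := pderiv_rev_blow i c f
      have e3 := pderiv_X_pow_mul i m g
      rw [hg] at e1 e2
      rw [e1] at e3
      rw [pderiv_X_pow_mul_rev] at e2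
      simp only [moved, closedFibre_family, epsPart_family, sum_eq_add_rev i, map_add, map_mul, hB,
        hA'i, hA'r, hg, map_neg, β]
      linear_combination (B i) * e3 - (B i.rev - (X i.rev + C c) * B i) * e2
  · refine planeEps_ext ?_ ?_
    · rw [closedFibre_mul, closedFibre_X]
      simp only [moved, closedFibre_family]
    · rw [epsPart_mul, closedFibre_X, epsPart_X]
      simp only [moved, closedFibre_family, epsPart_family, sum_eq_add_rev i, hA'i, hA'r,
        Derivation.leibniz, MvPowerSeries.pderiv_X_self, MvPowerSeries.pderiv_X_of_ne (rev_ne i).symm,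
        smul_eq_mul]
      ring

/-- A curve that can be resolved is deformed equisingularly by vector fields. -/
theorem Resolvable.isEquisingularAlong_moved {f : Plane K} (h : Resolvable f) :
    ∀ (A : Fin 2 → Plane K) (α : Plane K), IsEquisingularAlong (moved A α f)
      (-constantCoeff (A 0)) (-constantCoeff (A 1)) := by
  induction h with
  | smooth f hf =>
    intro A α
    refine IsEquisingularAlong.smooth _ _ _ (by rwa [moved, closedFibre_family]) ?_
    simpa using moved_mem_sectionIdeal_pow A α (m := 1) (f := f) (by rw [hf]; rfl)
  | node f hf =>
    intro A α
    refine IsEquisingularAlong.node _ _ _ (by rwa [moved, closedFibre_family]) ?_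
    exact moved_mem_sectionIdeal_pow A α (by rw [hf.1]; rfl)
  | blowup f m mult singular not_node g transform resolvable ih =>
    intro A α
    have hv : (![-constantCoeff (A 0), -constantCoeff (A 1)] : Fin 2 → K) =
        fun k => -constantCoeff (A k) := by
      funext k; fin_cases k <;> rfl
    have key : ∀ i c, (i = 0 ∨ c = 0) → ∃ (𝓖 : PlaneEps K) (s : Fin 2 → K),
        chartHom i (fun k => -constantCoeff (A k)) c (moved A α f) = X i ^ m * 𝓖 ∧
        IsEquisingularAlong (X i * 𝓖) (s 0) (s 1) ∧ s i = 0 := by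
      intro i c hic
      obtain ⟨𝓖, A', α', h1, h2, h3⟩ := exists_moved_blow A α (transform i c hic)
      exact ⟨𝓖, fun k => -constantCoeff (A' k), h1, by rw [h2]; exact ih i c hic A' α', by simp [h3]⟩
    choose! 𝓖 s h1 h2 h3 using key
    refine IsEquisingularAlong.blowup _ _ _ m (by rwa [moved, closedFibre_family]) singular
      (by rwa [moved, closedFibre_family]) (moved_mem_sectionIdeal_pow A α mult.ge)
      (fun c => 𝓖 0 c) (fun c => s 0 c 1) (fun c => ?_) (fun c => ?_) (𝓖 1 0) (s 1 0 0) ?_ ?_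
    · rw [chart_eq, hv]; exact h1 0 c (Or.inl rfl)
    · have := h2 0 c (Or.inl rfl)
      rwa [h3 0 c (Or.inl rfl)] at this
    · rw [chartInfty_eq, hv]; exact h1 1 0 (Or.inr rfl)
    · have := h2 1 0 (Or.inr rfl)
      rwa [h3 1 0 (Or.inr rfl)] at this

/-- A derivation and a multiplier deform the union of a curve `f = 0` and of an invariant curve
`z = 0` equisingularly; up to a unit, the second curve does not move. -/
theorem isEquisingular_of_derivation {z f : Plane K} (hres : Resolvable (z * f))
    (δ : Derivation K (Plane K) (Plane K)) (β α : Plane K) (hz : δ z = β * z) :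
    IsEquisingular (family z 0 * family f (δ f + α * f)) := by
  refine ⟨-constantCoeff (δ (X 0)), -constantCoeff (δ (X 1)), ?_⟩
  have := hres.isEquisingularAlong_moved (fun k => δ (X k)) (α - β)
  convert this using 1
  refine planeEps_ext ?_ ?_
  · rw [closedFibre_mul]; simp only [moved, closedFibre_family]
  · rw [epsPart_mul]
    simp only [moved, closedFibre_family, epsPart_family]
    have e := derivation_eq_sum δ (z * f)
    rw [Derivation.leibniz, hz] at e
    rw [← e]
    simp only [smul_eq_mul]
    ring

end Plane

section Puiseux

open Polynomial

variable {K : Type*} [Field K]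

/-! ### The theorem of Newton and Puiseux -/

instance isAdicComplete_powerSeries :
    IsAdicComplete (IsLocalRing.maximalIdeal (PowerSeries K)) (PowerSeries K) := by
  rw [PowerSeries.maximalIdeal_eq_span_X]
  infer_instance

theorem mem_maximalIdeal_powerSeries {f : PowerSeries K} :
    f ∈ IsLocalRing.maximalIdeal (PowerSeries K) ↔ PowerSeries.constantCoeff f = 0 := by
  rw [PowerSeries.maximalIdeal_eq_span_X, Ideal.mem_span_singleton, PowerSeries.X_dvd_iff]

theorem X_pow_dvd_iff_le_order {n : ℕ} {f : PowerSeries K} :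
    PowerSeries.X ^ n ∣ f ↔ n ≤ f.order := by
  rw [PowerSeries.X_pow_dvd_iff]
  exact ⟨fun h => PowerSeries.nat_le_order f n h, fun h m hm =>
    PowerSeries.coeff_of_lt_order m (lt_of_lt_of_le (by exact_mod_cast hm) h)⟩

/-- A polynomial that vanishes at the origin has a distinguished factor. -/
theorem exists_distinguished_dvd {P : (PowerSeries K)[X]} (hP : P.Monic)
    (h0 : PowerSeries.constantCoeff (P.coeff 0) = 0) :
    ∃ W : (PowerSeries K)[X], W.Monic ∧ W ∣ P ∧ 1 ≤ W.natDegree ∧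
      ∀ j < W.natDegree, PowerSeries.constantCoeff (W.coeff j) = 0 := by
  have hres : (P : PowerSeries (PowerSeries K)).map (IsLocalRing.residue (PowerSeries K)) ≠ 0 := by
    intro h
    have := congrArg (PowerSeries.coeff P.natDegree) h
    rw [PowerSeries.coeff_map, Polynomial.coeff_coe, hP.coeff_natDegree] at this
    simp at this
  obtain ⟨W, u, hW⟩ := PowerSeries.exists_isWeierstrassFactorization hres
  have hWm := hW.isDistinguishedAt.monic
  have hmod : P %ₘ W = 0 := by
    have hlt : (P %ₘ W).degree < W.degree := degree_modByMonic_lt _ hWm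
    have key : (P %ₘ W : (PowerSeries K)[X]) = (W : PowerSeries (PowerSeries K)) *
        (u - ((P /ₘ W : (PowerSeries K)[X]) : PowerSeries (PowerSeries K))) := by
      have h1 := congrArg (fun p : (PowerSeries K)[X] => (p : PowerSeries (PowerSeries K)))
        (modByMonic_add_div P W)
      simp only [Polynomial.coe_add, Polynomial.coe_mul] at h1
      rw [mul_sub, ← hW.eq_mul, ← h1]
      ring
    have hresW : (W : PowerSeries (PowerSeries K)).map
        (IsLocalRing.residue (PowerSeries K)) ≠ 0 := by
      intro h
      have := congrArg (PowerSeries.coeff W.natDegree) h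
      rw [PowerSeries.coeff_map, Polynomial.coeff_coe, hWm.coeff_natDegree] at this
      simp at this
    have hfac : (W : PowerSeries (PowerSeries K)).IsWeierstrassFactorization W 1 :=
      ⟨hW.isDistinguishedAt, isUnit_one, by simp⟩
    have hdegW := PowerSeries.IsWeierstrassFactorization.natDegree_eq_toNat_order_map hfac
    have hdiv : PowerSeries.IsWeierstrassDivision 0 (W : PowerSeries (PowerSeries K))
        (u - ((P /ₘ W : (PowerSeries K)[X]) : PowerSeries (PowerSeries K))) (-(P %ₘ W)) := by
      refine ⟨?_, by rw [← key]; simp⟩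
      rw [degree_neg]
      refine lt_of_lt_of_le hlt ?_
      rw [degree_eq_natDegree hWm.ne_zero]
      exact_mod_cast hdegW.le
    simpa using (PowerSeries.IsWeierstrassDivision.eq_zero hresW hdiv).2
  have hdvd : W ∣ P := (modByMonic_eq_zero_iff_dvd hWm).mp hmod
  refine ⟨W, hWm, hdvd, ?_, fun j hj => ?_⟩
  · by_contra hlt
    have h1 : W = 1 := hWm.natDegree_eq_zero.mp (by omega)
    have hu : IsUnit (P : PowerSeries (PowerSeries K)) := by
      rw [hW.eq_mul, h1]; simpa using hW.isUnit
    rw [PowerSeries.isUnit_iff_constantCoeff, ← PowerSeries.coeff_zero_eq_constantCoeff_apply,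
      Polynomial.coeff_coe, PowerSeries.isUnit_iff_constantCoeff, h0] at hu
    exact not_isUnit_zero hu
  · exact mem_maximalIdeal_powerSeries.mp (hW.isDistinguishedAt.mem hj)

theorem coeff_taylor_pred {A : Type*} [CommRing A] {P : A[X]} {d : ℕ} (hP : P.Monic)
    (hd : P.natDegree = d + 1) (a : A) :
    (taylor a P).coeff d = P.coeff d + (d + 1) * a := by
  rw [taylor_coeff, eval_eq_sum_range' (n := 2), Finset.sum_range_succ, Finset.sum_range_one,
    hasseDeriv_coeff, hasseDeriv_coeff]
  · have h1 : P.coeff (1 + d) = 1 := by rw [add_comm, ← hd]; exact hP.coeff_natDegree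
    rw [h1, zero_add, add_comm 1 d]
    simp
  · have := natDegree_hasseDeriv_le P d
    omega

/-- The ramification `x = t ^ n`. -/
def ramify (n : ℕ) (hn : n ≠ 0) : PowerSeries K →+* PowerSeries K :=
  (PowerSeries.expand n hn).toRingHom

theorem ramify_apply (n : ℕ) (hn : n ≠ 0) (f : PowerSeries K) :
    ramify n hn f = PowerSeries.expand n hn f :=
  rfl

theorem constantCoeff_ramify (n : ℕ) (hn : n ≠ 0) (f : PowerSeries K) :
    PowerSeries.constantCoeff (ramify n hn f) = PowerSeries.constantCoeff f :=
  PowerSeries.constantCoeff_expand ..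

theorem order_ramify (n : ℕ) (hn : n ≠ 0) (f : PowerSeries K) :
    (ramify n hn f).order = n • f.order :=
  PowerSeries.order_expand ..

@[simp]
theorem ramify_X (n : ℕ) (hn : n ≠ 0) :
    ramify n hn (PowerSeries.X : PowerSeries K) = PowerSeries.X ^ n :=
  PowerSeries.expand_X ..

@[simp]
theorem ramify_C (n : ℕ) (hn : n ≠ 0) (a : K) :
    ramify n hn (PowerSeries.C a) = PowerSeries.C a :=
  PowerSeries.expand_C ..

/-- **Newton–Puiseux**: a monic polynomial over `K[[x]]` that vanishes at the origin has, after the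
ramification `x = t ^ n`, a root that vanishes at the origin. -/
theorem exists_puiseux_root [IsAlgClosed K] [CharZero K] (d : ℕ) :
    ∀ P : (PowerSeries K)[X], P.Monic → P.natDegree = d →
      PowerSeries.constantCoeff (P.coeff 0) = 0 →
      ∃ (n : ℕ) (hn : n ≠ 0) (η : PowerSeries K), PowerSeries.constantCoeff η = 0 ∧
        eval₂ (ramify n hn) η P = 0 := by
  induction d using Nat.strong_induction_on with
  | _ d ih =>
  -- The case of a proper distinguished factor reduces to smaller degree.
  have reduce : ∀ P W : (PowerSeries K)[X], W ∣ P → W.Monic → 1 ≤ W.natDegree →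
      (∀ j < W.natDegree, PowerSeries.constantCoeff (W.coeff j) = 0) → W.natDegree < d →
      ∃ (n : ℕ) (hn : n ≠ 0) (η : PowerSeries K), PowerSeries.constantCoeff η = 0 ∧
        eval₂ (ramify n hn) η P = 0 := by
    intro P W hWP hW h1 hj hlt
    obtain ⟨n, hn, η, hη, hr⟩ := ih _ hlt W hW rfl (hj 0 h1)
    obtain ⟨Q, rfl⟩ := hWP
    exact ⟨n, hn, η, hη, by rw [eval₂_mul, hr, zero_mul]⟩
  intro P hP hd h0
  obtain ⟨W, hW, hWP, hW1, hWj⟩ := exists_distinguished_dvd hP h0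
  have hWd : W.natDegree ≤ d := hd ▸ natDegree_le_of_dvd hWP hP.ne_zero
  rcases Nat.lt_or_ge W.natDegree d with hlt | hge
  · exact reduce P W hWP hW hW1 hWj hlt
  have hWPeq : W = P := (eq_of_monic_of_dvd_of_natDegree_le hW hP hWP (by omega)).symm
  rw [hWPeq] at hWj hW1
  obtain ⟨D, rfl⟩ : ∃ D, d = D + 1 := ⟨d - 1, by omega⟩
  -- The Tschirnhaus transformation kills the second coefficient.
  set a : PowerSeries K := PowerSeries.C (-((D : K) + 1)⁻¹) * P.coeff D with ha
  have ha0 : PowerSeries.constantCoeff a = 0 := by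
    rw [ha, map_mul, hWj D (by omega), mul_zero]
  have hD0 : (D : K) + 1 ≠ 0 := by exact_mod_cast Nat.succ_ne_zero D
  set P₁ := taylor a P with hP₁
  have hP₁m : P₁.Monic := by
    rw [Monic, hP₁, leadingCoeff_taylor, hP.leadingCoeff]
  have hP₁d : P₁.natDegree = D + 1 := by rw [hP₁, natDegree_taylor, hd]
  have hP₁D : P₁.coeff D = 0 := by
    rw [hP₁, coeff_taylor_pred hP hd, ha]
    have : ((D : PowerSeries K) + 1) = PowerSeries.C ((D : K) + 1) := by simp
    rw [this, ← mul_assoc, ← map_mul, mul_neg, mul_inv_cancel₀ hD0]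
    simp
  have hP₁0 : ∀ j < D + 1, PowerSeries.constantCoeff (P₁.coeff j) = 0 := by
    have e1 : P.map PowerSeries.constantCoeff = X ^ (D + 1) := by
      ext j
      rw [coeff_map, coeff_X_pow]
      rcases lt_trichotomy j (D + 1) with h | h | h
      · rw [hWj j (by omega), if_neg h.ne]
      · rw [h, ← hd, hP.coeff_natDegree]; simp
      · rw [coeff_eq_zero_of_natDegree_lt (by omega), if_neg h.ne', map_zero]
    have e2 : P₁.map PowerSeries.constantCoeff = X ^ (D + 1) := by
      rw [hP₁, taylor_apply, Polynomial.map_comp, e1]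
      simp [ha0]
    intro j hj
    rw [← coeff_map, e2, coeff_X_pow, if_neg hj.ne]
  have back : ∀ (n : ℕ) (hn : n ≠ 0) (η : PowerSeries K), PowerSeries.constantCoeff η = 0 →
      eval₂ (ramify n hn) η P₁ = 0 →
      ∃ (n : ℕ) (hn : n ≠ 0) (η : PowerSeries K), PowerSeries.constantCoeff η = 0 ∧
        eval₂ (ramify n hn) η P = 0 := by
    intro n hn η hη hr
    refine ⟨n, hn, η + ramify n hn a, ?_, ?_⟩
    · rw [map_add, hη, constantCoeff_ramify, ha0, add_zero]
    · rw [hP₁, taylor_apply, eval₂_comp] at hr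
      simpa using hr
  by_cases hall : ∀ j < D + 1, P₁.coeff j = 0
  · have : P₁ = X ^ (D + 1) := by
      ext1 j
      rw [coeff_X_pow]
      rcases lt_trichotomy j (D + 1) with h | h | h
      · rw [hall j h, if_neg h.ne]
      · rw [h, if_pos rfl, ← hP₁d, hP₁m.coeff_natDegree]
      · rw [coeff_eq_zero_of_natDegree_lt (by omega), if_neg h.ne']
    exact back 1 one_ne_zero 0 (map_zero _) (by rw [this]; simp)
  -- The first edge of the Newton polygon.
  push Not at hall
  obtain ⟨j₁, hj₁, hj₁'⟩ := hall
  classical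
  let S := (Finset.range (D + 1)).filter fun j => P₁.coeff j ≠ 0
  have hord : ∀ j, P₁.coeff j ≠ 0 → (P₁.coeff j).order = (P₁.coeff j).order.toNat := fun j hj =>
    (ENat.natCast_toNat (by simpa [PowerSeries.order_eq_top] using hj)).symm
  obtain ⟨i, hiS, hi⟩ := S.exists_min_image
    (fun j => ((P₁.coeff j).order.toNat : ℚ) / ((D + 1 - j : ℕ) : ℚ)) ⟨j₁, by simp [S, hj₁, hj₁']⟩
  obtain ⟨hiD, hi0⟩ : i < D + 1 ∧ P₁.coeff i ≠ 0 := by simpa [S] using hiS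
  set r := (P₁.coeff i).order.toNat with hr
  have hN : D + 1 - i ≠ 0 := by omega
  have hr1 : 1 ≤ r := by
    have h1 : PowerSeries.X ^ 1 ∣ P₁.coeff i := by
      rw [pow_one, PowerSeries.X_dvd_iff]; exact hP₁0 i hiD
    have := X_pow_dvd_iff_le_order.mp h1
    rw [hord i hi0] at this
    exact_mod_cast this
  have hdvd : ∀ j, ∃ b : PowerSeries K, j < D + 1 →
      ramify (D + 1 - i) hN (P₁.coeff j) = PowerSeries.X ^ (r * (D + 1 - j)) * b := by
    intro j
    by_cases hj : j < D + 1
    · by_cases hj0 : P₁.coeff j = 0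
      · exact ⟨0, fun _ => by rw [hj0]; simp⟩
      · have h1 := hi j (by simp [S, hj, hj0])
        rw [div_le_div_iff₀ (by exact_mod_cast (show 0 < D + 1 - i by omega))
          (by exact_mod_cast (show 0 < D + 1 - j by omega))] at h1
        have h2 : r * (D + 1 - j) ≤ (P₁.coeff j).order.toNat * (D + 1 - i) := by exact_mod_cast h1
        have : PowerSeries.X ^ (r * (D + 1 - j)) ∣
            ramify (D + 1 - i) hN (P₁.coeff j) := by
          rw [X_pow_dvd_iff_le_order, order_ramify, hord j hj0,
            nsmul_eq_mul, mul_comm]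
          norm_cast
          linarith [h2]
        obtain ⟨b, hb⟩ := this
        exact ⟨b, fun _ => hb⟩
    · exact ⟨0, fun h => absurd h hj⟩
  choose b hb using hdvd
  have hbD : b D = 0 := by
    have := hb D (by omega)
    rw [hP₁D, map_zero] at this
    exact (mul_eq_zero.mp this.symm).resolve_left (pow_ne_zero _ PowerSeries.X_ne_zero)
  have hbi : PowerSeries.constantCoeff (b i) ≠ 0 := by
    intro h
    have h1 := hb i hiD
    obtain ⟨b', hb'⟩ := PowerSeries.X_dvd_iff.mpr h
    have h2 : PowerSeries.X ^ (r * (D + 1 - i) + 1) ∣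
        ramify (D + 1 - i) hN (P₁.coeff i) :=
      ⟨b', by rw [h1, hb', pow_succ]; ring⟩
    rw [X_pow_dvd_iff_le_order, order_ramify, hord i hi0, nsmul_eq_mul,
      mul_comm, ← hr] at h2
    have h3 : (D + 1 - i) * r + 1 ≤ (D + 1 - i) * r := by exact_mod_cast h2
    omega
  let R : (PowerSeries K)[X] := ∑ j ∈ Finset.range (D + 1), C (b j) * X ^ j
  have hRd : R.degree < (D + 1 : ℕ) := by
    refine (degree_sum_le _ _).trans_lt ((Finset.sup_lt_iff (WithBot.bot_lt_coe _)).mpr ?_)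
    intro j hj
    refine (degree_C_mul_X_pow_le _ _).trans_lt ?_
    exact_mod_cast Finset.mem_range.mp hj
  have hRc : ∀ j < D + 1, R.coeff j = b j := by
    intro j hj
    simp only [R, finsetSum_coeff, coeff_C_mul, coeff_X_pow]
    rw [Finset.sum_eq_single j]
    · simp
    · intro k _ hk; simp [hk.symm]
    · intro h; exact absurd (Finset.mem_range.mpr hj) h
  let Q : (PowerSeries K)[X] := X ^ (D + 1) + R
  have hQm : Q.Monic := monic_X_pow_add hRd
  have hQd : Q.natDegree = D + 1 := natDegree_eq_of_degree_eq_some (by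
    simp only [Q]
    rw [degree_add_eq_left_of_degree_lt (by rwa [degree_X_pow]), degree_X_pow])
  have hQc : ∀ j < D + 1, Q.coeff j = b j := by
    intro j hj
    simp only [Q]
    rw [coeff_add, coeff_X_pow, if_neg hj.ne, zero_add, hRc j hj]
  have hscale : ∀ (τ : PowerSeries K →+* PowerSeries K) (z : PowerSeries K),
      eval₂ (τ.comp (ramify (D + 1 - i) hN))
        (τ PowerSeries.X ^ r * z) P₁ = τ PowerSeries.X ^ (r * (D + 1)) * eval₂ τ z Q := by
    intro τ z
    rw [eval₂_eq_sum_range, eval₂_eq_sum_range, hP₁d, hQd, Finset.mul_sum]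
    refine Finset.sum_congr rfl fun j hj => ?_
    have hj' : j ≤ D + 1 := Nat.lt_succ_iff.mp (Finset.mem_range.mp hj)
    rcases hj'.lt_or_eq with h | h
    · have h3 := hb j h
      rw [RingHom.comp_apply]
      change τ (ramify (D + 1 - i) hN (P₁.coeff j)) * _ = _
      rw [h3, hQc j h, map_mul, map_pow, mul_pow, ← pow_mul,
        show r * (D + 1) = r * (D + 1 - j) + r * j by rw [← mul_add]; congr 1; omega, pow_add]
      ring
    · rw [h, show P₁.coeff (D + 1) = 1 by rw [← hP₁d]; exact hP₁m.coeff_natDegree,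
        show Q.coeff (D + 1) = 1 by rw [← hQd]; exact hQm.coeff_natDegree, map_one, map_one,
        mul_pow, ← pow_mul]
      ring
  -- A root of the edge polynomial; its multiplicity is not full.
  obtain ⟨c, hc⟩ := IsAlgClosed.exists_root (Q.map PowerSeries.constantCoeff) (by
    rw [degree_map_eq_of_leadingCoeff_ne_zero _ (by rw [hQm.leadingCoeff]; simp),
      degree_eq_natDegree hQm.ne_zero, hQd]
    exact_mod_cast Nat.succ_ne_zero D)
  set Q₂ := taylor (PowerSeries.C c) Q with hQ₂
  have hQ₂m : Q₂.Monic := by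
    rw [Monic, hQ₂, leadingCoeff_taylor, hQm.leadingCoeff]
  have hQ₂d : Q₂.natDegree = D + 1 := by rw [hQ₂, natDegree_taylor, hQd]
  have hQ₂0 : PowerSeries.constantCoeff (Q₂.coeff 0) = 0 := by
    rw [hQ₂, taylor_coeff_zero]
    rw [IsRoot, eval_map] at hc
    rw [← eval₂_at_apply]
    simpa using hc
  obtain ⟨W', hW', hWP', hW1', hWj'⟩ := exists_distinguished_dvd hQ₂m hQ₂0
  have hWd' : W'.natDegree ≤ D + 1 := hQ₂d ▸ natDegree_le_of_dvd hWP' hQ₂m.ne_zero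
  have hWlt : W'.natDegree < D + 1 := by
    refine lt_of_le_of_ne hWd' fun heq => ?_
    have hWeq : W' = Q₂ := (eq_of_monic_of_dvd_of_natDegree_le hW' hQ₂m hWP' (by omega)).symm
    have e2 : (taylor c (Q.map PowerSeries.constantCoeff)) = X ^ (D + 1) := by
      have : taylor c (Q.map PowerSeries.constantCoeff) = Q₂.map PowerSeries.constantCoeff := by
        rw [hQ₂, taylor_apply, taylor_apply, Polynomial.map_comp]; simp
      rw [this]
      ext j
      rw [coeff_map, coeff_X_pow, ← hWeq]
      rcases lt_trichotomy j (D + 1) with h | h | h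
      · rw [hWj' j (by omega), if_neg h.ne]
      · rw [h, ← heq, hW'.coeff_natDegree]; simp
      · rw [coeff_eq_zero_of_natDegree_lt (by omega), if_neg h.ne', map_zero]
    have hQ0m : (Q.map PowerSeries.constantCoeff).Monic := hQm.map _
    have hQ0d : (Q.map (PowerSeries.constantCoeff (R := K))).natDegree = D + 1 := by
      rw [hQm.natDegree_map, hQd]
    have e3 := coeff_taylor_pred hQ0m hQ0d c
    rw [e2, coeff_X_pow, if_neg (by omega), coeff_map, hQc D (by omega), hbD, map_zero,
      zero_add] at e3
    have hc0 : c = 0 := (mul_eq_zero.mp e3.symm).resolve_left hD0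
    rw [hc0, taylor_zero] at e2
    have e4 := congrArg (fun p => p.coeff i) e2
    simp only [coeff_map, coeff_X_pow, hQc i hiD, if_neg hiD.ne] at e4
    exact hbi e4
  obtain ⟨n, hn, ζ, hζ, hroot⟩ := reduce Q₂ W' hWP' hW' hW1' hWj' hWlt
  rw [hQ₂, taylor_apply, eval₂_comp] at hroot
  have hz := hscale (ramify n hn)
    (eval₂ (ramify n hn) ζ (X + C (PowerSeries.C c)))
  rw [hroot, mul_zero] at hz
  have hcomp : (ramify n hn).comp (ramify (D + 1 - i) hN) =
      (ramify (n * (D + 1 - i)) (mul_ne_zero hn hN) : PowerSeries K →+* PowerSeries K) :=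
    RingHom.ext fun f => (PowerSeries.expand_mul n hn (D + 1 - i) hN f).symm
  rw [hcomp] at hz
  refine back (n * (D + 1 - i)) (mul_ne_zero hn hN) _ ?_ hz
  rw [map_mul, map_pow]
  simp [hn, show r ≠ 0 by omega]

end Puiseux

section Curves

open MvPowerSeries (X C coeff constantCoeff pderiv order)

variable {K : Type*} [Field K]

/-! ### Branches of a curve -/

/-- `K[[x, y]]` as the ring of power series in `y` over `K[[x]]`. -/
def unfold : Plane K ≃ₐ[K] PowerSeries (PowerSeries K) :=
  (MvPowerSeries.renameEquiv K
    (⟨![some (), none], fun o => o.elim 1 fun _ => 0, by decide, by decide⟩ :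
      Fin 2 ≃ Option Unit)).trans (MvPowerSeries.optionEquivLeft Unit K)

theorem unfold_X_zero : unfold (X 0 : Plane K) = PowerSeries.C PowerSeries.X := by
  rw [unfold, AlgEquiv.trans_apply, MvPowerSeries.renameEquiv_apply]
  change MvPowerSeries.optionEquivLeft Unit K (MvPowerSeries.rename _ (X 0)) = _
  rw [MvPowerSeries.rename_X]
  exact MvPowerSeries.optionEquivLeft_X_some _

theorem unfold_X_one : unfold (X 1 : Plane K) = PowerSeries.X := by
  rw [unfold, AlgEquiv.trans_apply, MvPowerSeries.renameEquiv_apply]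
  change MvPowerSeries.optionEquivLeft Unit K (MvPowerSeries.rename _ (X 1)) = _
  rw [MvPowerSeries.rename_X]
  exact MvPowerSeries.optionEquivLeft_X_none

theorem unfold_C (a : K) : unfold (C a : Plane K) = PowerSeries.C (PowerSeries.C a) := by
  rw [unfold, AlgEquiv.trans_apply, MvPowerSeries.renameEquiv_apply]
  change MvPowerSeries.optionEquivLeft Unit K (MvPowerSeries.rename _ (C a)) = _
  rw [MvPowerSeries.rename_C]
  exact MvPowerSeries.optionEquivLeft_C a

theorem X_dvd_of_map_residue_eq_zero {f : Plane K}
    (h : (unfold f).map (IsLocalRing.residue (PowerSeries K)) = 0) : X 0 ∣ f := by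
  have h1 : ∀ n, ∃ b, PowerSeries.coeff n (unfold f) = PowerSeries.X * b := by
    intro n
    have h2 := congrArg (PowerSeries.coeff n) h
    rw [PowerSeries.coeff_map, map_zero, IsLocalRing.residue_eq_zero_iff,
      mem_maximalIdeal_powerSeries, ← PowerSeries.X_dvd_iff] at h2
    exact h2
  choose b hb using h1
  have h3 : unfold f = unfold (X 0) * PowerSeries.mk b := by
    ext1 n
    rw [hb, unfold_X_zero, PowerSeries.coeff_C_mul, PowerSeries.coeff_mk]
  refine ⟨unfold.symm (PowerSeries.mk b), unfold.injective ?_⟩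
  rw [map_mul, h3, AlgEquiv.apply_symm_apply]

/-- Ring homomorphisms from `K[[x]]` to itself that are continuous at the origin are determined by
their values on `x` and on constants. -/
theorem powerSeries_ringHom_ext {f g : PowerSeries K →+* PowerSeries K}
    (h0 : PowerSeries.constantCoeff (f PowerSeries.X) = 0)
    (hC : ∀ a, f (PowerSeries.C a) = g (PowerSeries.C a))
    (hX : f PowerSeries.X = g PowerSeries.X) : f = g := by
  have key : ∀ n : ℕ, ∀ a, PowerSeries.X ^ n ∣ f a - g a := by
    intro n
    induction n with
    | zero => simp
    | succ n ih =>
      intro a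
      obtain ⟨b, hb⟩ : PowerSeries.X ∣ a - PowerSeries.C (PowerSeries.constantCoeff a) := by
        rw [PowerSeries.X_dvd_iff]; simp
      have h1 : f a - g a = f PowerSeries.X * (f b - g b) := by
        rw [sub_eq_iff_eq_add.mp hb]
        simp only [map_add, map_mul, hC, ← hX]
        ring
      rw [h1, pow_succ']
      exact mul_dvd_mul (PowerSeries.X_dvd_iff.mpr h0) (ih b)
  refine RingHom.ext fun a => sub_eq_zero.mp ?_
  ext n
  rw [map_zero]
  exact PowerSeries.X_pow_dvd_iff.mp (key (n + 1) a) n (Nat.lt_succ_self n)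

/-- Every prime ideal of `K[[x, y]]` other than zero and the maximal ideal is the ideal of a
parametrized branch `θ`. In the parametrization supplied by the theorem of Newton and Puiseux, one
coordinate is a power of the parameter `t`, so that every power series in `t ^ n` lies in the image
of `θ`. -/
theorem exists_arc_ker_eq [IsAlgClosed K] [CharZero K] {p : Ideal (Plane K)} [hp : p.IsPrime]
    (hbot : p ≠ ⊥) (hmax : p ≠ maxIdeal K) :
    ∃ θ : Arc K, θ.Nonconst ∧ RingHom.ker θ = p ∧
      ∃ (n : ℕ) (hn : n ≠ 0), ∀ q, ramify n hn q ∈ (θ : Plane K →+* PowerSeries K).range := by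
  have hle : p ≤ maxIdeal K := le_maxIdeal_of_ne_top hp.ne_top
  by_cases hX0 : (X 0 : Plane K) ∈ p
  · -- The branch `x = 0`.
    have hspan : (Ideal.span {X 0} : Ideal (Plane K)).IsPrime :=
      (Ideal.span_singleton_prime (X_prime 0).ne_zero).mpr (X_prime 0)
    have hspan0 : (Ideal.span {X 0} : Ideal (Plane K)) ≠ ⊥ := by
      rw [Ne, Ideal.span_singleton_eq_bot]; exact (X_prime 0).ne_zero
    have hv : ∀ k, PowerSeries.constantCoeff
        ((![0, PowerSeries.X] : Fin 2 → PowerSeries K) k) = 0 := by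
      intro k; fin_cases k <;> simp
    have hnc : Arc.Nonconst (arcOf ![0, PowerSeries.X] hv) :=
      ⟨1, by rw [arcOf_X]; exact PowerSeries.X_ne_zero⟩
    refine ⟨arcOf ![0, PowerSeries.X] hv, hnc, ?_, 1, one_ne_zero, fun q => ?_⟩
    · rw [← eq_of_isPrime_of_le hspan0 ((Ideal.span_singleton_le_iff_mem _).mpr hX0) hmax]
      refine (Arc.eq_ker hnc hspan0 ((Ideal.span_singleton_le_iff_mem _).mpr ?_)).symm
      rw [RingHom.mem_ker, arcOf_X]
      rfl
    · refine ⟨unfold.symm (PowerSeries.map PowerSeries.C q), ?_⟩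
      have h1 : ((arcOf ![0, PowerSeries.X] hv : Arc K) : Plane K →+* PowerSeries K).comp
          (((unfold (K := K)).symm : PowerSeries (PowerSeries K) →+* Plane K).comp
            (PowerSeries.map PowerSeries.C)) = ramify 1 one_ne_zero := by
        have hX : (unfold (K := K)).symm PowerSeries.X = X 1 := by
          rw [← unfold_X_one, AlgEquiv.symm_apply_apply]
        have hC : ∀ a : K, (unfold (K := K)).symm (PowerSeries.C (PowerSeries.C a)) = C a := by
          intro a; rw [← unfold_C, AlgEquiv.symm_apply_apply]
        apply powerSeries_ringHom_ext
        · simp [hX, arcOf_X]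
        · intro a; simp [hC, arc_C]
        · simp [hX, arcOf_X]
      exact RingHom.congr_fun h1 q
  · -- An element of `p` that is regular in `y`.
    obtain ⟨F, hFp, hF⟩ : ∃ F ∈ p, ¬ X 0 ∣ F := by
      by_contra! hall
      refine hbot (eq_bot_iff.mpr fun f hf => ?_)
      have key : ∀ n : ℕ, ∀ f ∈ p, f ∈ maxIdeal K ^ n := by
        intro n
        induction n with
        | zero => simp
        | succ n ih =>
          intro f hf
          obtain ⟨g, rfl⟩ := hall f hf
          rw [pow_succ']
          exact Ideal.mul_mem_mul (mem_maxIdeal.mpr (by simp))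
            (ih g ((hp.mem_or_mem hf).resolve_left hX0))
      rw [← iInf_maxIdeal_pow (K := K), Submodule.mem_iInf]
      exact fun n => key n f hf
    have hres : (unfold F).map (IsLocalRing.residue (PowerSeries K)) ≠ 0 :=
      fun h => hF (X_dvd_of_map_residue_eq_zero h)
    let B := Plane K ⧸ p
    let π : PowerSeries (PowerSeries K) →+* B :=
      (Ideal.Quotient.mk p).comp ((unfold (K := K)).symm : PowerSeries (PowerSeries K) →+* Plane K)
    have hπ : ∀ f, π (unfold f) = Ideal.Quotient.mk p f := by
      intro f; simp [π]
    let _ : Algebra (PowerSeries K) B := (π.comp PowerSeries.C).toAlgebra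
    have halg : ∀ a, algebraMap (PowerSeries K) B a = π (PowerSeries.C a) := fun a => rfl
    have haev : ∀ P : Polynomial (PowerSeries K), Polynomial.aeval (π PowerSeries.X) P = π P := by
      intro P
      have : (Polynomial.aeval (π PowerSeries.X) : _ →ₐ[PowerSeries K] B).toRingHom =
          π.comp (Polynomial.coeToPowerSeries.ringHom) := by
        apply Polynomial.ringHom_ext
        · intro a; simp [halg]
        · simp
      exact RingHom.congr_fun this P
    have hinj : Function.Injective (algebraMap (PowerSeries K) B) := by
      rw [injective_iff_map_eq_zero]
      intro a ha
      by_contra hne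
      obtain ⟨b, hb⟩ := PowerSeries.X_pow_order_dvd (φ := a)
      have hu : IsUnit b := by
        rw [PowerSeries.isUnit_iff_constantCoeff, isUnit_iff_ne_zero]
        intro h0
        obtain ⟨b', rfl⟩ := PowerSeries.X_dvd_iff.mpr h0
        have : PowerSeries.X ^ (a.order.toNat + 1) ∣ a := ⟨b', by rw [pow_succ, mul_assoc]; exact hb⟩
        rw [X_pow_dvd_iff_le_order, ← PowerSeries.coe_toNat_order hne] at this
        have h2 : a.order.toNat + 1 ≤ a.order.toNat := by exact_mod_cast this
        omega
      rw [hb, map_mul, map_pow] at ha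
      have h3 : algebraMap (PowerSeries K) B PowerSeries.X = Ideal.Quotient.mk p (X 0) := by
        rw [halg, ← unfold_X_zero, hπ]
      rw [h3, (hu.map _).mul_left_eq_zero] at ha
      exact hX0 (Ideal.Quotient.eq_zero_iff_mem.mp (eq_zero_of_pow_eq_zero ha))
    have : Module.IsTorsionFree (PowerSeries K) B :=
      Module.IsTorsionFree.of_smul_eq_zero fun a b h => by
        rw [Algebra.smul_def, mul_eq_zero] at h
        exact h.imp (fun h => hinj (by rw [h, map_zero])) id
    obtain ⟨W, w, hW⟩ := PowerSeries.exists_isWeierstrassFactorization hres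
    have hWroot : Polynomial.aeval (π PowerSeries.X) W = 0 := by
      have h1 : π (unfold F) = 0 := by rw [hπ, Ideal.Quotient.eq_zero_iff_mem]; exact hFp
      rw [hW.eq_mul, map_mul, (hW.isUnit.map π).mul_left_eq_zero] at h1
      rw [haev, h1]
    have hint : IsIntegral (PowerSeries K) (π PowerSeries.X) :=
      ⟨W, hW.isDistinguishedAt.monic, hWroot⟩
    set μ := minpoly (PowerSeries K) (π PowerSeries.X) with hμ
    have hμ0 : PowerSeries.constantCoeff (μ.coeff 0) = 0 := by
      have h1 : π μ = 0 := by rw [← haev, hμ, minpoly.aeval]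
      obtain ⟨f, hf⟩ := (unfold (K := K)).surjective (μ : PowerSeries (PowerSeries K))
      rw [← hf, hπ, Ideal.Quotient.eq_zero_iff_mem] at h1
      have h2 := mem_maxIdeal.mp (hle h1)
      by_contra hne
      have h3 : IsUnit (unfold f) := by
        rw [hf, PowerSeries.isUnit_iff_constantCoeff,
          ← PowerSeries.coeff_zero_eq_constantCoeff_apply, Polynomial.coeff_coe,
          PowerSeries.isUnit_iff_constantCoeff, isUnit_iff_ne_zero]
        exact hne
      have h4 : IsUnit f := by simpa using h3.map (unfold (K := K)).symm
      exact isUnit_iff.mp h4 h2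
    obtain ⟨n, hn, η, hη, hroot⟩ :=
      exists_puiseux_root _ μ (minpoly.monic hint) rfl hμ0
    have hv : ∀ k, PowerSeries.constantCoeff
        ((![PowerSeries.X ^ n, η] : Fin 2 → PowerSeries K) k) = 0 := by
      intro k; fin_cases k <;> simp [hη, hn]
    set θ : Arc K := arcOf ![PowerSeries.X ^ n, η] hv with hθ
    have hnc : Arc.Nonconst θ :=
      ⟨0, by rw [hθ, arcOf_X]; exact pow_ne_zero _ PowerSeries.X_ne_zero⟩
    let τ : PowerSeries (PowerSeries K) →+* PowerSeries K :=
      (θ : Plane K →+* PowerSeries K).comp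
        ((unfold (K := K)).symm : PowerSeries (PowerSeries K) →+* Plane K)
    have hτ : ∀ f, τ (unfold f) = θ f := by intro f; simp [τ]
    have hτC : τ.comp PowerSeries.C = ramify n hn := by
      have h1 : τ (PowerSeries.C PowerSeries.X) = PowerSeries.X ^ n := by
        rw [← unfold_X_zero, hτ, hθ, arcOf_X]; rfl
      apply powerSeries_ringHom_ext
      · simp [h1, hn]
      · intro a
        rw [RingHom.comp_apply, ← unfold_C, hτ, arc_C, ramify_C]
      · simp [h1]
    have hτpoly : ∀ P : Polynomial (PowerSeries K), τ P = P.eval₂ (ramify n hn) η := by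
      intro P
      have : τ.comp (Polynomial.coeToPowerSeries.ringHom) =
          Polynomial.eval₂RingHom (ramify n hn) η := by
        apply Polynomial.ringHom_ext
        · intro a
          simpa using RingHom.congr_fun hτC a
        · have : τ PowerSeries.X = η := by rw [← unfold_X_one, hτ, hθ, arcOf_X]; rfl
          simpa using this
      exact RingHom.congr_fun this P
    have hvanish : ∀ P : Polynomial (PowerSeries K), Polynomial.aeval (π PowerSeries.X) P = 0 →
        τ P = 0 := by
      intro P hP
      obtain ⟨Q, rfl⟩ := minpoly.isIntegrallyClosed_dvd hint hP
      rw [hτpoly, Polynomial.eval₂_mul, ← hμ, hroot, zero_mul]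
    refine ⟨θ, hnc, ?_, n, hn, fun q => ⟨unfold.symm (PowerSeries.C q), RingHom.congr_fun hτC q⟩⟩
    refine (Arc.eq_ker hnc hbot fun g hg => ?_).symm
    have hF0 : τ (unfold F) = 0 := by
      rw [hW.eq_mul, map_mul, hvanish W hWroot, zero_mul]
    obtain ⟨q, r, hqr⟩ := PowerSeries.exists_isWeierstrassDivision (unfold g) hres
    rw [RingHom.mem_ker]
    change θ g = 0
    rw [← hτ, hqr.eq_mul_add, map_add, map_mul, hF0, zero_mul, zero_add]
    refine hvanish r ?_
    have h1 : π (unfold g) = 0 := by rw [hπ, Ideal.Quotient.eq_zero_iff_mem]; exact hg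
    have h2 : π (unfold F) = 0 := by rw [hπ, Ideal.Quotient.eq_zero_iff_mem]; exact hFp
    rw [hqr.eq_mul_add, map_add, map_mul, h2, zero_mul, zero_add] at h1
    rw [haev, h1]

/-! ### Reduced curves -/

/-- In characteristic zero a proper ideal stable under both partial derivatives vanishes. -/
theorem eq_bot_of_pderiv_mem [CharZero K] {p : Ideal (Plane K)} (hp : p ≠ ⊤)
    (h : ∀ k, ∀ f ∈ p, pderiv K k f ∈ p) : p = ⊥ := by
  have key : ∀ (n : ℕ) (d : Fin 2 →₀ ℕ), d.degree = n → ∀ f ∈ p, coeff d f = 0 := by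
    intro n
    induction n with
    | zero =>
      intro d hd f hf
      rw [Finsupp.degree_eq_zero_iff] at hd
      rw [hd, MvPowerSeries.coeff_zero_eq_constantCoeff_apply]
      exact mem_maxIdeal.mp (le_maxIdeal_of_ne_top hp hf)
    | succ n ih =>
      intro d hd f hf
      obtain ⟨k, hk⟩ : ∃ k, d k ≠ 0 := by
        by_contra! h0
        rw [show d = 0 from Finsupp.ext h0, map_zero] at hd
        omega
      obtain ⟨e, rfl⟩ : ∃ e, d = e + Finsupp.single k 1 :=
        ⟨d - Finsupp.single k 1, (tsub_add_cancel_of_le (by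
          rw [Finsupp.single_le_iff]; omega)).symm⟩
      have h1 := ih e (by rw [map_add, Finsupp.degree_single] at hd; omega) _ (h k f hf)
      rw [MvPowerSeries.coeff_pderiv] at h1
      exact (mul_eq_zero.mp h1).resolve_right (by exact_mod_cast Nat.succ_ne_zero (e k))
  rw [eq_bot_iff]
  intro f hf
  rw [Ideal.mem_bot]
  ext d
  rw [key _ d rfl f hf, map_zero]

/-- The maximal ideal has height two, hence is not minimal over a principal ideal. -/
theorem ne_maxIdeal_of_mem_minimalPrimes {f : Plane K} {p : Ideal (Plane K)}
    (hp : p ∈ (Ideal.span {f}).minimalPrimes) : p ≠ maxIdeal K := by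
  rintro rfl
  have h1 := Ideal.height_le_one_of_isPrincipal_of_mem_minimalPrimes _ _ hp
  have hspan : (Ideal.span {X 0} : Ideal (Plane K)).IsPrime :=
    (Ideal.span_singleton_prime (X_prime 0).ne_zero).mpr (X_prime 0)
  have hlt : (Ideal.span {X 0} : Ideal (Plane K)) < maxIdeal K := by
    refine lt_of_le_of_ne (le_maxIdeal_of_ne_top hspan.ne_top) fun he => ?_
    have h2 : (X 1 : Plane K) ∈ Ideal.span {X 0} := by rw [he, mem_maxIdeal]; simp
    have h3 := (MvPowerSeries.X_dvd_iff.mp (Ideal.mem_span_singleton.mp h2))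
      (Finsupp.single 1 1) (by simp)
    rw [MvPowerSeries.coeff_X, if_pos rfl] at h3
    exact one_ne_zero h3
  have h2 := Ideal.height_add_one_le_of_lt_of_isPrime hlt
  have h3 : (1 : ℕ∞) ≤ (Ideal.span {X 0} : Ideal (Plane K)).height := by
    rw [Order.one_le_iff_ne_zero]
    intro h
    have := Ideal.height_eq_zero_iff_eq_bot.mp h
    rw [Ideal.span_singleton_eq_bot] at this
    exact (X_prime 0).ne_zero this
  have : (1 : ℕ∞) + 1 ≤ 1 := (add_le_add_left h3 1).trans (h2.trans h1)
  norm_num at this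

theorem ne_bot_of_mem_minimalPrimes {f : Plane K} (hf : f ≠ 0) {p : Ideal (Plane K)}
    (hp : p ∈ (Ideal.span {f}).minimalPrimes) : p ≠ ⊥ := by
  rintro rfl
  exact hf ((Ideal.mem_bot).mp (hp.1.2 (Ideal.mem_span_singleton_self f)))

/-- Every curve through the closed point has a branch. -/
theorem exists_arc [IsAlgClosed K] [CharZero K] {f : Plane K} (hf : f ≠ 0)
    (hc : constantCoeff f = 0) : ∃ θ : Arc K, θ.Nonconst ∧ θ f = 0 := by
  have hle : Ideal.span {f} ≤ maxIdeal K :=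
    (Ideal.span_singleton_le_iff_mem _).mpr (mem_maxIdeal.mpr hc)
  obtain ⟨p, hp, -⟩ := Ideal.exists_minimalPrimes_le hle
  have hprime : p.IsPrime := hp.1.1
  obtain ⟨θ, hθ, hker, -⟩ := exists_arc_ker_eq (ne_bot_of_mem_minimalPrimes hf hp)
    (ne_maxIdeal_of_mem_minimalPrimes hp)
  have h1 : f ∈ RingHom.ker θ := by rw [hker]; exact hp.1.2 (Ideal.mem_span_singleton_self f)
  exact ⟨θ, hθ, h1⟩

/-- A minimal prime over a radical ideal `I` is `I : s` for some `s` outside it: take `s` in all the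
other minimal primes. -/
theorem exists_notMem_mul_mem {R : Type*} [CommRing R] [IsNoetherianRing R] {I p : Ideal R}
    (hI : I.IsRadical) (hp : p ∈ I.minimalPrimes) : ∃ s ∉ p, ∀ f ∈ p, s * f ∈ I := by
  classical
  have hfin := Ideal.finite_minimalPrimes_of_isNoetherianRing R I
  have hprime : p.IsPrime := hp.1.1
  have hnot : ¬ (hfin.toFinset.erase p).inf id ≤ p := by
    intro hle
    obtain ⟨q, hq, hqp⟩ := (Ideal.IsPrime.inf_le' hprime).mp hle
    rw [Finset.mem_erase, Set.Finite.mem_toFinset] at hq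
    exact hq.1 (le_antisymm hqp (hp.2 hq.2.1 hqp))
  obtain ⟨s, hs, hsp⟩ := SetLike.not_le_iff_exists.mp hnot
  refine ⟨s, hsp, fun f hf => ?_⟩
  rw [← hI.radical, ← Ideal.sInf_minimalPrimes, Ideal.mem_sInf]
  intro q hq
  by_cases hqp : q = p
  · exact hqp ▸ p.mul_mem_left s hf
  · have hle : (hfin.toFinset.erase p).inf id ≤ q :=
      Finset.inf_le (f := id) (Finset.mem_erase.mpr ⟨hqp, (Set.Finite.mem_toFinset hfin).mpr hq⟩)
    have : s ∈ q := hle hs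
    exact q.mul_mem_right f this

/-- The equation of a reduced curve has nonzero differential along every branch. -/
theorem arcReduced_of_isRadical [CharZero K] {f : Plane K} (hf : f ≠ 0)
    (hrad : (Ideal.span {f}).IsRadical) : ArcReduced f := by
  intro θ hθ hf0
  by_contra! hall
  set p := RingHom.ker θ with hp
  have hle : Ideal.span {f} ≤ p := (Ideal.span_singleton_le_iff_mem _).mpr hf0
  obtain ⟨q, hq, hqp⟩ := Ideal.exists_minimalPrimes_le hle
  have hqprime : q.IsPrime := hq.1.1
  have hqbot : q ≠ ⊥ := ne_bot_of_mem_minimalPrimes hf hq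
  have hqeq : q = p := Arc.eq_ker hθ hqbot hqp
  rw [hqeq] at hq hqbot
  obtain ⟨s, hs, hsf⟩ := exists_notMem_mul_mem hrad hq
  refine hqbot (eq_bot_of_pderiv_mem (RingHom.ker_ne_top θ) fun k g hg => ?_)
  obtain ⟨a, ha⟩ := Ideal.mem_span_singleton.mp (hsf g hg)
  have h1 := congrArg (fun u => θ (pderiv K k u)) ha
  simp only [Derivation.leibniz, smul_eq_mul, map_add, map_mul, hall k] at h1
  have hg0 : θ g = 0 := hg
  have hf0' : θ f = 0 := hf0
  rw [hg0, hf0', zero_mul, zero_mul, mul_zero, add_zero, add_zero] at h1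
  exact (mul_eq_zero.mp h1).resolve_left hs

/-! ### Functions on the normalization -/

/-- If the image of `θ` contains all power series in `X ^ n`, then the power series ring is integral
over it, being generated by `1, X, …, X ^ (n - 1)` over the power series in `X ^ n`. -/
theorem isIntegralElem_of_ramify {R : Type*} [CommRing R] (θ : R →+* PowerSeries K) {n : ℕ}
    (hn : n ≠ 0) (h : ∀ q, ramify n hn q ∈ θ.range) (q : PowerSeries K) : θ.IsIntegralElem q := by
  have hmem : ∀ q, θ.IsIntegralElem (ramify n hn q) := by
    intro q
    obtain ⟨r, hr⟩ := h q
    rw [← hr]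
    exact θ.isIntegralElem_map
  have hX : θ.IsIntegralElem (PowerSeries.X : PowerSeries K) := by
    obtain ⟨r, hr⟩ := h PowerSeries.X
    refine ⟨Polynomial.X ^ n - Polynomial.C r, Polynomial.monic_X_pow_sub_C r hn, ?_⟩
    simp [hr]
  have hpow : ∀ r : ℕ, θ.IsIntegralElem ((PowerSeries.X : PowerSeries K) ^ r) := by
    intro r
    induction r with
    | zero => rw [pow_zero]; exact θ.isIntegralElem_one
    | succ r ih => rw [pow_succ]; exact ih.mul θ hX
  have hq : q = ∑ r ∈ Finset.range n,
      PowerSeries.X ^ r * ramify n hn (PowerSeries.mk fun k => PowerSeries.coeff (n * k + r) q) := by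
    ext m
    rw [map_sum, Finset.sum_eq_single (m % n)]
    · rw [PowerSeries.coeff_X_pow_mul', if_pos (Nat.mod_le m n), ramify_apply,
        PowerSeries.coeff_expand, if_pos (Nat.dvd_sub_mod m), PowerSeries.coeff_mk]
      congr 2
      rw [Nat.mul_div_cancel' (Nat.dvd_sub_mod m), Nat.sub_add_cancel (Nat.mod_le m n)]
    · intro r hr hrm
      rw [PowerSeries.coeff_X_pow_mul']
      split_ifs with hle
      · rw [ramify_apply, PowerSeries.coeff_expand, if_neg]
        rintro ⟨k, hk⟩
        apply hrm
        rw [show m = r + n * k by omega, Nat.add_mul_mod_self_left,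
          Nat.mod_eq_of_lt (Finset.mem_range.mp hr)]
      · rfl
    · intro hm
      exact absurd (Finset.mem_range.mpr (Nat.mod_lt m (Nat.pos_of_ne_zero hn))) hm
  rw [hq]
  have hsum : ∀ s : Finset ℕ, θ.IsIntegralElem (∑ r ∈ s,
      PowerSeries.X ^ r *
        ramify n hn (PowerSeries.mk fun k => PowerSeries.coeff (n * k + r) q)) := by
    intro s
    classical
    induction s using Finset.induction_on with
    | empty => rw [Finset.sum_empty]; exact θ.isIntegralElem_zero
    | insert a s ha ih =>
      rw [Finset.sum_insert ha]
      exact ((hpow a).mul θ (hmem _)).add θ ih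
  exact hsum _

/-- A valuative criterion for the integrality of a fraction `h / f`, in terms of finitely many
branches. -/
theorem exists_integral_fraction {S A ι : Type*} [CommRing S] [CommRing A] [IsDomain A]
    [Fintype ι] (θ : ι → S →+* A) (hinj : ∀ g, (∀ j, θ j g = 0) → g = 0)
    (hint : ∀ j, (θ j).IsIntegral) {f h : S} (hf : ∀ j, θ j f ≠ 0) (hdvd : ∀ j, θ j f ∣ θ j h) :
    ∃ x : integralClosure S (FractionRing S),
      algebraMap S (integralClosure S (FractionRing S)) h =
        algebraMap S (integralClosure S (FractionRing S)) f * x := by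
  have hreg : f ∈ nonZeroDivisors S := by
    rw [mem_nonZeroDivisors_iff_right]
    intro g hg
    refine hinj g fun j => ?_
    have := congrArg (θ j) hg
    rw [map_mul, map_zero] at this
    exact (mul_eq_zero.mp this).resolve_right (hf j)
  choose q hq using hdvd
  choose P hPm hP using fun j => hint j (q j)
  have hunit : IsUnit (algebraMap S (FractionRing S) f) :=
    IsLocalization.map_units (FractionRing S) ⟨f, hreg⟩
  obtain ⟨u, hu⟩ := hunit
  set x : FractionRing S := (↑u⁻¹ : FractionRing S) * algebraMap S (FractionRing S) h with hx
  have hfx : algebraMap S (FractionRing S) f * x = algebraMap S (FractionRing S) h := by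
    rw [hx, ← hu, Units.mul_inv_cancel_left]
  let Q := ∏ j, P j
  have hroot : ((Q.scaleRoots f).eval h) = 0 := by
    refine hinj _ fun j => ?_
    have h1 : (Q.scaleRoots f).eval₂ (θ j) (θ j h) = 0 := by
      rw [hq j, Polynomial.scaleRoots_eval₂_mul, Polynomial.eval₂_finsetProd,
        Finset.prod_eq_zero (Finset.mem_univ j) (hP j), mul_zero]
    rw [← Polynomial.eval₂_at_apply, h1]
  have hxint : IsIntegral S x := by
    refine ⟨Q, Polynomial.monic_prod_of_monic _ _ fun j _ => hPm j, ?_⟩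
    have h1 : (Q.scaleRoots f).eval₂ (algebraMap S (FractionRing S))
        (algebraMap S (FractionRing S) h) = 0 := by
      rw [Polynomial.eval₂_at_apply, hroot, map_zero]
    rw [← hfx, Polynomial.scaleRoots_eval₂_mul, ← hu, ← Units.val_pow_eq_pow_val] at h1
    exact (Units.mul_right_eq_zero _).mp h1
  refine ⟨⟨x, hxint⟩, Subtype.ext ?_⟩
  exact hfx.symm

/-- Among the combinations `a + α b` of two power series that do not both vanish, all but one
divide both `a` and `b`. -/
theorem exists_generic_combination (a b : PowerSeries K) (h : a ≠ 0 ∨ b ≠ 0) :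
    ∃ s : Set K, s.Finite ∧ ∀ α ∉ s, a + PowerSeries.C α * b ≠ 0 ∧
      a + PowerSeries.C α * b ∣ a ∧ a + PowerSeries.C α * b ∣ b := by
  obtain ⟨m, a', b', ha, hb, h'⟩ : ∃ (m : ℕ) (a' b' : PowerSeries K),
      a = PowerSeries.X ^ m * a' ∧ b = PowerSeries.X ^ m * b' ∧
        (PowerSeries.constantCoeff a' ≠ 0 ∨ PowerSeries.constantCoeff b' ≠ 0) := by
    classical
    have hex : ∃ m : ℕ, PowerSeries.coeff m a ≠ 0 ∨ PowerSeries.coeff m b ≠ 0 := by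
      by_contra! hall
      rcases h with h | h
      · exact h (PowerSeries.ext fun m => (hall m).1)
      · exact h (PowerSeries.ext fun m => (hall m).2)
    obtain ⟨a', ha'⟩ : PowerSeries.X ^ Nat.find hex ∣ a := by
      rw [PowerSeries.X_pow_dvd_iff]
      exact fun k hk => (not_or.mp (Nat.find_min hex hk)).1 |> not_not.mp
    obtain ⟨b', hb'⟩ : PowerSeries.X ^ Nat.find hex ∣ b := by
      rw [PowerSeries.X_pow_dvd_iff]
      exact fun k hk => (not_or.mp (Nat.find_min hex hk)).2 |> not_not.mp
    refine ⟨_, a', b', ha', hb', ?_⟩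
    have h1 := Nat.find_spec hex
    have h2 : ∀ (n : ℕ) (g : PowerSeries K),
        PowerSeries.coeff n (PowerSeries.X ^ n * g) = PowerSeries.constantCoeff g := by
      intro n g
      rw [PowerSeries.coeff_X_pow_mul', if_pos le_rfl, Nat.sub_self,
        PowerSeries.coeff_zero_eq_constantCoeff_apply]
    refine h1.imp (fun h3 => ?_) (fun h3 => ?_)
    · have h4 := congrArg (PowerSeries.coeff (Nat.find hex)) ha'
      rw [h2] at h4
      rwa [← h4]
    · have h4 := congrArg (PowerSeries.coeff (Nat.find hex)) hb'
      rw [h2] at h4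
      rwa [← h4]
  refine ⟨{α | PowerSeries.constantCoeff a' + α * PowerSeries.constantCoeff b' = 0},
    Set.Subsingleton.finite ?_, fun α hα => ?_⟩
  · intro α hα β hβ
    simp only [Set.mem_ofPred_eq] at hα hβ
    have h1 : (α - β) * PowerSeries.constantCoeff b' = 0 := by linear_combination hα - hβ
    rcases mul_eq_zero.mp h1 with h2 | h2
    · exact sub_eq_zero.mp h2
    · rw [h2, mul_zero, add_zero] at hα
      exact (h'.elim (fun h => h hα) fun h => h h2).elim
  · have hunit : IsUnit (a' + PowerSeries.C α * b') := by
      rw [PowerSeries.isUnit_iff_constantCoeff, isUnit_iff_ne_zero]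
      simpa using hα
    have heq : a + PowerSeries.C α * b = PowerSeries.X ^ m * (a' + PowerSeries.C α * b') := by
      rw [ha, hb]; ring
    rw [heq]
    refine ⟨mul_ne_zero (pow_ne_zero _ PowerSeries.X_ne_zero) hunit.ne_zero, ?_, ?_⟩
    · rw [ha]; exact mul_dvd_mul_left _ hunit.dvd
    · rw [hb]; exact mul_dvd_mul_left _ hunit.dvd

/-- A function lies in the equiclassical ideal if its restriction to each branch lies in the ideal
generated there by the partial derivatives. -/
theorem mem_equiclassicalIdeal [IsAlgClosed K] [CharZero K] {R : Type*} [CommRing R] [Algebra K R]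
    (φ : R ≃ₐ[K] Plane K) {F h : R} (hF : F ≠ 0) (hrad : (Ideal.span {φ F}).IsRadical)
    (hh : ∀ θ : Arc K, θ.Nonconst → θ (φ F) = 0 →
      θ (φ h) ∈ Ideal.span (Set.range fun k => θ (pderiv K k (φ F)))) :
    h ∈ equiclassicalIdeal φ F := by
  have hF' : φ F ≠ 0 := by simpa using hF
  have hmem : ∀ g, g ∈ Ideal.span {F} ↔ φ g ∈ Ideal.span {φ F} := by
    intro g
    rw [Ideal.mem_span_singleton, Ideal.mem_span_singleton, map_dvd_iff φ]
  let ι := (Ideal.span {φ F}).minimalPrimes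
  have hfin : Finite ι := Ideal.finite_minimalPrimes_of_isNoetherianRing _ _
  have : Fintype ι := Fintype.ofFinite ι
  have harc : ∀ p : ι, ∃ θ : Arc K, θ.Nonconst ∧ RingHom.ker θ = p ∧
      ∃ (n : ℕ) (hn : n ≠ 0), ∀ q, ramify n hn q ∈ (θ : Plane K →+* PowerSeries K).range := by
    rintro ⟨p, hp⟩
    have hprime : p.IsPrime := hp.1.1
    apply exists_arc_ker_eq
    · exact ne_bot_of_mem_minimalPrimes hF' hp
    · exact ne_maxIdeal_of_mem_minimalPrimes hp
  choose θ hθ hker n hn hram using harc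
  have hθF : ∀ p, θ p (φ F) = 0 := by
    intro p
    have : φ F ∈ RingHom.ker (θ p) := by
      rw [hker]; exact p.2.1.2 (Ideal.mem_span_singleton_self _)
    exact this
  have hred := arcReduced_of_isRadical hF' hrad
  have hgen := fun p => exists_generic_combination (θ p (pderiv K 0 (φ F)))
    (θ p (pderiv K 1 (φ F))) (by
      obtain ⟨k, hk⟩ := hred (θ p) (hθ p) (hθF p)
      fin_cases k
      exacts [Or.inl hk, Or.inr hk])
  choose s hs hgood using hgen
  obtain ⟨α, hα⟩ := (Set.finite_iUnion hs).infinite_compl.nonempty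
  have hα' : ∀ p, α ∉ s p := fun p hp => hα (Set.mem_iUnion.mpr ⟨p, hp⟩)
  set f := partialDeriv φ 0 F + algebraMap K R α * partialDeriv φ 1 F with hf
  have hφf : ∀ p, θ p (φ f) =
      θ p (pderiv K 0 (φ F)) + PowerSeries.C α * θ p (pderiv K 1 (φ F)) := by
    intro p
    rw [hf, partialDeriv, partialDeriv, map_add, map_mul, AlgEquiv.apply_symm_apply,
      AlgEquiv.apply_symm_apply, AlgEquiv.commutes, map_add, map_mul, AlgHom.commutes]
    rfl
  let ψ : ι → (R ⧸ Ideal.span {F}) →+* PowerSeries K := fun p =>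
    Ideal.Quotient.lift (Ideal.span {F})
      ((θ p : Plane K →+* PowerSeries K).comp (φ : R →+* Plane K)) (by
        intro a ha
        obtain ⟨b, rfl⟩ := Ideal.mem_span_singleton.mp ha
        simp [hθF p])
  have hψ : ∀ p g, ψ p (Ideal.Quotient.mk _ g) = θ p (φ g) := fun p g => rfl
  obtain ⟨x, hx⟩ := exists_integral_fraction ψ (f := Ideal.Quotient.mk _ f)
    (h := Ideal.Quotient.mk _ h) (by
      intro g hg
      obtain ⟨g, rfl⟩ := Ideal.Quotient.mk_surjective g
      rw [Ideal.Quotient.eq_zero_iff_mem, hmem, ← hrad.radical, ← Ideal.sInf_minimalPrimes,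
        Ideal.mem_sInf]
      intro p hp
      have h1 := hg ⟨p, hp⟩
      rw [hψ] at h1
      have h2 : φ g ∈ RingHom.ker (θ ⟨p, hp⟩) := h1
      rwa [hker] at h2) (by
      intro p q
      refine isIntegralElem_of_ramify (ψ p) (hn p) (fun q => ?_) q
      obtain ⟨r, hr⟩ := hram p q
      refine ⟨Ideal.Quotient.mk _ (φ.symm r), ?_⟩
      rw [hψ, AlgEquiv.apply_symm_apply]
      exact hr) (by
      intro p
      rw [hψ, hφf]
      exact (hgood p α (hα' p)).1) (by
      intro p
      rw [hψ, hψ, hφf, ← Ideal.mem_span_singleton]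
      refine Ideal.span_le.mpr ?_ (hh (θ p) (hθ p) (hθF p))
      rintro _ ⟨k, rfl⟩
      refine Ideal.mem_span_singleton.mpr ?_
      fin_cases k
      exacts [(hgood p α (hα' p)).2.1, (hgood p α (hα' p)).2.2])
  change toNormalization F h ∈ (Ideal.span {partialDeriv φ 0 F, partialDeriv φ 1 F}).map
    (toNormalization F)
  have hx' : toNormalization F h = toNormalization F f * x := hx
  rw [hx']
  refine Ideal.mul_mem_right _ _ (Ideal.mem_map_of_mem _ ?_)
  exact Ideal.add_mem _ (Ideal.subset_span (by simp))
    (Ideal.mul_mem_left _ _ (Ideal.subset_span (by simp)))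

/-! ### Linear and quadratic parts -/

theorem constantCoeff_pderiv (k : Fin 2) (f : Plane K) :
    constantCoeff (pderiv K k f) = coeff (Finsupp.single k 1) f := by
  rw [← MvPowerSeries.coeff_zero_eq_constantCoeff_apply, MvPowerSeries.coeff_pderiv]
  simp

theorem exists_pderiv_ne_zero {f : Plane K} (hf : f.order = 1) :
    ∃ k, constantCoeff (pderiv K k f) ≠ 0 := by
  by_contra! h
  have hc : constantCoeff f = 0 := one_le_order_iff.mp hf.ge
  obtain ⟨g, hg⟩ := exists_eq_sum_of_constantCoeff_eq_zero hc
  have h1 : f ∈ maxIdeal K ^ 2 := by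
    rw [hg, pow_two]
    refine Ideal.sum_mem _ fun k _ => Ideal.mul_mem_mul (mem_maxIdeal.mpr (by simp))
      (mem_maxIdeal.mpr ?_)
    have h2 := h k
    rw [hg, map_sum, map_sum, Finset.sum_eq_single k] at h2
    · simpa using h2
    · intro j _ hj
      simp [MvPowerSeries.pderiv_X_of_ne hj]
    · simp
  rw [mem_maxIdeal_pow, hf] at h1
  norm_num at h1

theorem order_eq_one {f : Plane K} (hc : constantCoeff f = 0) {k : Fin 2}
    (hk : constantCoeff (pderiv K k f) ≠ 0) : f.order = 1 := by
  refine le_antisymm ?_ (one_le_order_iff.mpr hc)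
  rw [constantCoeff_pderiv] at hk
  have := MvPowerSeries.order_le hk
  simpa using this

theorem constantCoeff_pderiv_of_mem_sq {f : Plane K} (hf : f ∈ maxIdeal K ^ 2) (k : Fin 2) :
    constantCoeff (pderiv K k f) = 0 := by
  rw [constantCoeff_pderiv]
  refine MvPowerSeries.coeff_of_lt_order ?_
  refine lt_of_lt_of_le ?_ (mem_maxIdeal_pow.mp hf)
  simp

/-- Two functions with independent linear parts generate the maximal ideal. -/
theorem X_mem_span_of_det {f : Fin 2 → Plane K} (hf : ∀ j, constantCoeff (f j) = 0)
    (hdet : constantCoeff (pderiv K 0 (f 0)) * constantCoeff (pderiv K 1 (f 1))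
      - constantCoeff (pderiv K 1 (f 0)) * constantCoeff (pderiv K 0 (f 1)) ≠ 0) (k : Fin 2) :
    X k ∈ Ideal.span (Set.range f) := by
  choose g hg using fun j => exists_eq_sum_of_constantCoeff_eq_zero (hf j)
  have hd : ∀ j k, constantCoeff (pderiv K k (f j)) = constantCoeff (g j k) := by
    intro j k
    rw [hg j, map_sum, map_sum, Finset.sum_eq_single k]
    · simp
    · intro l _ hl
      simp [MvPowerSeries.pderiv_X_of_ne hl]
    · simp
  have hu : IsUnit (g 0 0 * g 1 1 - g 0 1 * g 1 0) := by
    rw [isUnit_iff]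
    simpa [← hd] using hdet
  rw [← (Ideal.span (Set.range f)).unit_mul_mem_iff_mem hu]
  have h0 : f 0 ∈ Ideal.span (Set.range f) := Ideal.subset_span ⟨0, rfl⟩
  have h1 : f 1 ∈ Ideal.span (Set.range f) := Ideal.subset_span ⟨1, rfl⟩
  have e0 : f 0 = X 0 * g 0 0 + X 1 * g 0 1 := by rw [hg 0, Fin.sum_univ_two]
  have e1 : f 1 = X 0 * g 1 0 + X 1 * g 1 1 := by rw [hg 1, Fin.sum_univ_two]
  fin_cases k
  · have : (g 0 0 * g 1 1 - g 0 1 * g 1 0) * X 0 = g 1 1 * f 0 - g 0 1 * f 1 := by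
      rw [e0, e1]; ring
    change (g 0 0 * g 1 1 - g 0 1 * g 1 0) * X 0 ∈ _
    rw [this]
    exact Ideal.sub_mem _ (Ideal.mul_mem_left _ _ h0) (Ideal.mul_mem_left _ _ h1)
  · have : (g 0 0 * g 1 1 - g 0 1 * g 1 0) * X 1 = g 0 0 * f 1 - g 1 0 * f 0 := by
      rw [e0, e1]; ring
    change (g 0 0 * g 1 1 - g 0 1 * g 1 0) * X 1 ∈ _
    rw [this]
    exact Ideal.sub_mem _ (Ideal.mul_mem_left _ _ h1) (Ideal.mul_mem_left _ _ h0)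

/-- The discriminant of a node in terms of second derivatives. -/
theorem hessian_ne_zero_of_isNode {f : Plane K} (hf : IsNode f) :
    constantCoeff (pderiv K 1 (pderiv K 0 f)) ^ 2
      - constantCoeff (pderiv K 0 (pderiv K 0 f)) * constantCoeff (pderiv K 1 (pderiv K 1 f)) ≠ 0 := by
  have h := hf.2
  have e0 : ∀ k, constantCoeff (pderiv K k (pderiv K k f)) = 2 * coeff (Finsupp.single k 2) f := by
    intro k
    rw [constantCoeff_pderiv, MvPowerSeries.coeff_pderiv, ← Finsupp.single_add]
    simp
    ring
  have e1 : constantCoeff (pderiv K 1 (pderiv K 0 f)) =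
      coeff (Finsupp.single 0 1 + Finsupp.single 1 1) f := by
    rw [constantCoeff_pderiv, MvPowerSeries.coeff_pderiv, add_comm]
    simp
  rw [e0, e0, e1]
  intro h0
  exact h (by linear_combination h0)

theorem constantCoeff_pderiv_pderiv_mul {f g : Plane K} (hf : constantCoeff f = 0)
    (hg : constantCoeff g = 0) (j k : Fin 2) :
    constantCoeff (pderiv K j (pderiv K k (f * g))) =
      constantCoeff (pderiv K j f) * constantCoeff (pderiv K k g)
        + constantCoeff (pderiv K k f) * constantCoeff (pderiv K j g) := by
  simp [Derivation.leibniz, hf, hg]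
  ring

/-! ### First-order deformations of arcs -/

section Tangent

variable {A : Type*} [CommRing A] [Algebra K A]

/-- The coefficient of `ε` in the restriction of `𝓗` along the arc `θ + ε ξ` over `K[ε]`. -/
def tangent (θ : Plane K →ₐ[K] A) (ξ : Fin 2 → A) (𝓗 : PlaneEps K) : A :=
  θ (epsPart 𝓗) + ∑ k, ξ k * θ (pderiv K k (closedFibre 𝓗))

theorem tangent_add (θ : Plane K →ₐ[K] A) (ξ : Fin 2 → A) (𝓐 𝓑 : PlaneEps K) :
    tangent θ ξ (𝓐 + 𝓑) = tangent θ ξ 𝓐 + tangent θ ξ 𝓑 := by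
  simp only [tangent, epsPart_add, closedFibre_add, map_add, mul_add, Finset.sum_add_distrib]
  ring

theorem tangent_mul (θ : Plane K →ₐ[K] A) (ξ : Fin 2 → A) (𝓐 𝓑 : PlaneEps K) :
    tangent θ ξ (𝓐 * 𝓑) =
      θ (closedFibre 𝓐) * tangent θ ξ 𝓑 + θ (closedFibre 𝓑) * tangent θ ξ 𝓐 := by
  simp only [tangent, epsPart_mul, closedFibre_mul, map_add, map_mul, Derivation.leibniz,
    smul_eq_mul, Fin.sum_univ_two]
  ring

theorem tangent_X (θ : Plane K →ₐ[K] A) (ξ : Fin 2 → A) (i : Fin 2) :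
    tangent θ ξ (X i) = ξ i := by
  rw [tangent, epsPart_X, closedFibre_X, map_zero, zero_add, Finset.sum_eq_single i]
  · simp
  · intro k _ hk
    simp [MvPowerSeries.pderiv_X_of_ne hk.symm]
  · simp

theorem tangent_X_pow_succ (θ : Plane K →ₐ[K] A) (ξ : Fin 2 → A) (i : Fin 2) (n : ℕ) :
    tangent θ ξ (X i ^ (n + 1)) = (n + 1) * θ (X i) ^ n * ξ i := by
  induction n with
  | zero => simp [tangent_X]
  | succ n ih =>
    rw [pow_succ, tangent_mul, ih, tangent_X, closedFibre_pow, closedFibre_X, map_pow]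
    push_cast
    ring

theorem tangent_sectionEq (v : Fin 2 → K) (k : Fin 2) :
    tangent (AlgHom.id K (Plane K)) (fun k => C (v k)) (sectionEq v k) = 0 := by
  have hX := tangent_X (AlgHom.id K (Plane K)) (fun k => C (v k)) k
  rw [tangent, epsPart_X, closedFibre_X, map_zero, zero_add] at hX
  rw [tangent, closedFibre_sectionEq, epsPart_sectionEq, hX, map_neg]
  simp

/-- The derivative of a curve along the constant lift `X k + ε v k` of the coordinates vanishes at the
closed point if the curve contains the section `v`. -/
theorem tangent_mem_of_mem_sectionIdeal (v : Fin 2 → K) {𝓕 : PlaneEps K}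
    (h : 𝓕 ∈ sectionIdeal (v 0) (v 1)) :
    closedFibre 𝓕 ∈ maxIdeal K ∧
      tangent (AlgHom.id K (Plane K)) (fun k => C (v k)) 𝓕 ∈ maxIdeal K := by
  rw [sectionIdeal_eq] at h
  induction h using Submodule.span_induction with
  | mem x hx =>
    obtain ⟨k, rfl⟩ := hx
    rw [tangent_sectionEq, closedFibre_sectionEq]
    exact ⟨mem_maxIdeal.mpr (by simp), Ideal.zero_mem _⟩
  | zero =>
    have h0 : closedFibre (0 : PlaneEps K) = 0 := map_zero _
    have h1 := tangent_add (AlgHom.id K (Plane K)) (fun k => C (v k)) 0 0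
    rw [add_zero, left_eq_add] at h1
    rw [h0, h1]
    exact ⟨Ideal.zero_mem _, Ideal.zero_mem _⟩
  | add x y _ _ hx hy =>
    rw [tangent_add, closedFibre_add]
    exact ⟨Ideal.add_mem _ hx.1 hy.1, Ideal.add_mem _ hx.2 hy.2⟩
  | smul a x _ hx =>
    rw [smul_eq_mul, tangent_mul, closedFibre_mul]
    exact ⟨Ideal.mul_mem_left _ _ hx.1,
      Ideal.add_mem _ (Ideal.mul_mem_left _ _ hx.2) (Ideal.mul_mem_right _ _ hx.1)⟩

/-- If the curve has multiplicity two along the section, the derivative along the constant lift is of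
second order. -/
theorem tangent_mem_of_mem_sectionIdeal_sq (v : Fin 2 → K) {𝓕 : PlaneEps K}
    (h : 𝓕 ∈ sectionIdeal (v 0) (v 1) ^ 2) :
    tangent (AlgHom.id K (Plane K)) (fun k => C (v k)) 𝓕 ∈ maxIdeal K ^ 2 := by
  rw [pow_two] at h ⊢
  induction h using Submodule.mul_induction_on' with
  | mem_mul_mem x hx y hy =>
    have h1 := tangent_mem_of_mem_sectionIdeal v hx
    have h2 := tangent_mem_of_mem_sectionIdeal v hy
    rw [tangent_mul]
    exact Ideal.add_mem _ (Ideal.mul_mem_mul h1.1 h2.2) (Ideal.mul_mem_mul h2.1 h1.2)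
  | add x _ y _ hx hy =>
    rw [tangent_add]
    exact Ideal.add_mem _ hx hy

/-- The coefficient of `ε` along an arc in terms of the arc on a blow-up lifting it. -/
theorem tangent_comp_blow (i : Fin 2) (v : Fin 2 → K) (c : K) (θ : Plane K →ₐ[K] A)
    (ξ ξ' : Fin 2 → A) (hi : ξ i = ξ' i + algebraMap K A (v i))
    (hr : ξ i.rev = ξ' i * (θ (X i.rev) + algebraMap K A c) + θ (X i) * ξ' i.rev
      + algebraMap K A (v i.rev)) (𝓗 : PlaneEps K) :
    tangent (θ.comp (blow i c)) ξ 𝓗 = tangent θ ξ' (chartHom i v c 𝓗) := by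
  have hC : ∀ a : K, θ (C a) = algebraMap K A a := fun a => θ.commutes a
  simp only [tangent, closedFibre_chartHom, epsPart_chartHom]
  rw [sum_eq_add_rev i, sum_eq_add_rev i, sum_eq_add_rev i, pderiv_blow, pderiv_rev_blow, hi, hr]
  simp only [map_add, map_mul, AlgHom.comp_apply, hC]
  ring

end Tangent

/-! ### Equisingular deformations along branches -/

/-- `θ + ε ξ` is a deformation over `K[ε]`, along the section `⟨x - v₀ ε, y - v₁ ε⟩`, of the
branch `θ` of the closed fibre, contained in the curve `𝓖 = 0`. If `𝓖` is the union of a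
deformation `𝓩` of a smooth curve and of `𝓗`, then its intersection number with the component that
does not contain the branch is constant, in the sense that the ideal of the intersection does not
change. -/
structure BranchLift (𝓖 : PlaneEps K) (v : Fin 2 → K) (θ : Arc K) (ξ : Fin 2 → PowerSeries K) :
    Prop where
  tangent_eq : tangent θ ξ 𝓖 = 0
  sub_mem : ∀ k, ξ k - PowerSeries.C (v k) ∈ Ideal.span (Set.range fun k => θ (X k))
  dvd : ∀ 𝓩 𝓗, 𝓖 = 𝓩 * 𝓗 → (closedFibre 𝓩).order = 1 →
    (θ (closedFibre 𝓩) ≠ 0 → θ (closedFibre 𝓩) ∣ tangent θ ξ 𝓩) ∧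
      (θ (closedFibre 𝓩) = 0 → θ (closedFibre 𝓗) ∣ tangent θ ξ 𝓗)

theorem arc_mem_span (θ : Arc K) {f : Plane K} (hf : constantCoeff f = 0) :
    θ f ∈ Ideal.span (Set.range fun k => θ (X k)) := by
  obtain ⟨g, rfl⟩ := exists_eq_sum_of_constantCoeff_eq_zero hf
  rw [map_sum]
  refine Ideal.sum_mem _ fun k _ => ?_
  rw [map_mul]
  exact Ideal.mul_mem_right _ _ (Ideal.subset_span ⟨k, rfl⟩)

theorem constantCoeff_eq_zero_of_mem_span (θ : Arc K) {f : PowerSeries K}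
    (hf : f ∈ Ideal.span (Set.range fun k => θ (X k))) : PowerSeries.constantCoeff f = 0 := by
  have hle : Ideal.span (Set.range fun k => θ (X k)) ≤
      RingHom.ker (PowerSeries.constantCoeff (R := K)) := by
    rw [Ideal.span_le]
    rintro _ ⟨k, rfl⟩
    exact PowerSeries.X_dvd_iff.mp (X_dvd_arc_X θ k)
  exact hle hf

theorem constantCoeff_tangent (θ : Arc K) (ξ : Fin 2 → PowerSeries K) (v : Fin 2 → K)
    (h : ∀ k, ξ k - PowerSeries.C (v k) ∈ Ideal.span (Set.range fun k => θ (X k)))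
    (𝓗 : PlaneEps K) :
    PowerSeries.constantCoeff (tangent θ ξ 𝓗) =
      constantCoeff (tangent (AlgHom.id K (Plane K)) (fun k => C (v k)) 𝓗) := by
  have hξ : ∀ k, PowerSeries.constantCoeff (ξ k) = v k := by
    intro k
    have := constantCoeff_eq_zero_of_mem_span θ (h k)
    rw [map_sub, sub_eq_zero] at this
    rw [this, PowerSeries.constantCoeff_C]
  simp [tangent, hξ, constantCoeff_arc]

theorem tangent_sub_mem (θ : Arc K) (ξ : Fin 2 → PowerSeries K) (v : Fin 2 → K)
    (h : ∀ k, ξ k - PowerSeries.C (v k) ∈ Ideal.span (Set.range fun k => θ (X k)))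
    (𝓗 : PlaneEps K) :
    tangent θ ξ 𝓗 - θ (tangent (AlgHom.id K (Plane K)) (fun k => C (v k)) 𝓗) ∈
      Ideal.span (Set.range fun k => θ (X k)) := by
  have : tangent θ ξ 𝓗 - θ (tangent (AlgHom.id K (Plane K)) (fun k => C (v k)) 𝓗) =
      ∑ k, (ξ k - PowerSeries.C (v k)) * θ (pderiv K k (closedFibre 𝓗)) := by
    simp only [tangent, AlgHom.id_apply, map_add, map_mul, arc_C, Fin.sum_univ_two]
    ring
  rw [this]
  exact Ideal.sum_mem _ fun k _ => Ideal.mul_mem_right _ _ (h k)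

/-- On a smooth curve one partial derivative is a unit along the branch, so that the equation for the
lift can be solved in that coordinate. A smooth curve has no second component to intersect. -/
theorem exists_branchLift_smooth {𝓖 : PlaneEps K} {v : Fin 2 → K}
    (hs : IsSmoothCurve (closedFibre 𝓖)) (hmem : 𝓖 ∈ sectionIdeal (v 0) (v 1)) {θ : Arc K}
    (h0 : θ (closedFibre 𝓖) = 0) : ∃ ξ, BranchLift 𝓖 v θ ξ := by
  obtain ⟨i, hi⟩ := exists_pderiv_ne_zero hs
  have hunit : IsUnit (θ (pderiv K i (closedFibre 𝓖))) := (isUnit_iff.mpr hi).map θ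
  obtain ⟨u, hu⟩ := hunit.exists_right_inv
  set e := tangent (AlgHom.id K (Plane K)) (fun k => C (v k)) 𝓖 with he
  have hec := mem_maxIdeal.mp (tangent_mem_of_mem_sectionIdeal v hmem).2
  set r : Fin 2 → PowerSeries K := fun k => if k = i then - (θ e * u) else 0 with hr
  refine ⟨fun k => PowerSeries.C (v k) + r k, ?_, fun k => ?_,
    fun 𝓩 𝓗 hG hz => ⟨fun hne => ?_, fun _ => ?_⟩⟩
  · have h1 : tangent θ (fun k => PowerSeries.C (v k) + r k) 𝓖 =
        θ e + ∑ k, r k * θ (pderiv K k (closedFibre 𝓖)) := by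
      simp only [he, tangent, AlgHom.id_apply, map_add, map_mul, arc_C, Fin.sum_univ_two]
      ring
    rw [h1, Finset.sum_eq_single i]
    · rw [hr]
      simp only [if_true]
      linear_combination (- θ e) * hu
    · intro k _ hk; simp [hr, hk]
    · simp
  · rw [add_sub_cancel_left, hr]
    dsimp only
    split_ifs
    · exact neg_mem (Ideal.mul_mem_right _ _ (arc_mem_span θ hec))
    · exact Ideal.zero_mem _
  all_goals
    have ho : (closedFibre 𝓖).order = 1 := hs
    have hh : constantCoeff (closedFibre 𝓗) ≠ 0 := by
      rw [← order_eq_zero_iff]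
      rw [hG, closedFibre_mul, MvPowerSeries.order_mul, hz] at ho
      revert ho
      cases h : (closedFibre 𝓗).order with
      | top => simp
      | coe n =>
        intro h2
        have h3 : 1 + n = 1 := by exact_mod_cast h2
        have : n = 0 := by omega
        rw [this]; rfl
    have hhu : IsUnit (θ (closedFibre 𝓗)) := (isUnit_iff.mpr hh).map θ
  · rw [hG, closedFibre_mul, map_mul, hhu.mul_left_eq_zero] at h0
    exact absurd h0 hne
  · exact hhu.dvd

/-- At a node the partial derivatives generate the maximal ideal, so that the equation for the lift,
whose right-hand side is of second order, can be solved by a correction in the maximal ideal. -/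
theorem exists_branchLift_node {𝓖 : PlaneEps K} {v : Fin 2 → K}
    (hn : IsNode (closedFibre 𝓖)) (hmem : 𝓖 ∈ sectionIdeal (v 0) (v 1) ^ 2) {θ : Arc K}
    (h0 : θ (closedFibre 𝓖) = 0) : ∃ ξ, BranchLift 𝓖 v θ ξ := by
  set G := closedFibre 𝓖 with hG
  set e := tangent (AlgHom.id K (Plane K)) (fun k => C (v k)) 𝓖 with he
  have hess := hessian_ne_zero_of_isNode hn
  have he2 : e ∈ maxIdeal K ^ 2 := tangent_mem_of_mem_sectionIdeal_sq v hmem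
  have hG2 : G ∈ maxIdeal K ^ 2 := mem_maxIdeal_pow.mpr hn.1.ge
  have hcomm : constantCoeff (pderiv K 0 (pderiv K 1 G)) =
      constantCoeff (pderiv K 1 (pderiv K 0 G)) := by
    rw [constantCoeff_pderiv, constantCoeff_pderiv, MvPowerSeries.coeff_pderiv,
      MvPowerSeries.coeff_pderiv, add_comm]
    simp
  -- The partial derivatives of a node generate the maximal ideal.
  have hX : ∀ k, X k ∈ Ideal.span (Set.range fun j => pderiv K j G) := by
    refine X_mem_span_of_det (fun j => constantCoeff_pderiv_of_mem_sq hG2 j) fun h => hess ?_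
    rw [hcomm] at h
    linear_combination - h
  have hle : maxIdeal K ≤ Ideal.span (Set.range fun j => pderiv K j G) := by
    rw [maxIdeal_eq_span, Ideal.span_le]
    rintro _ ⟨k, rfl⟩
    exact hX k
  obtain ⟨a, ha, hea⟩ : ∃ a : Fin 2 → Plane K, (∀ k, constantCoeff (a k) = 0) ∧
      e = ∑ k, a k * pderiv K k G := by
    rw [pow_two] at he2
    clear_value e
    clear he
    induction he2 using Submodule.mul_induction_on' with
    | mem_mul_mem x hx y hy =>
      obtain ⟨b, hb⟩ := Ideal.mem_span_range_iff_exists_fun.mp (hle hy)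
      refine ⟨fun k => x * b k, fun k => by simp [mem_maxIdeal.mp hx], ?_⟩
      rw [← hb, Finset.mul_sum]
      exact Finset.sum_congr rfl fun k _ => by ring
    | add x _ y _ hx hy =>
      obtain ⟨a, ha, hxa⟩ := hx
      obtain ⟨b, hb, hyb⟩ := hy
      refine ⟨fun k => a k + b k, fun k => by simp [ha, hb], ?_⟩
      rw [hxa, hyb, ← Finset.sum_add_distrib]
      exact Finset.sum_congr rfl fun k _ => by ring
  have hsub : ∀ k, (PowerSeries.C (v k) - θ (a k)) - PowerSeries.C (v k) ∈
      Ideal.span (Set.range fun k => θ (X k)) := by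
    intro k
    rw [sub_sub_cancel_left]
    exact neg_mem (arc_mem_span θ (ha k))
  refine ⟨fun k => PowerSeries.C (v k) - θ (a k), ?_, hsub, fun 𝓩 𝓗 hZH hz => ?_⟩
  · have h1 : tangent θ (fun k => PowerSeries.C (v k) - θ (a k)) 𝓖 =
        θ e - ∑ k, θ (a k) * θ (pderiv K k G) := by
      simp only [he, tangent, AlgHom.id_apply, map_add, map_mul, arc_C, Fin.sum_univ_two]
      ring
    rw [h1, hea, map_sum]
    simp
  · set z := closedFibre 𝓩
    set h := closedFibre 𝓗
    have hzh : G = z * h := by rw [hG, hZH, closedFibre_mul]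
    have hzc : constantCoeff z = 0 := one_le_order_iff.mp hz.ge
    have hhc : constantCoeff h = 0 := by
      rw [← one_le_order_iff]
      have ho := hn.1
      rw [hzh, MvPowerSeries.order_mul, hz] at ho
      revert ho
      cases h.order with
      | top => simp
      | coe n =>
        intro h2
        have h3 : 1 + n = 2 := by exact_mod_cast h2
        have : n = 1 := by omega
        rw [this]; rfl
    have hdet : constantCoeff (pderiv K 0 z) * constantCoeff (pderiv K 1 h)
        - constantCoeff (pderiv K 1 z) * constantCoeff (pderiv K 0 h) ≠ 0 := by
      intro h1
      apply hess
      rw [hzh, constantCoeff_pderiv_pderiv_mul hzc hhc, constantCoeff_pderiv_pderiv_mul hzc hhc,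
        constantCoeff_pderiv_pderiv_mul hzc hhc]
      linear_combination (constantCoeff (pderiv K 0 z) * constantCoeff (pderiv K 1 h)
        - constantCoeff (pderiv K 1 z) * constantCoeff (pderiv K 0 h)) * h1
    -- Both branches of the node contain the section.
    set ζ := tangent (AlgHom.id K (Plane K)) (fun k => C (v k)) 𝓩 with hζ
    set η := tangent (AlgHom.id K (Plane K)) (fun k => C (v k)) 𝓗 with hη
    have heq : e = z * η + h * ζ := by
      rw [he, hZH, tangent_mul]; rfl
    have hlin : ∀ k, constantCoeff (pderiv K k z) * constantCoeff η
        + constantCoeff (pderiv K k h) * constantCoeff ζ = 0 := by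
      intro k
      have h1 := constantCoeff_pderiv_of_mem_sq he2 k
      rw [heq] at h1
      simp only [map_add, Derivation.leibniz, smul_eq_mul, map_mul, hzc, hhc, zero_mul,
        zero_add] at h1
      linear_combination h1
    have hη0 : constantCoeff η = 0 := by
      have : (constantCoeff (pderiv K 0 z) * constantCoeff (pderiv K 1 h)
        - constantCoeff (pderiv K 1 z) * constantCoeff (pderiv K 0 h)) * constantCoeff η = 0 := by
        linear_combination constantCoeff (pderiv K 1 h) * hlin 0
          - constantCoeff (pderiv K 0 h) * hlin 1
      exact (mul_eq_zero.mp this).resolve_left hdet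
    have hζ0 : constantCoeff ζ = 0 := by
      have : (constantCoeff (pderiv K 0 z) * constantCoeff (pderiv K 1 h)
        - constantCoeff (pderiv K 1 z) * constantCoeff (pderiv K 0 h)) * constantCoeff ζ = 0 := by
        linear_combination constantCoeff (pderiv K 0 z) * hlin 1
          - constantCoeff (pderiv K 1 z) * hlin 0
      exact (mul_eq_zero.mp this).resolve_left hdet
    have hspan : ∀ k, X k ∈ Ideal.span (Set.range ![z, h]) :=
      X_mem_span_of_det (f := ![z, h]) (by
        intro j; fin_cases j <;> simp [hzc, hhc]) hdet
    have htop : Ideal.span (Set.range fun k => θ (X k)) ≤ Ideal.span {θ z, θ h} := by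
      rw [Ideal.span_le]
      rintro _ ⟨k, rfl⟩
      have h1 := Ideal.mem_map_of_mem θ (hspan k)
      rw [Ideal.map_span, ← Set.range_comp] at h1
      refine Ideal.span_mono ?_ h1
      rintro _ ⟨j, rfl⟩
      fin_cases j <;> simp
    have hmemT : ∀ 𝓣 : PlaneEps K,
        constantCoeff (tangent (AlgHom.id K (Plane K)) (fun k => C (v k)) 𝓣) = 0 →
        tangent θ (fun k => PowerSeries.C (v k) - θ (a k)) 𝓣 ∈ Ideal.span {θ z, θ h} := by
      intro 𝓣 h𝓣
      have h1 := tangent_sub_mem θ _ v hsub 𝓣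
      have h2 := Ideal.add_mem _ h1 (arc_mem_span θ h𝓣)
      rw [sub_add_cancel] at h2
      exact htop h2
    refine ⟨fun hne => ?_, fun hz0 => ?_⟩
    · have hh0 : θ h = 0 := by
        rw [hzh, map_mul] at h0
        exact (mul_eq_zero.mp h0).resolve_left hne
      have h1 := hmemT 𝓩 hζ0
      rw [hh0, Set.pair_comm, Ideal.span_insert_zero] at h1
      exact Ideal.mem_span_singleton.mp h1
    · have h1 := hmemT 𝓗 hη0
      rw [hz0, Ideal.span_insert_zero] at h1
      exact Ideal.mem_span_singleton.mp h1

/-- The inductive step: branches of a curve of multiplicity at least two are deformed together with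
their strict transforms. -/
theorem exists_branchLift_blowup [IsAlgClosed K] [CharZero K] {𝓖 : PlaneEps K} {v : Fin 2 → K}
    {m : ℕ} (hm : (closedFibre 𝓖).order = m) (h2 : 2 ≤ m) (hred : ArcReduced (closedFibre 𝓖))
    (H : ∀ (i : Fin 2) (c : K), i = 0 ∨ c = 0 → ∃ (𝓖₁ : PlaneEps K) (w : Fin 2 → K), w i = 0 ∧
      chartHom i v c 𝓖 = X i ^ m * 𝓖₁ ∧
      (ArcReduced (closedFibre (X i * 𝓖₁)) → ∀ θ : Arc K, θ.Nonconst →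
        θ (closedFibre (X i * 𝓖₁)) = 0 → ∃ ξ, BranchLift (X i * 𝓖₁) w θ ξ))
    {θ : Arc K} (hθ : θ.Nonconst) (h0 : θ (closedFibre 𝓖) = 0) : ∃ ξ, BranchLift 𝓖 v θ ξ := by
  obtain ⟨M, rfl⟩ : ∃ M, m = M + 1 + 1 := ⟨m - 2, by omega⟩
  have lift : ∀ θ : Arc K, θ.Nonconst → θ (closedFibre 𝓖) = 0 →
      ∃ (i : Fin 2) (c : K) (θ₁ : Arc K) (𝓖₁ : PlaneEps K) (w : Fin 2 → K)
        (ξ₁ ξ : Fin 2 → PowerSeries K), θ₁ (X i) ≠ 0 ∧ chartHom i v c 𝓖 = X i ^ (M + 1 + 1) * 𝓖₁ ∧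
        BranchLift (X i * 𝓖₁) w θ₁ ξ₁ ∧ θ₁ (X i) ∣ ξ₁ i ∧
        (∀ 𝓗, θ (closedFibre 𝓗) = θ₁ (closedFibre (chartHom i v c 𝓗))) ∧
        (∀ 𝓗, tangent θ ξ 𝓗 = tangent θ₁ ξ₁ (chartHom i v c 𝓗)) ∧
        tangent θ ξ 𝓖 = 0 ∧
        ∀ k, ξ k - PowerSeries.C (v k) ∈ Ideal.span (Set.range fun k => θ (X k)) := by
    intro θ hθ h0
    obtain ⟨i, c, θ₁, hic, rfl, hx⟩ := Arc.exists_lift hθ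
    obtain ⟨𝓖₁, w, hw, hG₁, hind⟩ := H i c hic
    obtain ⟨g, hg, ⟨j, -, hj⟩, -⟩ := exists_strictTransform i c hm
    have hgG : closedFibre 𝓖₁ = g := by
      have h1 := congrArg closedFibre hG₁
      rw [closedFibre_chartHom, hg, closedFibre_mul, closedFibre_pow, closedFibre_X] at h1
      exact (mul_left_cancel₀ (pow_ne_zero _ (X_prime i).ne_zero) h1).symm
    have hX : ¬ X i ∣ g := not_X_dvd_of_coeff hj
    have hred₁ : ArcReduced (closedFibre (X i * 𝓖₁)) := by
      rw [closedFibre_mul, closedFibre_X, hgG]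
      exact hred.blow hg hX
    have hg0 : θ₁ g = 0 := by
      rw [AlgHom.comp_apply, hg, map_mul, map_pow] at h0
      exact (mul_eq_zero.mp h0).resolve_left (pow_ne_zero _ hx)
    obtain ⟨ξ₁, hξ₁⟩ := hind hred₁ θ₁ ⟨i, hx⟩ (by
      rw [closedFibre_mul, map_mul, hgG, hg0, mul_zero])
    have hdvd : θ₁ (X i) ∣ ξ₁ i := by
      have h1 := (hξ₁.dvd (X i) 𝓖₁ rfl (by rw [closedFibre_X, order_X])).1
      rw [closedFibre_X, tangent_X] at h1
      exact h1 hx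
    have ht : tangent θ₁ ξ₁ 𝓖₁ = 0 := by
      have h1 := hξ₁.tangent_eq
      rw [tangent_mul, closedFibre_X, hgG, hg0, zero_mul, add_zero] at h1
      exact (mul_eq_zero.mp h1).resolve_left hx
    let ξ : Fin 2 → PowerSeries K := fun k =>
      (if k = i then ξ₁ i else
        ξ₁ i * (θ₁ (X i.rev) + PowerSeries.C c) + θ₁ (X i) * ξ₁ i.rev) + PowerSeries.C (v k)
    have hchain : ∀ 𝓗, tangent (θ₁.comp (blow i c)) ξ 𝓗 = tangent θ₁ ξ₁ (chartHom i v c 𝓗) :=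
      tangent_comp_blow i v c θ₁ ξ ξ₁ (by simp [ξ])
        (by simp [ξ, rev_ne])
    refine ⟨i, c, θ₁, 𝓖₁, w, ξ₁, ξ, hx, hG₁, hξ₁, hdvd, fun 𝓗 => ?_, hchain, ?_, fun k => ?_⟩
    · rw [closedFibre_chartHom, AlgHom.comp_apply]
    · rw [hchain, hG₁, tangent_mul, ht, hgG, hg0]
      ring
    · have hmem : θ₁ (X i) ∈ Ideal.span (Set.range fun k => θ₁.comp (blow i c) (X k)) :=
        Ideal.subset_span ⟨i, by simp [blow_X]⟩
      simp only [ξ, add_sub_cancel_right]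
      obtain ⟨q, hq⟩ := hdvd
      split_ifs
      · rw [hq]; exact Ideal.mul_mem_right _ _ hmem
      · rw [hq, mul_assoc, ← mul_add]; exact Ideal.mul_mem_right _ _ hmem
  -- The section lies in every smooth component, as one sees along the component itself.
  have hsec : ∀ 𝓩 𝓗, 𝓖 = 𝓩 * 𝓗 → (closedFibre 𝓩).order = 1 →
      constantCoeff (tangent (AlgHom.id K (Plane K)) (fun k => C (v k)) 𝓩) = 0 := by
    intro 𝓩 𝓗 hZH hz
    have hz0 : closedFibre 𝓩 ≠ 0 := by
      intro h; rw [h, MvPowerSeries.order_zero] at hz; exact absurd hz (by simp)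
    obtain ⟨ω, hω, hωz⟩ := exists_arc hz0 (one_le_order_iff.mp hz.ge)
    have hωG : ω (closedFibre 𝓖) = 0 := by rw [hZH, closedFibre_mul, map_mul, hωz, zero_mul]
    obtain ⟨-, -, -, -, -, -, ξ, -, -, -, -, -, -, ht, hmem⟩ := lift ω hω hωG
    have hh : ω (closedFibre 𝓗) ≠ 0 := by
      rw [hZH, closedFibre_mul] at hred
      exact hred.of_mul_right hω hωz
    rw [hZH, tangent_mul, hωz, zero_mul, zero_add] at ht
    rw [← constantCoeff_tangent ω ξ v hmem, (mul_eq_zero.mp ht).resolve_left hh, map_zero]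
  obtain ⟨i, c, θ₁, 𝓖₁, w, ξ₁, ξ, hx, hG₁, hξ₁, ⟨q, hq⟩, hθ₁, hchain, ht, hmem⟩ := lift θ hθ h0
  refine ⟨ξ, ht, hmem, fun 𝓩 𝓗 hZH hz => ?_⟩
  have hzc : constantCoeff (closedFibre 𝓩) = 0 := one_le_order_iff.mp hz.ge
  -- The strict transforms of the two components.
  obtain ⟨𝓩₁, hZ₁⟩ : X i ∣ chartHom i v c 𝓩 := by
    refine X_dvd_planeEps ?_ ?_
    · rw [closedFibre_chartHom]; exact X_dvd_blow hzc
    · have h1 : epsPart (chartHom i v c 𝓩) =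
          blow i c (tangent (AlgHom.id K (Plane K)) (fun k => C (v k)) 𝓩) := by
        simp [epsPart_chartHom, tangent, blow_C]
      rw [h1]
      exact X_dvd_blow (hsec 𝓩 𝓗 hZH hz)
  obtain ⟨z₁, hz₁, ⟨j, hj1, hj⟩, -⟩ := exists_strictTransform i c (m := 1) (by exact_mod_cast hz)
  have hzZ : closedFibre 𝓩₁ = z₁ := by
    have h1 := congrArg closedFibre hZ₁
    rw [closedFibre_chartHom, hz₁, closedFibre_mul, closedFibre_X, pow_one] at h1
    exact (mul_left_cancel₀ (X_prime i).ne_zero h1).symm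
  have hprod : X i ^ (M + 1) * 𝓖₁ = chartHom i v c 𝓗 * 𝓩₁ := by
    apply X_mul_cancel (i := i)
    rw [← mul_assoc, ← pow_succ', ← hG₁, hZH, map_mul, hZ₁]
    ring
  obtain ⟨𝓗₁, hH₁⟩ : X i ^ (M + 1) ∣ chartHom i v c 𝓗 :=
    X_pow_dvd_of_dvd_mul ⟨𝓖₁, hprod.symm⟩ (by rw [hzZ]; exact not_X_dvd_of_coeff hj)
  have hG₁' : X i * 𝓖₁ = 𝓩₁ * (X i * 𝓗₁) := by
    rw [hH₁, mul_assoc] at hprod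
    rw [X_pow_mul_cancel hprod]
    ring
  have hord : constantCoeff z₁ = 0 → (closedFibre 𝓩₁).order = 1 := by
    intro hc
    rw [hzZ]
    interval_cases j
    · rw [Finsupp.single_zero, MvPowerSeries.coeff_zero_eq_constantCoeff_apply] at hj
      exact absurd hc hj
    · exact order_eq_one hc (by rwa [constantCoeff_pderiv])
  have hunit : constantCoeff z₁ ≠ 0 → IsUnit (θ₁ z₁) := fun h => (isUnit_iff.mpr h).map θ₁
  rw [hchain, hchain, hθ₁, hθ₁, hZ₁, hH₁, tangent_mul, tangent_mul, tangent_X, tangent_X_pow_succ,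
    closedFibre_mul, closedFibre_mul, closedFibre_pow, closedFibre_X, hzZ, map_mul, map_mul,
    map_pow, hq]
  constructor
  · intro hne
    have hne1 : θ₁ z₁ ≠ 0 := right_ne_zero_of_mul hne
    have hdvd : θ₁ z₁ ∣ tangent θ₁ ξ₁ 𝓩₁ := by
      by_cases hc : constantCoeff z₁ = 0
      · have h1 := (hξ₁.dvd 𝓩₁ _ hG₁' (hord hc)).1
        rw [hzZ] at h1
        exact h1 hne1
      · exact (hunit hc).dvd
    obtain ⟨p, hp⟩ := hdvd
    exact ⟨p + q, by rw [hp]; ring⟩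
  · intro hz0
    have hz1 : θ₁ z₁ = 0 := (mul_eq_zero.mp hz0).resolve_left hx
    have hc : constantCoeff z₁ = 0 := by
      by_contra hc
      exact (hunit hc).ne_zero hz1
    have h1 := (hξ₁.dvd 𝓩₁ _ hG₁' (hord hc)).2
    rw [hzZ, closedFibre_mul, closedFibre_X, tangent_mul, closedFibre_X, tangent_X, map_mul] at h1
    obtain ⟨p, hp⟩ := h1 hz1
    rw [hq] at hp
    have hp' : tangent θ₁ ξ₁ 𝓗₁ = θ₁ (closedFibre 𝓗₁) * (p - q) := by
      apply mul_left_cancel₀ hx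
      linear_combination hp
    exact ⟨p - q + (M + 1) * q, by rw [hp']; ring⟩

/-- In an equisingular deformation of a reduced curve every branch is deformed. -/
theorem exists_branchLift [IsAlgClosed K] [CharZero K] {𝓖 : PlaneEps K} {a b : K}
    (h : IsEquisingularAlong 𝓖 a b) : ArcReduced (closedFibre 𝓖) → ∀ θ : Arc K, θ.Nonconst →
      θ (closedFibre 𝓖) = 0 → ∃ ξ, BranchLift 𝓖 ![a, b] θ ξ := by
  induction h with
  | smooth 𝓕 a b hs hmem =>
    intro _ θ _ h0
    have hmem' : 𝓕 ∈ sectionIdeal ((![a, b] : Fin 2 → K) 0) ((![a, b] : Fin 2 → K) 1) := hmem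
    exact exists_branchLift_smooth hs hmem' h0
  | node 𝓕 a b hn hmem =>
    intro _ θ _ h0
    have hmem' : 𝓕 ∈ sectionIdeal ((![a, b] : Fin 2 → K) 0) ((![a, b] : Fin 2 → K) 1) ^ 2 := hmem
    exact exists_branchLift_node hn hmem' h0
  | blowup 𝓕 a b m hm h2 _ _ 𝓖 s hG _ 𝓖' s' hG' _ ih ih' =>
    intro hred θ hθ h0
    refine exists_branchLift_blowup hm h2 hred (fun i c hic => ?_) hθ h0
    rcases eq_or_eq_rev 0 i with rfl | rfl
    · exact ⟨𝓖 c, ![0, s c], rfl, by rw [← chart_eq, hG], ih c⟩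
    · obtain rfl : c = 0 := hic.resolve_left (by decide)
      exact ⟨𝓖', ![s', 0], rfl, (chartInfty_eq a b 𝓕).symm.trans hG', ih'⟩

/-! ### Logarithmic derivatives of power series -/

theorem exists_eq_X_pow_mul_unit {f : PowerSeries K} (hf : f ≠ 0) :
    ∃ (n : ℕ) (u : PowerSeries K), PowerSeries.constantCoeff u ≠ 0 ∧ f = PowerSeries.X ^ n * u := by
  obtain ⟨u, hu⟩ := PowerSeries.X_pow_order_dvd (φ := f)
  refine ⟨_, u, fun h0 => ?_, hu⟩
  obtain ⟨u', rfl⟩ := PowerSeries.X_dvd_iff.mpr h0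
  have : PowerSeries.X ^ (f.order.toNat + 1) ∣ f := ⟨u', by rw [pow_succ, mul_assoc]; exact hu⟩
  rw [X_pow_dvd_iff_le_order, ← PowerSeries.coe_toNat_order hf] at this
  have h2 : f.order.toNat + 1 ≤ f.order.toNat := by exact_mod_cast this
  omega

theorem X_mul_derivative_X_pow_mul (n : ℕ) (u : PowerSeries K) :
    PowerSeries.X * PowerSeries.derivative K (PowerSeries.X ^ n * u) =
      PowerSeries.X ^ n * ((n : PowerSeries K) * u + PowerSeries.X * PowerSeries.derivative K u) := by
  rw [Derivation.leibniz, Derivation.leibniz_pow, PowerSeries.derivative_X]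
  simp only [smul_eq_mul, nsmul_eq_mul, mul_one]
  cases n with
  | zero => simp
  | succ n => rw [Nat.add_sub_cancel, pow_succ]; ring

theorem dvd_X_mul_derivative (f : PowerSeries K) :
    f ∣ PowerSeries.X * PowerSeries.derivative K f := by
  rcases eq_or_ne f 0 with rfl | hf
  · simp
  obtain ⟨n, u, hu, rfl⟩ := exists_eq_X_pow_mul_unit hf
  rw [X_mul_derivative_X_pow_mul]
  have : IsUnit u := by rwa [PowerSeries.isUnit_iff_constantCoeff, isUnit_iff_ne_zero]
  exact mul_dvd_mul_left _ this.dvd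

theorem X_mul_derivative_dvd [CharZero K] {f : PowerSeries K}
    (hc : PowerSeries.constantCoeff f = 0) : PowerSeries.X * PowerSeries.derivative K f ∣ f := by
  rcases eq_or_ne f 0 with rfl | hf
  · simp
  obtain ⟨n, u, hu, rfl⟩ := exists_eq_X_pow_mul_unit hf
  have hn : n ≠ 0 := by
    rintro rfl
    rw [pow_zero, one_mul] at hc
    exact hu hc
  rw [X_mul_derivative_X_pow_mul]
  have : IsUnit ((n : PowerSeries K) * u + PowerSeries.X * PowerSeries.derivative K u) := by
    rw [PowerSeries.isUnit_iff_constantCoeff, isUnit_iff_ne_zero]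
    simpa [hn] using hu
  exact mul_dvd_mul_left _ this.dvd

theorem not_dvd_derivative [CharZero K] {f : PowerSeries K} (hf : f ≠ 0)
    (hc : PowerSeries.constantCoeff f = 0) : ¬ f ∣ PowerSeries.derivative K f := by
  intro hd
  obtain ⟨a, ha⟩ := (X_mul_derivative_dvd hc).trans hd
  have h0 : PowerSeries.derivative K f ≠ 0 := by
    intro h
    have := X_mul_derivative_dvd hc
    rw [h, mul_zero, zero_dvd_iff] at this
    exact hf this
  have h1 : (1 : PowerSeries K) = PowerSeries.X * a := by
    apply mul_left_cancel₀ h0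
    linear_combination ha
  have := congrArg PowerSeries.constantCoeff h1
  simp at this

/-! ### Formal smooth curves -/

section Surface

variable {R : Type*} [CommRing R] [Algebra K R] (φ : R ≃ₐ[K] Plane K)

/-- A formal smooth curve is the zero locus of one equation, of order one, and has a regular
parametrization. -/
theorem IsFormalSmoothCurve.exists_parametrization {I : Ideal R} (hD : IsFormalSmoothCurve K I) :
    ∃ ω : Arc K, (∀ f, f ∈ I ↔ ω (φ f) = 0) ∧
      (∃ k, PowerSeries.constantCoeff (PowerSeries.derivative K (ω (X k))) ≠ 0) ∧
      (∃ y, I = Ideal.span {y}) ∧ ∀ y, I = Ideal.span {y} → (φ y).order = 1 := by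
  obtain ⟨e⟩ := hD
  let ω : Arc K := (e : (R ⧸ I) →ₐ[K] PowerSeries K).comp
    ((Ideal.Quotient.mkₐ K I).comp (φ.symm : Plane K →ₐ[K] R))
  have hω : ∀ f, ω (φ f) = e (Ideal.Quotient.mk I f) := by intro f; simp [ω]
  have hI : ∀ f, f ∈ I ↔ ω (φ f) = 0 := by
    intro f
    rw [hω, map_eq_zero_iff e e.injective, Ideal.Quotient.eq_zero_iff_mem]
  have hsurj : Function.Surjective ω := by
    intro q
    obtain ⟨f, hf⟩ := Ideal.Quotient.mk_surjective (e.symm q)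
    exact ⟨φ f, by rw [hω, hf, AlgEquiv.apply_symm_apply]⟩
  obtain ⟨u, hu⟩ := hsurj PowerSeries.X
  have huc : constantCoeff u = 0 := by rw [← constantCoeff_arc ω, hu, PowerSeries.constantCoeff_X]
  have hder : ∑ k, constantCoeff (pderiv K k u) *
      PowerSeries.constantCoeff (PowerSeries.derivative K (ω (X k))) = 1 := by
    have h1 := congrArg PowerSeries.constantCoeff (derivative_arc ω u)
    rw [hu, PowerSeries.derivative_X, map_one, map_sum] at h1
    rw [h1]
    exact Finset.sum_congr rfl fun k _ => by rw [map_mul, constantCoeff_arc]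
  choose c hc using fun k => (X_dvd_arc_X ω k).imp fun q hq => hq
  choose a ha using fun k => hsurj (c k)
  -- The linear part of `X k - a k * u` is independent of that of `u` for a suitable `k`.
  obtain ⟨z, hz0, hdet⟩ : ∃ z, ω z = 0 ∧
      constantCoeff (pderiv K 0 z) * constantCoeff (pderiv K 1 u)
        - constantCoeff (pderiv K 1 z) * constantCoeff (pderiv K 0 u) ≠ 0 := by
    have hker : ∀ k, ω (X k - a k * u) = 0 := by
      intro k; rw [map_sub, map_mul, ha, hu, hc]; ring
    have hp : ∀ j k, constantCoeff (pderiv K j (X k - a k * u)) =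
        constantCoeff (pderiv K j (X k)) - constantCoeff (a k) * constantCoeff (pderiv K j u) := by
      intro j k
      simp [Derivation.leibniz, huc]
    by_cases h1 : constantCoeff (pderiv K 1 u) = 0
    · have h0 : constantCoeff (pderiv K 0 u) ≠ 0 := by
        intro h0
        rw [Fin.sum_univ_two, h0, h1] at hder
        simp at hder
      refine ⟨_, hker 1, ?_⟩
      rw [hp, hp]
      simp [h1, h0, MvPowerSeries.pderiv_X_of_ne]
    · refine ⟨_, hker 0, ?_⟩
      rw [hp, hp]
      intro h
      apply h1
      simp [MvPowerSeries.pderiv_X_of_ne] at h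
      linear_combination h
  have hzc : constantCoeff z = 0 := by rw [← constantCoeff_arc ω, hz0, map_zero]
  have hzo : z.order = 1 := by
    by_cases h0 : constantCoeff (pderiv K 0 z) = 0
    · refine order_eq_one hzc (k := 1) fun h1 => hdet ?_
      rw [h0, h1]; ring
    · exact order_eq_one hzc h0
  have hspan := X_mem_span_of_det (f := ![z, u])
    (by intro j; fin_cases j <;> simp [hzc, huc]) hdet
  -- The kernel of the parametrization is generated by `z`, by the lemma of Nakayama.
  have hker : RingHom.ker ω ≤ Ideal.span {z} := by
    refine Submodule.le_of_le_smul_of_le_jacobson_bot (I := Ideal.span {u})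
      (IsNoetherian.noetherian _) ?_ ?_
    · rw [IsLocalRing.jacobson_eq_maximalIdeal ⊥ bot_ne_top, Ideal.span_singleton_le_iff_mem,
        IsLocalRing.mem_maximalIdeal, mem_nonunits_iff, isUnit_iff, not_not]
      exact huc
    · intro f hf
      have hfc : constantCoeff f = 0 := by
        rw [← constantCoeff_arc ω, show ω f = 0 from hf, map_zero]
      have hfm : f ∈ Ideal.span (Set.range ![z, u]) := by
        have : f ∈ maxIdeal K := mem_maxIdeal.mpr hfc
        rw [maxIdeal_eq_span] at this
        refine Ideal.span_le.mpr ?_ this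
        rintro _ ⟨k, rfl⟩
        exact hspan k
      obtain ⟨b, hb⟩ := Ideal.mem_span_range_iff_exists_fun.mp hfm
      rw [Fin.sum_univ_two] at hb
      change b 0 * z + b 1 * u = f at hb
      have hb1 : ω (b 1) = 0 := by
        have h1 := congrArg ω hb
        rw [map_add, map_mul, map_mul, hz0, hu, show ω f = 0 from hf, mul_zero, zero_add] at h1
        exact (mul_eq_zero.mp h1).resolve_right PowerSeries.X_ne_zero
      rw [← hb]
      refine Submodule.add_mem_sup (Ideal.mul_mem_left _ _ (Ideal.mem_span_singleton_self z)) ?_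
      rw [mul_comm]
      exact Submodule.smul_mem_smul (Ideal.mem_span_singleton_self u) hb1
  refine ⟨ω, hI, ?_, ⟨φ.symm z, ?_⟩, fun y hy => ?_⟩
  · by_contra! hall
    simp [hall] at hder
  · ext f
    rw [hI, Ideal.mem_span_singleton]
    constructor
    · intro hf
      obtain ⟨b, hb⟩ := Ideal.mem_span_singleton.mp (hker (show φ f ∈ RingHom.ker ω from hf))
      exact ⟨φ.symm b, φ.injective (by simp [hb])⟩
    · rintro ⟨b, rfl⟩
      rw [map_mul, map_mul, AlgEquiv.apply_symm_apply, hz0, zero_mul]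
  · have h1 : φ.symm z ∈ Ideal.span {y} := by
      rw [← hy, hI, AlgEquiv.apply_symm_apply, hz0]
    have h2 : ω (φ y) = 0 := by rw [← hI, hy]; exact Ideal.mem_span_singleton_self y
    obtain ⟨b, hb⟩ := Ideal.mem_span_singleton.mp h1
    have h3 : z = φ y * φ b := by rw [← map_mul, ← hb, AlgEquiv.apply_symm_apply]
    have h4 : (1 : ℕ∞) ≤ (φ y).order := by
      rw [one_le_order_iff, ← constantCoeff_arc ω, h2, map_zero]
    refine le_antisymm ?_ h4
    rw [← hzo, h3, MvPowerSeries.order_mul]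
    exact le_self_add

/-- The partial derivative with respect to a coordinate, as a derivation. -/
def partialDerivation (i : Fin 2) : Derivation K R R :=
  Derivation.mk' (φ.symm.toLinearMap ∘ₗ (pderiv K i).toLinearMap ∘ₗ φ.toLinearMap) (by
    intro a b
    simp [Derivation.leibniz])

/-- A derivation of the coordinate ring of the surface in terms of a coordinate system. -/
def transportDerivation (δ : Derivation K R R) : Derivation K (Plane K) (Plane K) :=
  Derivation.mk' (φ.toLinearMap ∘ₗ δ.toLinearMap ∘ₗ φ.symm.toLinearMap) (by
    intro a b
    simp [Derivation.leibniz])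

theorem transportDerivation_apply (δ : Derivation K R R) (f : R) :
    transportDerivation φ δ (φ f) = φ (δ f) := by
  change φ (δ (φ.symm (φ f))) = _
  rw [AlgEquiv.symm_apply_apply]

theorem equianalyticIdeal_le_logEquianalyticIdeal {I : Ideal R} (hD : IsFormalSmoothCurve K I)
    (F : R) : equianalyticIdeal φ F ≤ logEquianalyticIdeal φ I F := by
  obtain ⟨ω, hω, -, ⟨y, hy⟩, hord⟩ := hD.exists_parametrization φ
  have hyc : constantCoeff (φ y) = 0 := one_le_order_iff.mp (hord y hy).ge
  intro f hf
  refine Submodule.mem_colon.mpr fun d hd => ?_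
  have hd' : d ∈ I := hd
  rw [hy, Ideal.mem_span_singleton] at hd'
  obtain ⟨b, rfl⟩ := hd'
  suffices h : y * f ∈ relEquianalyticIdeal φ I F by
    rw [smul_eq_mul, show f * (y * b) = b * (y * f) by ring]
    exact Ideal.mul_mem_left _ _ h
  have hle : equianalyticIdeal φ F ≤
      Submodule.comap (LinearMap.mulLeft R y) (relEquianalyticIdeal φ I F) := by
    have hpart : ∀ i, y * partialDeriv φ i F ∈ relEquianalyticIdeal φ I F := by
      intro i
      refine Ideal.mem_sup_left (Ideal.subset_span ⟨y • partialDerivation φ i, ?_, ?_, rfl⟩)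
      · intro g _
        rw [hy]
        exact Ideal.mul_mem_right _ _ (Ideal.mem_span_singleton_self y)
      · intro g _
        change constantCoeff (φ (y * _)) = 0
        rw [map_mul, map_mul, hyc, zero_mul]
    refine Submodule.span_le.mpr ?_
    rintro g (rfl | rfl | rfl)
    · exact hpart 0
    · exact hpart 1
    · exact Ideal.mem_sup_right (Ideal.mul_mem_left _ _ (Ideal.mem_span_singleton_self _))
  exact hle hf

theorem exists_derivation_of_mem_relEquianalyticIdeal {I : Ideal R} {F g : R}
    (hg : g ∈ relEquianalyticIdeal φ I F) :
    ∃ (δ : Derivation K R R) (a : R), (∀ f ∈ I, δ f ∈ I) ∧ g = δ F + a * F := by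
  obtain ⟨p, hp, q, hq, rfl⟩ := Submodule.mem_sup.mp hg
  obtain ⟨a, rfl⟩ := Ideal.mem_span_singleton'.mp hq
  suffices h : ∃ δ : Derivation K R R, (∀ f ∈ I, δ f ∈ I) ∧ p = δ F by
    obtain ⟨δ, hδ, rfl⟩ := h
    exact ⟨δ, a, hδ, rfl⟩
  clear hg
  induction hp using Submodule.span_induction with
  | mem x hx =>
    obtain ⟨δ, hδ, -, rfl⟩ := hx
    exact ⟨δ, hδ, rfl⟩
  | zero => exact ⟨0, fun f _ => by simp, by simp⟩
  | add x y hx hy hx' hy' =>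
    obtain ⟨δ₁, h₁, rfl⟩ := hx'
    obtain ⟨δ₂, h₂, rfl⟩ := hy'
    exact ⟨δ₁ + δ₂, fun f hf => I.add_mem (h₁ f hf) (h₂ f hf), rfl⟩
  | smul b x hx hx' =>
    obtain ⟨δ, h, rfl⟩ := hx'
    exact ⟨b • δ, fun f hf => I.mul_mem_left b (h f hf), rfl⟩

/-- The union of a reduced curve and of a smooth curve not contained in it is reduced. -/
theorem arcReduced_mul_of_order_eq_one {z f : Plane K} (hz : z.order = 1) (hf : ArcReduced f)
    (h : ∀ θ : Arc K, θ.Nonconst → θ z = 0 → θ f ≠ 0) : ArcReduced (z * f) := by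
  intro θ hθ h0
  rw [map_mul] at h0
  by_cases hz0 : θ z = 0
  · obtain ⟨k, hk⟩ := exists_pderiv_ne_zero hz
    refine ⟨k, ?_⟩
    have hu : IsUnit (θ (pderiv K k z)) := (isUnit_iff.mpr hk).map θ
    rw [Derivation.leibniz]
    simpa [hz0] using ⟨h θ hθ hz0, hu.ne_zero⟩
  · have hf0 := (mul_eq_zero.mp h0).resolve_left hz0
    obtain ⟨k, hk⟩ := hf θ hθ hf0
    refine ⟨k, ?_⟩
    rw [Derivation.leibniz]
    simpa [hf0] using ⟨hz0, hk⟩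

/-- An arc in a smooth curve has the same ideal as its regular parametrization. -/
theorem Arc.ker_eq_of_order_eq_one {z : Plane K} (hz : z.order = 1) {ω : Arc K}
    (hω : RingHom.ker ω = Ideal.span {z}) {θ : Arc K} (hθ : θ.Nonconst) (h : θ z = 0) :
    RingHom.ker θ = RingHom.ker ω := by
  refine (Arc.eq_ker hθ ?_ ?_).symm
  · rw [hω, Ne, Ideal.span_singleton_eq_bot]
    rintro rfl
    rw [MvPowerSeries.order_zero] at hz
    exact absurd hz (by simp)
  · rw [hω, Ideal.span_singleton_le_iff_mem]
    exact h

theorem isRadical_span_map {F : R} (h : IsReduced (R ⧸ Ideal.span {F})) :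
    (Ideal.span {φ F}).IsRadical := by
  have h1 : (Ideal.span {F}).IsRadical := (Ideal.isRadical_iff_quotient_reduced _).mpr h
  rintro f ⟨n, hn⟩
  rw [Ideal.mem_span_singleton] at hn ⊢
  have h2 : F ∣ φ.symm f ^ n := by
    rw [← map_dvd_iff φ, map_pow, AlgEquiv.apply_symm_apply]
    exact hn
  have h3 := h1 ⟨n, Ideal.mem_span_singleton.mpr h2⟩
  rw [Ideal.mem_span_singleton, ← map_dvd_iff φ, AlgEquiv.apply_symm_apply] at h3
  exact h3

theorem ker_eq_span {I : Ideal R} {ω : Arc K} (hω : ∀ f, f ∈ I ↔ ω (φ f) = 0) {y : R}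
    (hy : I = Ideal.span {y}) : RingHom.ker ω = Ideal.span {φ y} := by
  ext f
  obtain ⟨f, rfl⟩ := φ.surjective f
  rw [Ideal.mem_span_singleton, map_dvd_iff φ, ← Ideal.mem_span_singleton, ← hy, hω]
  rfl

theorem arcReduced_mul [CharZero K] {I : Ideal R} {ω : Arc K} (hω : ∀ f, f ∈ I ↔ ω (φ f) = 0)
    {y F : R} (hy : I = Ideal.span {y}) (hord : (φ y).order = 1)
    (hred : IsReduced (R ⧸ Ideal.span {F})) (hFD : F ∉ I) : ArcReduced (φ y * φ F) := by
  have hF : φ F ≠ 0 := by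
    intro h
    exact hFD (by rw [hω, h, map_zero])
  refine arcReduced_mul_of_order_eq_one hord
    (arcReduced_of_isRadical hF (isRadical_span_map φ hred)) fun θ hθ hθy hθF => hFD ?_
  rw [hω]
  have h1 : φ F ∈ RingHom.ker θ := hθF
  rw [Arc.ker_eq_of_order_eq_one hord (ker_eq_span φ hω hy) hθ hθy] at h1
  exact h1

theorem logEquianalyticIdeal_subset_logEquisingular [CharZero K] {I : Ideal R}
    (hD : IsFormalSmoothCurve K I) {F : R} (hred : IsReduced (R ⧸ Ideal.span {F}))
    (hFD : F ∉ I) : (logEquianalyticIdeal φ I F : Set R) ⊆ logEquisingular φ I F := by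
  obtain ⟨ω, hω, -, ⟨y, hy⟩, hord⟩ := hD.exists_parametrization φ
  intro h hh d hd
  have hmem : h * d ∈ relEquianalyticIdeal φ I F := Submodule.mem_colon.mp hh d hd
  obtain ⟨δ, a, hδ, heq⟩ := exists_derivation_of_mem_relEquianalyticIdeal φ hmem
  refine ⟨y, hy, ?_⟩
  have hyc : constantCoeff (φ y) = 0 := one_le_order_iff.mp (hord y hy).ge
  have hG := arcReduced_mul φ hω hy (hord y hy) hred hFD
  have hne : φ y * φ F ≠ 0 := by
    refine mul_ne_zero ?_ ?_
    · intro h0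
      have := hord y hy
      rw [h0, MvPowerSeries.order_zero] at this
      exact absurd this (by simp)
    · intro h0
      exact hFD (by rw [hω, h0, map_zero])
  have hyI : δ y ∈ I := hδ y (by rw [hy]; exact Ideal.mem_span_singleton_self y)
  rw [hy, Ideal.mem_span_singleton] at hyI
  obtain ⟨b, hb⟩ := hyI
  have key := isEquisingular_of_derivation (hG.resolvable hne (by rw [map_mul, hyc, zero_mul]))
    (transportDerivation φ δ) (φ b) (φ a)
    (by rw [transportDerivation_apply, hb, map_mul, mul_comm])
  rwa [transportDerivation_apply, ← map_mul, ← map_add, ← heq] at key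

end Surface

/-! ### From equisingular to equiclassical -/

/-- If the union of the trivial deformation of a smooth curve `z = 0` and of a deformation of the
curve `f = 0` is equisingular along a section, then this section is trivial: it moves neither along
the smooth curve, by the constancy of the intersection number of the components, nor out of it. -/
theorem section_eq_zero [CharZero K] {z f g : Plane K} {v : Fin 2 → K} {ω : Arc K}
    {ξ : Fin 2 → PowerSeries K} (hξ : BranchLift (family z 0 * family f g) v ω ξ)
    (hz : z.order = 1) (hωz : ω z = 0) (hωg : ω g = 0) (hωf : ω f ≠ 0)
    (hf : constantCoeff f = 0)
    (hω : ∃ k, PowerSeries.constantCoeff (PowerSeries.derivative K (ω (X k))) ≠ 0) :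
    v = 0 := by
  have ht := hξ.tangent_eq
  rw [tangent_mul, closedFibre_family, closedFibre_family, hωz, zero_mul, zero_add] at ht
  have hz' := (mul_eq_zero.mp ht).resolve_left hωf
  have hdvd := (hξ.dvd _ _ rfl (by rwa [closedFibre_family])).2
  simp only [tangent, closedFibre_family, epsPart_family, hωg, map_zero, zero_add] at hz' hdvd
  replace hdvd := hdvd hωz
  obtain ⟨i, hi⟩ := exists_pderiv_ne_zero hz
  have hui : IsUnit (ω (pderiv K i z)) := (isUnit_iff.mpr hi).map ω
  have hdz := derivative_arc ω z
  have hdf := derivative_arc ω f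
  rw [hωz, map_zero, sum_eq_add_rev i] at hdz
  rw [sum_eq_add_rev i] at hz' hdf hdvd
  set x := fun k => PowerSeries.derivative K (ω (X k)) with hx
  change 0 = ω (pderiv K i z) * x i + ω (pderiv K i.rev z) * x i.rev at hdz
  change _ = ω (pderiv K i f) * x i + ω (pderiv K i.rev f) * x i.rev at hdf
  have hur : IsUnit (x i.rev) := by
    rw [PowerSeries.isUnit_iff_constantCoeff, isUnit_iff_ne_zero]
    intro h0
    have h1 := congrArg PowerSeries.constantCoeff hdz
    rw [map_zero, map_add, map_mul, map_mul, h0, mul_zero, add_zero] at h1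
    have h2 := (mul_eq_zero.mp h1.symm).resolve_left (by rw [constantCoeff_arc]; exact hi)
    obtain ⟨k, hk⟩ := hω
    rcases eq_or_eq_rev i k with rfl | rfl
    · exact hk h2
    · exact hk h0
  obtain ⟨l, hl⟩ : x i.rev ∣ ξ i.rev := hur.dvd
  have hli : ξ i = x i * l := by
    apply hui.mul_left_cancel
    rw [hl] at hz'
    linear_combination hz' + l * hdz
  have hlc : PowerSeries.constantCoeff l = 0 := by
    by_contra hne
    have hul : IsUnit l := by rwa [PowerSeries.isUnit_iff_constantCoeff, isUnit_iff_ne_zero]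
    rw [hl, hli] at hdvd
    have h1 : x i * l * ω (pderiv K i f) + x i.rev * l * ω (pderiv K i.rev f) =
        l * PowerSeries.derivative K (ω f) := by
      rw [hdf]; ring
    rw [h1, hul.dvd_mul_left] at hdvd
    exact not_dvd_derivative hωf (by rw [constantCoeff_arc, hf]) hdvd
  funext k
  have h1 := constantCoeff_eq_zero_of_mem_span ω (hξ.sub_mem k)
  have h2 : PowerSeries.constantCoeff (ξ k) = 0 := by
    rcases eq_or_eq_rev i k with rfl | rfl
    · rw [hli, map_mul, hlc, mul_zero]
    · rw [hl, map_mul, hlc, mul_zero]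
  rw [map_sub, h2, PowerSeries.constantCoeff_C, zero_sub, neg_eq_zero] at h1
  exact h1

/-- If a branch `θ` of `f = 0` is deformed along the trivial section inside `f + ε g = 0`, so that
its intersection with the smooth curve `z = 0` does not change, then `g / z` restricted to the
branch lies in the ideal of the partial derivatives of `f`. -/
theorem mem_span_of_branchLift [CharZero K] {z f g h b : Plane K} {θ : Arc K}
    {ξ : Fin 2 → PowerSeries K} (hξ : BranchLift (family z 0 * family f g) 0 θ ξ)
    (hz : z.order = 1) (hθz : θ z ≠ 0) (hθf : θ f = 0) (hg : z * h = g * b) :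
    θ h ∈ Ideal.span (Set.range fun k => θ (pderiv K k f)) := by
  have ht := hξ.tangent_eq
  rw [tangent_mul, closedFibre_family, closedFibre_family, hθf, zero_mul, add_zero] at ht
  have hf' := (mul_eq_zero.mp ht).resolve_left hθz
  have hdvd := (hξ.dvd _ _ rfl (by rwa [closedFibre_family])).1
  simp only [tangent, closedFibre_family, epsPart_family, map_zero, zero_add] at hf' hdvd
  obtain ⟨l, hl⟩ := hdvd hθz
  have hzc : constantCoeff z = 0 := one_le_order_iff.mp hz.ge
  obtain ⟨r, hr⟩ := exists_pderiv_ne_zero hz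
  obtain ⟨i, rfl⟩ : ∃ i : Fin 2, r = i.rev := ⟨r.rev, (Fin.rev_rev r).symm⟩
  have hur : IsUnit (θ (pderiv K i.rev z)) := (isUnit_iff.mpr hr).map θ
  have hdz := derivative_arc θ z
  have hdf := derivative_arc θ f
  rw [hθf, map_zero, sum_eq_add_rev i] at hdf
  rw [sum_eq_add_rev i] at hdz hf' hl
  set S := Ideal.span (Set.range fun k => θ (pderiv K k f)) with hS
  have hSk : ∀ k, θ (pderiv K k f) ∈ S := fun k => Ideal.subset_span ⟨k, rfl⟩
  -- `W` is the Jacobian determinant of `z` and `f`.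
  set W := θ (pderiv K i.rev z) * θ (pderiv K i f) - θ (pderiv K i z) * θ (pderiv K i.rev f)
    with hW
  have hWS : W ∈ S := S.sub_mem (S.mul_mem_left _ (hSk _)) (S.mul_mem_left _ (hSk _))
  have hWx : W * PowerSeries.derivative K (θ (X i)) =
      -(θ (pderiv K i.rev f) * PowerSeries.derivative K (θ z)) := by
    rw [hW]
    linear_combination θ (pderiv K i.rev f) * hdz - θ (pderiv K i.rev z) * hdf
  have hWξ : θ (pderiv K i.rev z) * θ g = -(W * ξ i) - θ (pderiv K i.rev f) * (θ z * l) := by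
    rw [hW]
    linear_combination θ (pderiv K i.rev z) * hf' - θ (pderiv K i.rev f) * hl
  -- `X i` and `z` generate the maximal ideal.
  have hmax : ∀ k, θ (X k) ∈ Ideal.span {θ (X i), θ z} := by
    intro k
    rcases eq_or_eq_rev i k with rfl | rfl
    · exact Ideal.subset_span (by simp)
    · obtain ⟨q, hq⟩ := exists_eq_sum_of_constantCoeff_eq_zero hzc
      have hqc : constantCoeff (q i.rev) ≠ 0 := by
        rw [hq, sum_eq_add_rev i] at hr
        simpa [Derivation.leibniz, MvPowerSeries.pderiv_X_of_ne (rev_ne i).symm] using hr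
      have hqu : IsUnit (θ (q i.rev)) := (isUnit_iff.mpr hqc).map θ
      rw [← Ideal.unit_mul_mem_iff_mem _ hqu]
      have h1 : θ (q i.rev) * θ (X i.rev) = θ z - θ (q i) * θ (X i) := by
        have h2 := congrArg θ hq
        rw [sum_eq_add_rev i, map_add, map_mul, map_mul] at h2
        linear_combination -h2
      rw [h1]
      exact Ideal.sub_mem _ (Ideal.subset_span (by simp))
        (Ideal.mul_mem_left _ _ (Ideal.subset_span (by simp)))
  have hξi : ξ i ∈ Ideal.span {θ (X i), θ z} := by
    have h1 := hξ.sub_mem i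
    rw [Pi.zero_apply, map_zero, sub_zero] at h1
    refine Ideal.span_le.mpr ?_ h1
    rintro _ ⟨k, rfl⟩
    exact hmax k
  obtain ⟨p, s, hps⟩ := Ideal.mem_span_pair.mp hξi
  -- In characteristic zero `x` is a multiple of `t (dx/dt)`.
  obtain ⟨e, he⟩ := X_mul_derivative_dvd (K := K) (PowerSeries.X_dvd_iff.mp (X_dvd_arc_X θ i))
  obtain ⟨d, hd⟩ := dvd_X_mul_derivative (θ z)
  have key : θ (pderiv K i.rev z) * θ g = θ z *
      (p * e * d * θ (pderiv K i.rev f) - s * W - l * θ (pderiv K i.rev f)) := by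
    rw [hWξ, ← hps]
    linear_combination (-(p * W)) * he - (p * e * PowerSeries.X) * hWx
      + (p * e * θ (pderiv K i.rev f)) * hd
  have hzh : θ z * (θ (pderiv K i.rev z) * θ h) = θ z *
      (θ b * (p * e * d * θ (pderiv K i.rev f) - s * W - l * θ (pderiv K i.rev f))) := by
    have h1 := congrArg θ hg
    rw [map_mul, map_mul] at h1
    linear_combination θ (pderiv K i.rev z) * h1 + θ b * key
  rw [← Ideal.unit_mul_mem_iff_mem _ hur, mul_left_cancel₀ hθz hzh]
  exact S.mul_mem_left _ (S.sub_mem (S.sub_mem (S.mul_mem_left _ (hSk _)) (S.mul_mem_left _ hWS))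
    (S.mul_mem_left _ (hSk _)))

theorem logEquisingular_subset_equiclassicalIdeal [IsAlgClosed K] [CharZero K] {R : Type*}
    [CommRing R] [Algebra K R] (φ : R ≃ₐ[K] Plane K) {I : Ideal R} (hD : IsFormalSmoothCurve K I)
    {F : R} (hred : IsReduced (R ⧸ Ideal.span {F})) (hFD : F ∉ I) :
    logEquisingular φ I F ⊆ equiclassicalIdeal φ F := by
  obtain ⟨ω, hω, hreg, ⟨y₀, hy₀⟩, hord⟩ := hD.exists_parametrization φ
  intro h hh
  have hy₀I : y₀ ∈ I := by rw [hy₀]; exact Ideal.mem_span_singleton_self y₀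
  obtain ⟨y, hy, v₀, v₁, hes⟩ := hh y₀ hy₀I
  have hF : F ≠ 0 := by rintro rfl; exact hFD I.zero_mem
  have hz := hord y hy
  have hωy : ω (φ y) = 0 := by rw [← hω, hy]; exact Ideal.mem_span_singleton_self y
  have hωF : ω (φ F) ≠ 0 := fun h => hFD ((hω F).mpr h)
  have hG : ArcReduced (closedFibre (family (φ y) 0 * family (φ F) (φ (h * y₀)))) := by
    rw [closedFibre_mul, closedFibre_family, closedFibre_family]
    exact arcReduced_mul φ hω hy hz hred hFD
  have hlift := exists_branchLift hes hG
  simp only [closedFibre_mul, closedFibre_family, map_mul] at hlift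
  have hωn : ω.Nonconst := by
    obtain ⟨k, hk⟩ := hreg
    exact ⟨k, fun h0 => hk (by rw [h0, map_zero, map_zero])⟩
  obtain ⟨ξω, hξω⟩ := hlift ω hωn (by rw [hωy, zero_mul])
  refine mem_equiclassicalIdeal φ hF (isRadical_span_map φ hred) fun θ hθ hθF => ?_
  have hFc : constantCoeff (φ F) = 0 := by rw [← constantCoeff_arc θ, hθF, map_zero]
  have hv := section_eq_zero hξω hz hωy
    (by rw [map_mul, (hω y₀).mp hy₀I, mul_zero]) hωF hFc hreg
  obtain ⟨ξ, hξ⟩ := hlift θ hθ (by rw [hθF, mul_zero])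
  rw [hv] at hξ
  have hθy : θ (φ y) ≠ 0 := by
    intro h0
    have h1 : φ F ∈ RingHom.ker θ := hθF
    rw [Arc.ker_eq_of_order_eq_one hz (ker_eq_span φ hω hy) hθ h0] at h1
    exact hωF h1
  have hyI : y ∈ Ideal.span {y₀} := by rw [← hy₀, hy]; exact Ideal.mem_span_singleton_self y
  obtain ⟨b, hb⟩ := Ideal.mem_span_singleton.mp hyI
  refine mem_span_of_branchLift hξ hz hθy hθF (b := φ b) ?_
  rw [← map_mul, ← map_mul, ← map_mul, hb]
  congr 1
  ring

end Curves

end LogCurve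

end

theorem theorem4 {K : Type*} [Field K] [IsAlgClosed K] [CharZero K]
    {R : Type*} [CommRing R] [Algebra K R] (φ : R ≃ₐ[K] LogCurve.Plane K)
    (I : Ideal R) (hD : LogCurve.IsFormalSmoothCurve K I)
    (F : R) (hred : IsReduced (R ⧸ Ideal.span {F})) (hFD : F ∉ I) :
    (LogCurve.equianalyticIdeal φ F : Set R) ⊆ LogCurve.logEquianalyticIdeal φ I F ∧
      (LogCurve.logEquianalyticIdeal φ I F : Set R) ⊆ LogCurve.logEquisingular φ I F ∧
      LogCurve.logEquisingular φ I F ⊆ LogCurve.equiclassicalIdeal φ F := by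
  exact ⟨LogCurve.equianalyticIdeal_le_logEquianalyticIdeal φ hD F,
    LogCurve.logEquianalyticIdeal_subset_logEquisingular φ hD hred hFD,
    LogCurve.logEquisingular_subset_equiclassicalIdeal φ hD hred hFD⟩
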